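/- Let $N\ge 1$, $T>0$, $\mathbb T^N=\mathbb R^N/\mathbb Z^N$, $Q=\mathbb T^N\times(0,T)$. Let $\gamma,\gamma'>1$ with $\frac1\gamma+\frac1{\gamma'}=1$, and let $0<\alpha<\gamma'/N$. Assume: * $H:\mathbb R^N\to\mathbb R$ is convex and of class $C^3$, and for some $C_H>0$, $C_H^{-1}|p|^\gamma\le H(p)\le C_H(|p|^\gamma+1)$ for all $p\in\mathbb R^N$; let $L(q)=\sup_{p\in\mathbb R^N}\{p\cdot q-H(p)\}$; * $f:\mathbb T^N\times[0,+\infty)\to[0,+\infty)$ is continuous, differentiable in its second variable, and for some $c_f$, $|\partial_m f(x,m)|\le c_f(m+1)^{\alpha-1}$ for all $(x,m)$; let $F(x,m)=\int_0^m f(x,\sigma)\,d\sigma$ for $m\ge0$; * $m_0,u_T\in C^2(\mathbb T^N)$, $m_0>0$, $\int_{\mathbb T^N}m_0\,dx=1$. Let $\mathcal K$ be the set of pairs $(m,w)\in L^{\alpha+1}(Q)\times L^1(Q;\mathbb R^N)$ with $m\ge0$ a.e., $|w|^{\gamma'}m^{1-\gamma'}\in L^1(Q)$ and $$\int_Q\big(m\,\varphi_t+w\cdot\nabla\varphi+m\,\Delta\varphi\big)\,dx\,dt+\int_{\mathbb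 T^N}m_0(x)\varphi(x,0)\,dx=0\qquad\forall\varphi\in C_0^\infty(\mathbb T^N\times[0,T)),$$ that is, $m_t-\Delta m+\operatorname{div}w=0$ and $m(\cdot,0)=m_0$ in the sense of distributions. On $\mathcal K$ define $$\mathcal E(m,w)=\int_Q\Big(mL\big(-\tfrac wm\big)-F(x,m)\Big)dx\,dt+\int_{\mathbb T^N}u_T(x)\,m(x,T)\,dx.$$ Here $|w|^{\gamma'}m^{1-\gamma'}$ and $mL(-w/m)$ are $0$ where $(m,w)=(0,0)$ and $+\infty$ where $m=0$, $w\ne0$; and $m(\cdot,T)$ is the trace of $m$ at time $T$, i.e. the value at $T$ of the weakly continuous curve $[0,T]\to\mathcal P(\mathbb T^N)$ of probability measures that equals $m(\cdot,t)\,dx$ for a.e. $t$. Then: 1. For every $(m,w)\in\mathcal K$ this trace exists and is unique, $mL(-w/m)$ is finite a.e., and $mL(-w/m)$ and $F(x,m)$ are integrable on $Q$; so $\mathcal E(m,w)$ is a well-defined real number. 2. There exists $c\in\mathbb R$ such that $c=\inf_{(m,w)\in\mathcal K}\mathcal E(m,w)$; in particular $\mathcal K\neq\emptyset$. 3. For every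 $e\in\mathbb R$ there is a constant $c_1$ (depending on $e$ and the data) such that for every sequence $(m^n,w^n)\in\mathcal K$ with $\mathcal E(m^n,w^n)\le e$ for all $n\in\mathbb N$, $$\int_Q(m^n)^{\alpha+1}\,dx\,dt+\int_Q\frac{|w^n|^{\gamma'}}{(m^n)^{\gamma'-1}}\,dx\,dt\le c_1\qquad\text{for all }n\in\mathbb N.$$ -/

import Mathlib

open MeasureTheory Set Filter Topology
open scoped ENNReal ContDiff

noncomputable section

namespace MFG

/-- The Euclidean space in which gradients, momenta and fluxes take their values. -/
abbrev Vec (N : ℕ) : Type := EuclideanSpace ℝ (Fin N)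

/-- The flat torus `ℝ^N / ℤ^N`, with its Haar measure of total mass one as `volume`. -/
abbrev Torus (N : ℕ) : Type := UnitAddTorus (Fin N)

/-- The quotient map from `ℝ^N` onto the torus. -/
def toTorus {N : ℕ} (y : Vec N) : Torus N := fun i => (y i : UnitAddCircle)

/-- A function on the torus is of class `C^n` if its periodic lift to `ℝ^N` is. -/
def TorusContDiff {N : ℕ} (n : WithTop ℕ∞) (u : Torus N → ℝ) : Prop :=
  ContDiff ℝ n (fun y : Vec N => u (toTorus y))

/-- Gradient of a function on the torus, computed in the local coordinate `v ↦ x + v`. -/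
def grad {N : ℕ} (u : Torus N → ℝ) (x : Torus N) : Vec N :=
  gradient (fun v : Vec N => u (x + toTorus v)) 0

/-- Laplacian of a function on the torus, computed in the local coordinate `v ↦ x + v`. -/
def lap {N : ℕ} (u : Torus N → ℝ) (x : Torus N) : ℝ :=
  Laplacian.laplacian (fun v : Vec N => u (x + toTorus v)) 0

/-- Lebesgue measure `dx dt` on the cylinder `Q = 𝕋^N × (0, T)`. -/
def cyl (N : ℕ) (T : ℝ) : Measure (Torus N × ℝ) :=
  (volume : Measure (Torus N)).prod (volume.restrict (Ioo 0 T))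

/-- Test functions in `C_0^∞(𝕋^N × [0, T))`: smooth up to time `0`, and zero near time `T`. They
are represented by smooth functions on `𝕋^N × ℝ`; the values at negative times are never used. -/
def IsTest {N : ℕ} (T : ℝ) (φ : Torus N × ℝ → ℝ) : Prop :=
  ContDiff ℝ ∞ (fun y : Vec N × ℝ => φ (toTorus y.1, y.2)) ∧
    ∃ τ < T, ∀ x t, τ ≤ t → φ (x, t) = 0

/-- `m_t - Δ m + div w = 0` in `Q` with `m(·, 0) = m₀`, tested against `C_0^∞(𝕋^N × [0, T))`.
The gradient of `m` is a distributional one, so that `-∫ ∇m · ∇φ` is `∫ m Δφ`. -/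
def SolvesFP {N : ℕ} (T : ℝ) (m₀ : Torus N → ℝ) (m : Torus N × ℝ → ℝ)
    (w : Torus N × ℝ → Vec N) : Prop :=
  ∀ φ : Torus N × ℝ → ℝ, IsTest T φ →
    (∫ z, (m z * deriv (fun s => φ (z.1, s)) z.2
        + inner ℝ (w z) (grad (fun x => φ (x, z.2)) z.1)
        + m z * lap (fun x => φ (x, z.2)) z.1) ∂(cyl N T))
      + ∫ x, m₀ x * φ (x, 0) = 0

/-- `|w|^{γ'} m^{1-γ'}`, equal to `0` if `(m, w) = (0, 0)` and to `+∞` if `w ≠ 0` and `m ≤ 0`. -/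
def kinetic {N : ℕ} (γ' m : ℝ) (w : Vec N) : ℝ≥0∞ :=
  open Classical in
  if 0 < m then ENNReal.ofReal (‖w‖ ^ γ' * m ^ (1 - γ')) else if w = 0 then 0 else ⊤

/-- The constraint set `𝒦 ⊂ L^{α+1}(Q) × L^1(Q)`. -/
def K {N : ℕ} (T α γ' : ℝ) (m₀ : Torus N → ℝ) :
    Set ((Torus N × ℝ → ℝ) × (Torus N × ℝ → Vec N)) :=
  {mw | MemLp mw.1 (ENNReal.ofReal (α + 1)) (cyl N T) ∧
    Integrable mw.2 (cyl N T) ∧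
    (∫⁻ z, kinetic γ' (mw.1 z) (mw.2 z) ∂(cyl N T)) < ⊤ ∧
    (∀ᵐ z ∂(cyl N T), 0 ≤ mw.1 z) ∧
    SolvesFP T m₀ mw.1 mw.2}

/-- The Legendre transform `L(q) = sup_p (p · q - H(p))`. -/
def legendre {N : ℕ} (H : Vec N → ℝ) (q : Vec N) : ℝ := ⨆ p : Vec N, (inner ℝ p q - H p)

/-- `m L(-w/m)`, equal to `0` if `(m, w) = (0, 0)` and to `+∞` if `w ≠ 0` and `m ≤ 0`. -/
def runningCost {N : ℕ} (H : Vec N → ℝ) (m : ℝ) (w : Vec N) : EReal :=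
  open Classical in
  if 0 < m then ((m * legendre H (-(m⁻¹ • w)) : ℝ) : EReal) else if w = 0 then 0 else ⊤

/-- `F(x, m) = ∫_0^m f(x, σ) dσ`; only its values at `m ≥ 0` matter. -/
def primitive {N : ℕ} (f : Torus N → ℝ → ℝ) (x : Torus N) (m : ℝ) : ℝ := ∫ σ in (0 : ℝ)..m, f x σ

/-- `μ` is the trace `m(·, T)`: the value at time `T` of the weakly continuous version
`[0, T] → 𝒫(𝕋^N)` of the curve `t ↦ m(·, t) dx`. -/
def IsTerminalTrace {N : ℕ} (T : ℝ) (m : Torus N × ℝ → ℝ)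
    (μ : ProbabilityMeasure (Torus N)) : Prop :=
  ∃ ρ : ℝ → ProbabilityMeasure (Torus N), ContinuousOn ρ (Icc 0 T) ∧
    (∀ᵐ t ∂(volume.restrict (Ioo 0 T)), (ρ t : Measure (Torus N)) =
      (volume : Measure (Torus N)).withDensity (fun x => ENNReal.ofReal (m (x, t)))) ∧
    ρ T = μ

/-- The trace `m(·, T)` as a measure (zero if there is no trace). -/
def terminalMeasure {N : ℕ} (T : ℝ) (m : Torus N × ℝ → ℝ) : Measure (Torus N) :=
  open Classical in
  if h : ∃ μ : ProbabilityMeasure (Torus N), IsTerminalTrace T m μ then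
    (h.choose : Measure (Torus N)) else 0

/-- The energy `∫_Q (m L(-w/m) - F(x, m)) dx dt + ∫ u_T(x) m(x, T) dx`. -/
def energy {N : ℕ} (T : ℝ) (H : Vec N → ℝ) (f : Torus N → ℝ → ℝ) (uT : Torus N → ℝ)
    (m : Torus N × ℝ → ℝ) (w : Torus N × ℝ → Vec N) : ℝ :=
  (∫ z, ((runningCost H (m z) (w z)).toReal - primitive f z.1 (m z)) ∂(cyl N T))
    + ∫ x, uT x ∂(terminalMeasure T m)

/-- All the terms of the energy of `(m, w)` are meaningful: the trace `m(·, T)` exists and is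
unique, `m L(-w/m)` is finite almost everywhere, and both integrands are integrable on `Q`. -/
def EnergyWellDefined {N : ℕ} (T : ℝ) (H : Vec N → ℝ) (f : Torus N → ℝ → ℝ)
    (m : Torus N × ℝ → ℝ) (w : Torus N × ℝ → Vec N) : Prop :=
  (∃! μ : ProbabilityMeasure (Torus N), IsTerminalTrace T m μ) ∧
  (∀ᵐ z ∂(cyl N T), runningCost H (m z) (w z) ≠ ⊤) ∧
  Integrable (fun z => (runningCost H (m z) (w z)).toReal) (cyl N T) ∧
  Integrable (fun z => primitive f z.1 (m z)) (cyl N T)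

end MFG

end

/-!
The energy is bounded below by a multiple of the kinetic energy `∫ |w|^{γ'} m^{1-γ'}` minus
a multiple of `∫ m^{α+1}`, because `L` grows like the power `γ'` and `F` at most like the power `α + 1`.
Everything rests on an a priori estimate for the Fokker-Planck equation: if `α < γ' / N`, then
`∫ m^{α+1}` is at most an arbitrarily small multiple of the kinetic energy plus a constant
(`exists_density_estimate`). This gives the lower bound of the energy and the bound on the sequences
(`exists_energy_coercive`).

The estimate is proved by duality, without parabolic regularity theory. Given `0 ≤ ψ ≤ 1` and a time
scale `η`, the equation is tested with the correlation of `ψ` with a heat kernel truncated at unit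
distance and at times `η` (`exists_heat_parametrix`). The heat operator maps this kernel to
an approximate identity up to a bounded error of size `η^{-N/2-1}` on times less than `η`; against the
error `m` counts only through its mass, which is one. The result (`exists_duality_estimate`) is
  `∫ m ψ ≲ (η^{-N/2} + sup m₀) ∫ ψ + ∫ |w| g`, with `g ≲ √η` and `∫ g ≲ √η ∫ ψ`.
Let `ψ` approach the indicator function of `{m > C λ}` and take `η^{-N/2} ~ λ`, so that the first term
is absorbed. As `√η ~ λ^{-1/N}`, Young's inequality yields
  `|{m > C λ}| ≲ λ^{-p} ∫ |w|^r` with `p = r (1 + 1/N)` (`exists_superlevel_estimate`).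
For `r = γ'(α+1)/(α+γ')` the right-hand side is controlled by the kinetic energy and `∫ m^{α+1}`, and
`α + 1 < p` holds exactly when `α < γ' / N`. Integrating over the levels above a large threshold
therefore gives a small factor.

The trace at time `T` is obtained from the moments `∫ m(x, t) ψ(x) dx` of the density: the equation says
that they are absolutely continuous in time (`ae_moment_eq`). The space of probability measures on the
torus is compact, and the real and imaginary parts of the Fourier modes determine such a measure;
hence continuity of countably many moments is enough for a weakly continuous version
(`existsUnique_isTerminalTrace`). Finally the constraint set contains `(m₀, ∇m₀)`, a stationary
solution (`stationary_mem_K`).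
-/

/-! ### The torus and its covering map -/

namespace MFG

variable {N : ℕ}

instance : IsProbabilityMeasure (volume : Measure UnitAddCircle) :=
  ⟨UnitAddCircle.measure_univ⟩

instance : IsProbabilityMeasure (volume : Measure (Torus N)) :=
  inferInstanceAs (IsProbabilityMeasure (Measure.pi fun _ : Fin N => (volume : Measure UnitAddCircle)))

instance : (volume : Measure (Torus N × ℝ)).IsAddHaarMeasure :=
  Measure.prod.instIsAddHaarMeasure _ _

instance : (volume : Measure (Vec N × ℝ)).IsAddHaarMeasure :=
  Measure.prod.instIsAddHaarMeasure _ _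

instance (T : ℝ) : IsFiniteMeasure (cyl N T) := by unfold cyl; infer_instance

theorem toTorus_add (y z : Vec N) : toTorus (y + z) = toTorus y + toTorus z := by
  ext i; simp [toTorus]

@[simp] theorem toTorus_zero : toTorus (0 : Vec N) = 0 := by
  ext i; simp [toTorus]

theorem continuous_toTorus : Continuous (toTorus : Vec N → Torus N) :=
  continuous_pi fun i => (AddCircle.continuous_mk' (1 : ℝ)).comp (by fun_prop)

theorem isOpenQuotientMap_toTorus : IsOpenQuotientMap (toTorus : Vec N → Torus N) := by
  have h1 : IsOpenQuotientMap (Pi.map fun (_ : Fin N) (s : ℝ) => (s : UnitAddCircle)) :=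
    IsOpenQuotientMap.piMap fun _ => QuotientAddGroup.isOpenQuotientMap_mk
  exact h1.comp (EuclideanSpace.equiv (Fin N) ℝ).toHomeomorph.isOpenQuotientMap

theorem toTorus_surjective : Function.Surjective (toTorus : Vec N → Torus N) :=
  isOpenQuotientMap_toTorus.surjective

/-- The unit cube is a fundamental domain, and it contains the ball of radius `1/2`. -/
theorem setLIntegral_ball_toTorus_le {g : Torus N → ℝ≥0∞} (hg : Measurable g) (x : Torus N) :
    ∫⁻ v in Metric.ball (0 : Vec N) (1 / 2), g (x + toTorus v) ≤ ∫⁻ y, g y := by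
  have h1 : MeasurePreserving (fun (v : Fin N → ℝ) (i : Fin N) => (v i : UnitAddCircle))
      (Measure.pi fun _ => (volume : Measure ℝ).restrict (Ioc (-1 / 2) (-1 / 2 + 1)))
      (Measure.pi fun _ => volume) :=
    measurePreserving_pi _ _ fun _ => UnitAddCircle.measurePreserving_mk (-1 / 2)
  rw [← Measure.restrict_pi_pi] at h1
  have hg' : Measurable fun y => g (x + y) := hg.comp (measurable_const_add x)
  calc ∫⁻ v in Metric.ball (0 : Vec N) (1 / 2), g (x + toTorus v)
      ≤ ∫⁻ v in (WithLp.ofLp : Vec N → Fin N → ℝ) ⁻¹' (univ.pi fun _ => Ioc (-1 / 2 : ℝ) (-1 / 2 + 1)),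
          g (x + toTorus v) := by
        apply lintegral_mono_set
        intro v hv i _
        have h2 : ‖v i‖ ≤ ‖v‖ := PiLp.norm_apply_le v i
        have h3 : ‖v‖ < 1 / 2 := by simpa using hv
        rw [Real.norm_eq_abs] at h2
        have := abs_lt.1 (h2.trans_lt h3)
        constructor <;> linarith [this.1, this.2]
    _ = ∫⁻ v in univ.pi fun _ : Fin N => Ioc (-1 / 2 : ℝ) (-1 / 2 + 1),
          g (x + fun i => (v i : UnitAddCircle)) :=
        (PiLp.volume_preserving_ofLp (Fin N)).setLIntegral_comp_preimage
          (MeasurableSet.univ_pi fun _ => measurableSet_Ioc)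
          (f := fun v : Fin N → ℝ => g (x + fun i => (v i : UnitAddCircle)))
          (hg'.comp h1.measurable)
    _ = ∫⁻ y, g (x + y) := h1.lintegral_comp hg'
    _ = ∫⁻ y, g y := lintegral_add_left_eq_self g x

theorem TorusContDiff.continuous {n : WithTop ℕ∞} {u : Torus N → ℝ} (hu : TorusContDiff n u) :
    Continuous u :=
  (isOpenQuotientMap_toTorus.isQuotientMap.continuous_iff).2 (ContDiff.continuous hu)

theorem lift_add (u : Torus N → ℝ) (y : Vec N) :
    (fun v : Vec N => u (toTorus y + toTorus v)) = fun v => (fun z => u (toTorus z)) (y + v) := by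
  ext v; simp [toTorus_add]

theorem grad_toTorus (u : Torus N → ℝ) (y : Vec N) :
    grad u (toTorus y) = gradient (fun z => u (toTorus z)) y := by
  unfold grad gradient
  rw [lift_add, fderiv_comp_add_left (f := fun z : Vec N => u (toTorus z)), add_zero]

theorem lap_toTorus (u : Torus N → ℝ) (y : Vec N) :
    lap u (toTorus y) = ∑ i, fderiv ℝ (fderiv ℝ (fun z => u (toTorus z))) y
      (EuclideanSpace.basisFun (Fin N) ℝ i) (EuclideanSpace.basisFun (Fin N) ℝ i) := by
  unfold lap
  rw [lift_add, InnerProductSpace.laplacian_eq_iteratedFDeriv_orthonormalBasis _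
    (EuclideanSpace.basisFun (Fin N) ℝ)]
  simp only [iteratedFDeriv_two_apply]
  have : fderiv ℝ (fun v => (fun z => u (toTorus z)) (y + v))
      = fun v => fderiv ℝ (fun z => u (toTorus z)) (y + v) := by
    ext1 v; rw [fderiv_comp_add_left (f := fun z : Vec N => u (toTorus z))]
  rw [this, fderiv_comp_add_left (f := fderiv ℝ fun z : Vec N => u (toTorus z))]
  simp

theorem TorusContDiff.continuous_grad {u : Torus N → ℝ} (hu : TorusContDiff 1 u) :
    Continuous (grad u) := by
  refine (isOpenQuotientMap_toTorus.isQuotientMap.continuous_iff).2 ?_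
  have h : grad u ∘ toTorus = fun y => gradient (fun z => u (toTorus z)) y :=
    funext fun y => grad_toTorus u y
  rw [h]
  unfold gradient
  exact (LinearIsometryEquiv.continuous _).comp (ContDiff.continuous_fderiv hu one_ne_zero)

theorem TorusContDiff.continuous_lap {u : Torus N → ℝ} (hu : TorusContDiff 2 u) :
    Continuous (lap u) := by
  refine (isOpenQuotientMap_toTorus.isQuotientMap.continuous_iff).2 ?_
  have h : lap u ∘ toTorus = _ := funext fun y => lap_toTorus u y
  rw [h]
  have h2 : Continuous (fderiv ℝ (fderiv ℝ (fun z : Vec N => u (toTorus z)))) :=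
    (ContDiff.fderiv_right hu (m := 1) (by norm_num)).continuous_fderiv one_ne_zero
  fun_prop

/-- A continuous function on the torus is bounded. -/
theorem exists_norm_le_of_continuous {E : Type*} [NormedAddCommGroup E] {u : Torus N → E}
    (hu : Continuous u) : ∃ C : ℝ, 0 ≤ C ∧ ∀ x, ‖u x‖ ≤ C := by
  obtain ⟨C, hC⟩ := isCompact_univ.exists_bound_of_continuousOn hu.continuousOn
  exact ⟨C, (norm_nonneg _).trans (hC 0 trivial), fun x => hC x trivial⟩

/-! ### Correlation of a function on the cylinder with a kernel on space-time -/

/-- The correlation `z ↦ ∫ ψ(z + p) k(p) dp` of a function `ψ` on `𝕋^N × ℝ` with a kernel `k` on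
the covering space `ℝ^N × ℝ`. -/
noncomputable def corr (ψ : Torus N × ℝ → ℝ) (k : Vec N × ℝ → ℝ) (z : Torus N × ℝ) : ℝ :=
  ∫ p : Vec N × ℝ, ψ (z.1 + toTorus p.1, z.2 + p.2) * k p

/-- The lift to `ℝ^N × ℝ` of a function on `𝕋^N × ℝ`. -/
def lift (φ : Torus N × ℝ → ℝ) (y : Vec N × ℝ) : ℝ := φ (toTorus y.1, y.2)

theorem continuous_lift {ψ : Torus N × ℝ → ℝ} (hψ : Continuous ψ) : Continuous (lift ψ) :=
  hψ.comp ((continuous_toTorus.comp continuous_fst).prodMk continuous_snd)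

theorem lift_corr (ψ : Torus N × ℝ → ℝ) (k : Vec N × ℝ → ℝ) :
    lift (corr ψ k) = convolution (lift ψ) (fun p => k (-p)) (ContinuousLinearMap.mul ℝ ℝ) volume := by
  ext y
  unfold lift corr convolution
  rw [← integral_add_left_eq_self (fun p : Vec N × ℝ =>
    (ContinuousLinearMap.mul ℝ ℝ) (ψ (toTorus p.1, p.2)) (k (-(y - p)))) y]
  refine integral_congr_ae (Eventually.of_forall fun p => ?_)
  simp [toTorus_add]

theorem hasCompactSupport_comp_neg {k : Vec N × ℝ → ℝ} (hk : HasCompactSupport k) :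
    HasCompactSupport fun p => k (-p) :=
  hk.comp_homeomorph (Homeomorph.neg _)

theorem contDiff_lift_corr {ψ : Torus N × ℝ → ℝ} (hψ : Continuous ψ) {k : Vec N × ℝ → ℝ}
    (hk : ContDiff ℝ ∞ k) (hkc : HasCompactSupport k) : ContDiff ℝ ∞ (lift (corr ψ k)) := by
  rw [lift_corr]
  exact (hasCompactSupport_comp_neg hkc).contDiff_convolution_right (n := ⊤) _
    (continuous_lift hψ).locallyIntegrable (hk.comp contDiff_neg)

theorem fderiv_lift_corr {ψ : Torus N × ℝ → ℝ} (hψ : Continuous ψ) {k : Vec N × ℝ → ℝ}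
    (hk : ContDiff ℝ ∞ k) (hkc : HasCompactSupport k) (y e : Vec N × ℝ) :
    fderiv ℝ (lift (corr ψ k)) y e = -lift (corr ψ fun p => fderiv ℝ k p e) y := by
  have hc := hasCompactSupport_comp_neg hkc
  have hs : ContDiff ℝ 1 fun p => k (-p) := (hk.of_le (by exact_mod_cast le_top)).comp contDiff_neg
  have h := hc.hasFDerivAt_convolution_right (ContinuousLinearMap.mul ℝ ℝ)
    (continuous_lift hψ).locallyIntegrable (μ := volume) hs y
  rw [lift_corr, h.fderiv, convolution_precompR_apply _ (continuous_lift hψ).locallyIntegrable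
    (hc.fderiv ℝ) (hs.continuous_fderiv one_ne_zero), lift_corr]
  have : (fun a => fderiv ℝ (fun p => k (-p)) a e) = fun a => -(fun p => fderiv ℝ k p e) (-a) := by
    ext a
    have h1 : HasFDerivAt (fun p => k (-p)) ((fderiv ℝ k (-a)).comp (-ContinuousLinearMap.id ℝ _)) a :=
      ((hk.differentiable (by simp)) (-a)).hasFDerivAt.comp a (hasFDerivAt_id a).neg
    rw [h1.fderiv]; simp
  rw [this]
  simp only [convolution]
  rw [← integral_neg]
  simp

/-- Directional derivative of a kernel. -/
noncomputable def dirD (e : Vec N × ℝ) (k : Vec N × ℝ → ℝ) (p : Vec N × ℝ) : ℝ := fderiv ℝ k p e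

theorem contDiff_dirD {k : Vec N × ℝ → ℝ} (hk : ContDiff ℝ ∞ k) (e : Vec N × ℝ) :
    ContDiff ℝ ∞ (dirD e k) :=
  (hk.fderiv_right (by simp)).clm_apply contDiff_const

theorem hasCompactSupport_dirD {k : Vec N × ℝ → ℝ} (hk : HasCompactSupport k) (e : Vec N × ℝ) :
    HasCompactSupport (dirD e k) := by
  exact (hk.fderiv ℝ).comp_left (g := fun L : (Vec N × ℝ) →L[ℝ] ℝ => L e) rfl

/-- The unit vector in the `i`-th space direction. -/
noncomputable def spaceDir (i : Fin N) : Vec N × ℝ := (EuclideanSpace.basisFun (Fin N) ℝ i, 0)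

/-- The unit vector in the time direction. -/
def timeDir : Vec N × ℝ := (0, 1)

theorem deriv_time_corr {ψ : Torus N × ℝ → ℝ} (hψ : Continuous ψ) {k : Vec N × ℝ → ℝ}
    (hk : ContDiff ℝ ∞ k) (hkc : HasCompactSupport k) (z : Torus N × ℝ) :
    deriv (fun s => corr ψ k (z.1, s)) z.2 = -corr ψ (dirD timeDir k) z := by
  obtain ⟨y, hy⟩ := toTorus_surjective z.1
  have h1 := ((contDiff_lift_corr hψ hk hkc).differentiable (by simp) (y, z.2)).hasFDerivAt
  have h2 : HasDerivAt (fun s : ℝ => (y, s)) (timeDir : Vec N × ℝ) z.2 :=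
    (hasDerivAt_const _ _).prodMk (hasDerivAt_id _)
  have h3 := h1.comp_hasDerivAt z.2 h2
  rw [fderiv_lift_corr hψ hk hkc] at h3
  have h4 := h3.deriv
  simp only [lift, hy, Function.comp_def] at h4
  exact h4

theorem fderiv_space_corr {ψ : Torus N × ℝ → ℝ} (hψ : Continuous ψ) {k : Vec N × ℝ → ℝ}
    (hk : ContDiff ℝ ∞ k) (hkc : HasCompactSupport k) (y : Vec N) (t : ℝ) (i : Fin N) :
    fderiv ℝ (fun v => corr ψ k (toTorus v, t)) y (EuclideanSpace.basisFun (Fin N) ℝ i)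
      = -corr ψ (dirD (spaceDir i) k) (toTorus y, t) := by
  have h1 := ((contDiff_lift_corr hψ hk hkc).differentiable (by simp) (y, t)).hasFDerivAt
  have h2 : HasFDerivAt (fun v : Vec N => (v, t)) (ContinuousLinearMap.inl ℝ (Vec N) ℝ) y :=
    hasFDerivAt_prodMk_left y t
  have h3 := HasFDerivAt.comp (g := lift (corr ψ k)) y h1 h2
  have h4 : (fun v => corr ψ k (toTorus v, t)) = lift (corr ψ k) ∘ fun v : Vec N => (v, t) := rfl
  rw [h4, h3.fderiv]
  exact fderiv_lift_corr hψ hk hkc (y, t) (spaceDir i)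

theorem contDiff_space_corr {ψ : Torus N × ℝ → ℝ} (hψ : Continuous ψ) {k : Vec N × ℝ → ℝ}
    (hk : ContDiff ℝ ∞ k) (hkc : HasCompactSupport k) (t : ℝ) :
    TorusContDiff ∞ fun x => corr ψ k (x, t) :=
  (contDiff_lift_corr hψ hk hkc).comp (contDiff_id.prodMk contDiff_const)

theorem lap_corr {ψ : Torus N × ℝ → ℝ} (hψ : Continuous ψ) {k : Vec N × ℝ → ℝ}
    (hk : ContDiff ℝ ∞ k) (hkc : HasCompactSupport k) (z : Torus N × ℝ) :
    lap (fun x => corr ψ k (x, z.2)) z.1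
      = ∑ i, corr ψ (dirD (spaceDir i) (dirD (spaceDir i) k)) z := by
  obtain ⟨y, hy⟩ := toTorus_surjective z.1
  rw [← hy, lap_toTorus]
  refine Finset.sum_congr rfl fun i _ => ?_
  set e := EuclideanSpace.basisFun (Fin N) ℝ i
  have hd : DifferentiableAt ℝ (fderiv ℝ fun v => corr ψ k (toTorus v, z.2)) y :=
    (ContDiff.fderiv_right (m := 1) (contDiff_space_corr hψ hk hkc z.2) (by norm_cast)).differentiable
      one_ne_zero y
  have h1 : fderiv ℝ (fun v => fderiv ℝ (fun v => corr ψ k (toTorus v, z.2)) v e) y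
      = (ContinuousLinearMap.apply ℝ ℝ e).comp (fderiv ℝ (fderiv ℝ fun v => corr ψ k (toTorus v, z.2)) y) :=
    ((ContinuousLinearMap.apply ℝ ℝ e).hasFDerivAt.comp y hd.hasFDerivAt).fderiv
  have h2 : (fderiv ℝ (fderiv ℝ fun v => corr ψ k (toTorus v, z.2)) y) e e
      = fderiv ℝ (fun v => fderiv ℝ (fun v => corr ψ k (toTorus v, z.2)) v e) y e := by
    rw [h1]; simp
  rw [h2]
  have h3 : (fun v => fderiv ℝ (fun v => corr ψ k (toTorus v, z.2)) v e)
      = -fun v => corr ψ (dirD (spaceDir i) k) (toTorus v, z.2) := by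
    ext v; exact fderiv_space_corr hψ hk hkc v z.2 i
  rw [h3, fderiv_neg]
  have h4 := fderiv_space_corr hψ (contDiff_dirD hk (spaceDir i))
    (hasCompactSupport_dirD hkc (spaceDir i)) y z.2 i
  rw [neg_apply, h4, neg_neg, hy]

theorem grad_corr_apply {ψ : Torus N × ℝ → ℝ} (hψ : Continuous ψ) {k : Vec N × ℝ → ℝ}
    (hk : ContDiff ℝ ∞ k) (hkc : HasCompactSupport k) (z : Torus N × ℝ) (i : Fin N) :
    grad (fun x => corr ψ k (x, z.2)) z.1 i = -corr ψ (dirD (spaceDir i) k) z := by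
  obtain ⟨y, hy⟩ := toTorus_surjective z.1
  have h := fderiv_space_corr hψ hk hkc y z.2 i
  rw [hy] at h
  rw [← h, ← hy, grad_toTorus]
  have h1 : gradient (fun v => corr ψ k (toTorus v, z.2)) y i
      = inner ℝ (gradient (fun v => corr ψ k (toTorus v, z.2)) y) (EuclideanSpace.basisFun (Fin N) ℝ i) := by
    rw [EuclideanSpace.basisFun_apply, EuclideanSpace.inner_single_right]
    simp
  rw [h1, gradient, InnerProductSpace.toDual_symm_apply]

theorem norm_grad_corr_le {ψ : Torus N × ℝ → ℝ} (hψ : Continuous ψ) {k : Vec N × ℝ → ℝ}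
    (hk : ContDiff ℝ ∞ k) (hkc : HasCompactSupport k) (z : Torus N × ℝ) :
    ‖grad (fun x => corr ψ k (x, z.2)) z.1‖ ≤ ∑ i, |corr ψ (dirD (spaceDir i) k) z| := by
  set G := grad (fun x => corr ψ k (x, z.2)) z.1
  calc ‖G‖ = ‖∑ i, G i • EuclideanSpace.basisFun (Fin N) ℝ i‖ := by
        congr 1
        simpa using ((EuclideanSpace.basisFun (Fin N) ℝ).sum_repr G).symm
    _ ≤ ∑ i, ‖G i • EuclideanSpace.basisFun (Fin N) ℝ i‖ := norm_sum_le _ _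
    _ = _ := by
        refine Finset.sum_congr rfl fun i _ => ?_
        rw [norm_smul, OrthonormalBasis.norm_eq_one, mul_one, Real.norm_eq_abs,
          grad_corr_apply hψ hk hkc, abs_neg]

theorem integrable_corr_integrand {ψ : Torus N × ℝ → ℝ} (hψ : Continuous ψ) {k : Vec N × ℝ → ℝ}
    (hk : Continuous k) (hkc : HasCompactSupport k) (z : Torus N × ℝ) :
    Integrable fun p : Vec N × ℝ => ψ (z.1 + toTorus p.1, z.2 + p.2) * k p := by
  refine Continuous.integrable_of_hasCompactSupport ?_ hkc.mul_left
  refine (hψ.comp ?_).mul hk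
  exact (continuous_const.add (continuous_toTorus.comp continuous_fst)).prodMk
    (continuous_const.add continuous_snd)

theorem continuous_corr {ψ : Torus N × ℝ → ℝ} (hψ : Continuous ψ) {k : Vec N × ℝ → ℝ}
    (hk : Continuous k) (hkc : HasCompactSupport k) : Continuous (corr ψ k) := by
  have h : Continuous (lift (corr ψ k)) := by
    rw [lift_corr]
    exact (hasCompactSupport_comp_neg hkc).continuous_convolution_right _
      (continuous_lift hψ).locallyIntegrable (hk.comp continuous_neg)
  have hq : IsOpenQuotientMap (Prod.map (toTorus : Vec N → Torus N) (id : ℝ → ℝ)) :=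
    isOpenQuotientMap_toTorus.prodMap .id
  exact hq.isQuotientMap.continuous_iff.2 h

theorem corr_sub {ψ : Torus N × ℝ → ℝ} (hψ : Continuous ψ) {k l : Vec N × ℝ → ℝ}
    (hk : Continuous k) (hkc : HasCompactSupport k) (hl : Continuous l) (hlc : HasCompactSupport l)
    (z : Torus N × ℝ) : corr ψ (fun p => k p - l p) z = corr ψ k z - corr ψ l z := by
  unfold corr
  rw [← integral_sub (integrable_corr_integrand hψ hk hkc z) (integrable_corr_integrand hψ hl hlc z)]
  simp only [mul_sub]

theorem corr_sum {ψ : Torus N × ℝ → ℝ} (hψ : Continuous ψ) {ι : Type*} (s : Finset ι)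
    {k : ι → Vec N × ℝ → ℝ} (hk : ∀ i, Continuous (k i)) (hkc : ∀ i, HasCompactSupport (k i))
    (z : Torus N × ℝ) : corr ψ (fun p => ∑ i ∈ s, k i p) z = ∑ i ∈ s, corr ψ (k i) z := by
  unfold corr
  rw [← integral_finsetSum _ fun i _ => integrable_corr_integrand hψ (hk i) (hkc i) z]
  simp only [Finset.mul_sum]

theorem enorm_corr_le (ψ : Torus N × ℝ → ℝ) (k : Vec N × ℝ → ℝ) (z : Torus N × ℝ) :
    ‖corr ψ k z‖ₑ ≤ ∫⁻ p : Vec N × ℝ, ‖ψ (z.1 + toTorus p.1, z.2 + p.2)‖ₑ * ‖k p‖ₑ := by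
  refine (enorm_integral_le_lintegral_enorm _).trans_eq ?_
  simp only [enorm_mul]

/-- A correlation with a function bounded by one is bounded by the mass of the kernel. -/
theorem enorm_corr_le_of_norm_le_one {ψ : Torus N × ℝ → ℝ} (hψ : ∀ z, ‖ψ z‖ ≤ 1)
    (k : Vec N × ℝ → ℝ) (z : Torus N × ℝ) : ‖corr ψ k z‖ₑ ≤ ∫⁻ p, ‖k p‖ₑ := by
  refine (enorm_corr_le ψ k z).trans (lintegral_mono fun p => ?_)
  refine mul_le_of_le_one_left' ?_
  rw [← ofReal_norm]
  exact ENNReal.ofReal_le_one.2 (hψ _)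

theorem measurable_corr_integrand {ψ : Torus N × ℝ → ℝ} (hψ : Continuous ψ) :
    Measurable fun q : (Torus N × ℝ) × (Vec N × ℝ) => ‖ψ (q.1.1 + toTorus q.2.1, q.1.2 + q.2.2)‖ₑ := by
  have := (continuous_toTorus (N := N))
  refine (Continuous.measurable ?_).enorm
  fun_prop

/-- Young's inequality: a correlation is controlled in `L^1` by the masses of both factors. -/
theorem lintegral_enorm_corr_le {ψ : Torus N × ℝ → ℝ} (hψ : Continuous ψ) {k : Vec N × ℝ → ℝ}
    (hk : Continuous k) :
    ∫⁻ z, ‖corr ψ k z‖ₑ ≤ (∫⁻ z, ‖ψ z‖ₑ) * ∫⁻ p, ‖k p‖ₑ := by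
  have hk' : Measurable fun p => ‖k p‖ₑ := hk.measurable.enorm
  calc ∫⁻ z, ‖corr ψ k z‖ₑ
      ≤ ∫⁻ z : Torus N × ℝ, ∫⁻ p : Vec N × ℝ, ‖ψ (z.1 + toTorus p.1, z.2 + p.2)‖ₑ * ‖k p‖ₑ :=
        lintegral_mono fun z => enorm_corr_le ψ k z
    _ = ∫⁻ p : Vec N × ℝ, ∫⁻ z : Torus N × ℝ, ‖ψ (z.1 + toTorus p.1, z.2 + p.2)‖ₑ * ‖k p‖ₑ :=
        lintegral_lintegral_swap
          ((measurable_corr_integrand hψ).mul (hk'.comp measurable_snd)).aemeasurable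
    _ = ∫⁻ p : Vec N × ℝ, (∫⁻ z, ‖ψ z‖ₑ) * ‖k p‖ₑ := by
        refine lintegral_congr fun p => ?_
        have hm : Measurable fun z : Torus N × ℝ => ‖ψ (z.1 + toTorus p.1, z.2 + p.2)‖ₑ :=
          (measurable_corr_integrand hψ).comp (measurable_id.prodMk measurable_const)
        rw [lintegral_mul_const _ hm]
        congr 1
        exact lintegral_add_right_eq_self (fun z => ‖ψ z‖ₑ) ((toTorus p.1, p.2) : Torus N × ℝ)
    _ = _ := lintegral_const_mul _ hk'

/-! ### Truncated heat kernels -/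

/-- A smooth function equal to `0` on `(-∞, 1/2]` and to `1` on `[1, ∞)`. -/
noncomputable def step (x : ℝ) : ℝ := Real.smoothTransition (2 * x - 1)

/-- A smooth radial cutoff, as a function of the square `r` of the radius: it is `1` for `r ≤ 1/16`
and `0` for `r ≥ 1/5`, so that its support lies in the ball of radius `1/2`. -/
noncomputable def cutoff (r : ℝ) : ℝ := Real.smoothTransition (8 * (1 / 5 - r))

theorem contDiff_step : ContDiff ℝ ∞ step :=
  (Real.smoothTransition.contDiff (n := ⊤)).comp (by fun_prop)

theorem contDiff_cutoff : ContDiff ℝ ∞ cutoff :=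
  (Real.smoothTransition.contDiff (n := ⊤)).comp (by fun_prop)

theorem step_of_le {x : ℝ} (h : x ≤ 1 / 2) : step x = 0 :=
  Real.smoothTransition.zero_of_nonpos (by linarith)

theorem step_of_ge {x : ℝ} (h : 1 ≤ x) : step x = 1 :=
  Real.smoothTransition.one_of_one_le (by linarith)

theorem monotone_smoothTransition : Monotone Real.smoothTransition := by
  intro x y hxy
  unfold Real.smoothTransition
  rw [div_le_div_iff₀ (Real.smoothTransition.pos_denom x) (Real.smoothTransition.pos_denom y)]
  have h1 := expNegInvGlue.monotone hxy
  have h2 := expNegInvGlue.monotone (show 1 - y ≤ 1 - x by linarith)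
  have h3 := mul_le_mul h1 h2 (expNegInvGlue.nonneg _) (expNegInvGlue.nonneg _)
  nlinarith

theorem monotone_step : Monotone step := fun _ _ h =>
  monotone_smoothTransition (by linarith)

theorem deriv_step_nonneg (x : ℝ) : 0 ≤ deriv step x := monotone_step.deriv_nonneg

theorem deriv_step_of_lt {x : ℝ} (h : x < 1 / 2) : deriv step x = 0 := by
  have : step =ᶠ[𝓝 x] fun _ => 0 := by
    filter_upwards [gt_mem_nhds h] with y hy using step_of_le hy.le
  rw [this.deriv_eq]; simp

theorem deriv_step_of_gt {x : ℝ} (h : 1 < x) : deriv step x = 0 := by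
  have : step =ᶠ[𝓝 x] fun _ => 1 := by
    filter_upwards [lt_mem_nhds h] with y hy using step_of_ge hy.le
  rw [this.deriv_eq]; simp

theorem continuous_deriv_step : Continuous (deriv step) :=
  contDiff_step.continuous_deriv (by simp)

theorem exists_deriv_step_le : ∃ C, 0 ≤ C ∧ ∀ x, |deriv step x| ≤ C := by
  obtain ⟨C, hC⟩ := (isCompact_Icc (a := (1 / 2 : ℝ)) (b := 1)).exists_bound_of_continuousOn
    continuous_deriv_step.continuousOn
  have hC0 : 0 ≤ C := (norm_nonneg _).trans (hC 1 (by norm_num))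
  refine ⟨C, hC0, fun x => ?_⟩
  by_cases h : x ∈ Icc (1 / 2 : ℝ) 1
  · exact hC x h
  · rw [mem_Icc, not_and_or, not_le, not_le] at h
    rcases h with h | h
    · rw [deriv_step_of_lt h]; simpa
    · rw [deriv_step_of_gt h]; simpa

theorem cutoff_of_le {r : ℝ} (h : r ≤ 1 / 16) : cutoff r = 1 :=
  Real.smoothTransition.one_of_one_le (by linarith)

theorem cutoff_of_ge {r : ℝ} (h : 1 / 5 ≤ r) : cutoff r = 0 :=
  Real.smoothTransition.zero_of_nonpos (by linarith)

theorem cutoff_nonneg (r : ℝ) : 0 ≤ cutoff r := Real.smoothTransition.nonneg _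

theorem cutoff_le_one (r : ℝ) : cutoff r ≤ 1 := Real.smoothTransition.le_one _

theorem deriv_cutoff_of_lt {r : ℝ} (h : r < 1 / 16) :
    deriv cutoff r = 0 ∧ deriv (deriv cutoff) r = 0 := by
  have : cutoff =ᶠ[𝓝 r] fun _ => 1 := by
    filter_upwards [gt_mem_nhds h] with y hy using cutoff_of_le hy.le
  constructor
  · rw [this.deriv_eq]; simp
  · rw [this.deriv.deriv_eq]; simp

theorem deriv_cutoff_of_gt {r : ℝ} (h : 1 / 5 < r) :
    deriv cutoff r = 0 ∧ deriv (deriv cutoff) r = 0 := by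
  have : cutoff =ᶠ[𝓝 r] fun _ => 0 := by
    filter_upwards [lt_mem_nhds h] with y hy using cutoff_of_ge hy.le
  constructor
  · rw [this.deriv_eq]; simp
  · rw [this.deriv.deriv_eq]; simp

theorem contDiff_deriv_cutoff : ContDiff ℝ ∞ (deriv cutoff) :=
  (contDiff_infty_iff_deriv.1 contDiff_cutoff).2

theorem exists_deriv_cutoff_le :
    ∃ C, 0 ≤ C ∧ ∀ r, 0 ≤ r → |deriv cutoff r| ≤ C ∧ |deriv (deriv cutoff) r| ≤ C := by
  obtain ⟨C, hC⟩ := (isCompact_Icc (a := (0 : ℝ)) (b := 1)).exists_bound_of_continuousOn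
    contDiff_deriv_cutoff.continuous.continuousOn
  obtain ⟨D, hD⟩ := (isCompact_Icc (a := (0 : ℝ)) (b := 1)).exists_bound_of_continuousOn
    (contDiff_deriv_cutoff.continuous_deriv (by simp)).continuousOn
  have hC0 : 0 ≤ C := (norm_nonneg _).trans (hC 1 (by norm_num))
  refine ⟨max C D, hC0.trans (le_max_left _ _), fun r hr => ?_⟩
  by_cases h : r ≤ 1
  · exact ⟨(hC r ⟨hr, h⟩).trans (le_max_left _ _), (hD r ⟨hr, h⟩).trans (le_max_right _ _)⟩
  · have h1 := deriv_cutoff_of_gt (r := r) (by linarith)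
    rw [h1.1, h1.2]
    simp [hC0]

/-- The Gaussian `τ^{-N/2} exp(-r / 4τ)` as a function of the square `r` of the radius and of time;
up to a factor it is the heat kernel of `ℝ^N`. -/
noncomputable def gauss (N : ℕ) (r τ : ℝ) : ℝ := τ ^ (-(N : ℝ) / 2) * Real.exp (-r / (4 * τ))

/-- The heat kernel, cut off in space at distance `1/2` and in time by the function `c`. -/
noncomputable def modKer (c : ℝ → ℝ) (p : Vec N × ℝ) : ℝ :=
  cutoff (‖p.1‖ ^ 2) * c p.2 * gauss N (‖p.1‖ ^ 2) p.2

theorem gauss_nonneg {r τ : ℝ} (hτ : 0 ≤ τ) : 0 ≤ gauss N r τ :=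
  mul_nonneg (Real.rpow_nonneg hτ _) (Real.exp_nonneg _)

theorem modKer_eventually_zero {c : ℝ → ℝ} {τ₀ : ℝ} (hc : ∀ τ ≤ τ₀, c τ = 0) {p : Vec N × ℝ}
    (hp : p.2 < τ₀) : modKer c =ᶠ[𝓝 p] fun _ => 0 := by
  filter_upwards [continuous_snd.continuousAt.eventually_lt_const hp] with q hq
  simp [modKer, hc _ hq.le]

theorem contDiff_modKer {c : ℝ → ℝ} (hcs : ContDiff ℝ ∞ c) {τ₀ : ℝ} (hτ₀ : 0 < τ₀)
    (hc : ∀ τ ≤ τ₀, c τ = 0) : ContDiff ℝ ∞ (modKer c : Vec N × ℝ → ℝ) := by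
  rw [contDiff_iff_contDiffAt]
  intro p
  rcases lt_or_ge p.2 τ₀ with h | h
  · exact contDiffAt_const.congr_of_eventuallyEq (modKer_eventually_zero hc h)
  · have h0 : p.2 ≠ 0 := (hτ₀.trans_le h).ne'
    have hn : ContDiff ℝ ∞ fun p : Vec N × ℝ => ‖p.1‖ ^ 2 := contDiff_fst.norm_sq ℝ
    have h1 : ContDiff ℝ ∞ fun p : Vec N × ℝ => cutoff (‖p.1‖ ^ 2) := contDiff_cutoff.comp hn
    have h2 : ContDiff ℝ ∞ fun p : Vec N × ℝ => c p.2 := hcs.comp contDiff_snd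
    have h3 : ContDiffAt ℝ ∞ (fun p : Vec N × ℝ => p.2 ^ (-(N : ℝ) / 2)) p :=
      contDiffAt_snd.rpow_const_of_ne h0
    have h4 : ContDiffAt ℝ ∞ (fun p : Vec N × ℝ => Real.exp (-‖p.1‖ ^ 2 / (4 * p.2))) p :=
      ((hn.contDiffAt.neg).div (contDiffAt_const.mul contDiffAt_snd) (by simpa using h0)).exp
    exact (h1.contDiffAt.mul h2.contDiffAt).mul (h3.mul h4)

theorem hasCompactSupport_modKer {c : ℝ → ℝ} (hc0 : ∀ τ ≤ 0, c τ = 0) (hc1 : ∀ τ, 1 < τ → c τ = 0) :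
    HasCompactSupport (modKer c : Vec N × ℝ → ℝ) := by
  refine HasCompactSupport.intro (isCompact_closedBall (0 : Vec N × ℝ) 1) fun p hp => ?_
  rw [mem_closedBall_zero_iff, Prod.norm_def, max_le_iff, not_and_or, not_le, not_le] at hp
  rcases hp with hp | hp
  · rw [modKer, cutoff_of_ge (by nlinarith)]; simp
  · rw [Real.norm_eq_abs, lt_abs] at hp
    rcases hp with hp | hp
    · rw [modKer, hc1 _ hp]; simp
    · rw [modKer, hc0 _ (by linarith)]; simp

theorem hasDerivAt_norm_sq_line (v : Vec N) (i : Fin N) :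
    HasDerivAt (fun h : ℝ => ‖v + h • EuclideanSpace.basisFun (Fin N) ℝ i‖ ^ 2) (2 * v i) 0 := by
  have h1 : HasDerivAt (fun h : ℝ => v + h • EuclideanSpace.basisFun (Fin N) ℝ i)
      (EuclideanSpace.basisFun (Fin N) ℝ i) 0 := by
    simpa using ((hasDerivAt_id (0 : ℝ)).smul_const (EuclideanSpace.basisFun (Fin N) ℝ i)).const_add v
  have h2 := h1.norm_sq
  simpa [EuclideanSpace.inner_single_right] using h2

theorem hasDerivAt_line {k : Vec N × ℝ → ℝ} {p : Vec N × ℝ} (hk : DifferentiableAt ℝ k p)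
    (e : Vec N × ℝ) : HasDerivAt (fun h : ℝ => k (p + h • e)) (dirD e k p) 0 :=
  hk.hasFDerivAt.hasLineDerivAt e

theorem hasDerivAt_gauss_left (τ r : ℝ) :
    HasDerivAt (fun r => gauss N r τ) (-(1 / (4 * τ)) * gauss N r τ) r := by
  unfold gauss
  have h1 : HasDerivAt (fun r : ℝ => -r / (4 * τ)) (-1 / (4 * τ)) r :=
    (hasDerivAt_id r).neg.div_const _
  refine (h1.exp.const_mul (τ ^ (-(N : ℝ) / 2))).congr_deriv ?_
  ring

theorem hasDerivAt_gauss_right {τ : ℝ} (hτ : 0 < τ) (r : ℝ) :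
    HasDerivAt (fun τ => gauss N r τ) ((-(N / (2 * τ)) + r / (4 * τ ^ 2)) * gauss N r τ) τ := by
  unfold gauss
  have h1 : HasDerivAt (fun τ : ℝ => -r / (4 * τ)) (r / (4 * τ ^ 2)) τ := by
    have := ((hasDerivAt_id τ).const_mul 4).inv (by simpa using hτ.ne') |>.const_mul (-r)
    simp only [id] at this
    refine (this.congr_deriv ?_)
    field_simp
  have h2 : HasDerivAt (fun τ : ℝ => τ ^ (-(N : ℝ) / 2)) (-(N : ℝ) / 2 * τ ^ (-(N : ℝ) / 2 - 1)) τ :=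
    Real.hasDerivAt_rpow_const (Or.inl hτ.ne')
  refine (h2.mul h1.exp).congr_deriv ?_
  rw [Real.rpow_sub_one hτ.ne']
  field_simp

theorem dirD_spaceDir_modKer {c : ℝ → ℝ} (hcs : ContDiff ℝ ∞ c) {τ₀ : ℝ} (hτ₀ : 0 < τ₀)
    (hc : ∀ τ ≤ τ₀, c τ = 0) (p : Vec N × ℝ) (i : Fin N) :
    dirD (spaceDir i) (modKer c) p = 2 * p.1 i *
      ((deriv cutoff (‖p.1‖ ^ 2) - cutoff (‖p.1‖ ^ 2) / (4 * p.2)) * c p.2 *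
        gauss N (‖p.1‖ ^ 2) p.2) := by
  have h1 := hasDerivAt_line
    ((contDiff_modKer (N := N) hcs hτ₀ hc).differentiable (by simp) p) (spaceDir i)
  have hA : HasDerivAt cutoff (deriv cutoff (‖p.1‖ ^ 2)) (‖p.1‖ ^ 2) :=
    (contDiff_cutoff.differentiable (by simp) _).hasDerivAt
  have hB := (hA.mul_const (c p.2)).mul (hasDerivAt_gauss_left (N := N) p.2 (‖p.1‖ ^ 2))
  have h2 := HasDerivAt.comp_of_eq (0 : ℝ) hB (hasDerivAt_norm_sq_line p.1 i) (by simp)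
  have heq : (fun h : ℝ => modKer c (p + h • spaceDir i)) =
      ((fun y => cutoff y * c p.2) * fun r => gauss N r p.2) ∘
        fun h : ℝ => ‖p.1 + h • EuclideanSpace.basisFun (Fin N) ℝ i‖ ^ 2 := by
    ext h
    simp [modKer, spaceDir]
  rw [heq] at h1
  rw [h1.unique h2]
  ring

theorem dirD_dirD_spaceDir_modKer {c : ℝ → ℝ} (hcs : ContDiff ℝ ∞ c) {τ₀ : ℝ} (hτ₀ : 0 < τ₀)
    (hc : ∀ τ ≤ τ₀, c τ = 0) (p : Vec N × ℝ) (i : Fin N) :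
    dirD (spaceDir i) (dirD (spaceDir i) (modKer c)) p =
      2 * ((deriv cutoff (‖p.1‖ ^ 2) - cutoff (‖p.1‖ ^ 2) / (4 * p.2)) * c p.2 *
        gauss N (‖p.1‖ ^ 2) p.2) +
      4 * (p.1 i) ^ 2 * ((deriv (deriv cutoff) (‖p.1‖ ^ 2) - deriv cutoff (‖p.1‖ ^ 2) / (2 * p.2)
        + cutoff (‖p.1‖ ^ 2) / (16 * p.2 ^ 2)) * c p.2 * gauss N (‖p.1‖ ^ 2) p.2) := by
  have h1 := hasDerivAt_line
    ((contDiff_dirD (contDiff_modKer (N := N) hcs hτ₀ hc) (spaceDir i)).differentiable (by simp) p)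
    (spaceDir i)
  have hA : HasDerivAt cutoff (deriv cutoff (‖p.1‖ ^ 2)) (‖p.1‖ ^ 2) :=
    (contDiff_cutoff.differentiable (by simp) _).hasDerivAt
  have hA' : HasDerivAt (deriv cutoff) (deriv (deriv cutoff) (‖p.1‖ ^ 2)) (‖p.1‖ ^ 2) :=
    (contDiff_deriv_cutoff.differentiable (by simp) _).hasDerivAt
  have hB := ((hA'.sub (hA.div_const (4 * p.2))).mul_const (c p.2)).mul
    (hasDerivAt_gauss_left (N := N) p.2 (‖p.1‖ ^ 2))
  have h3 := HasDerivAt.comp_of_eq (0 : ℝ) hB (hasDerivAt_norm_sq_line p.1 i) (by simp)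
  have h4 : HasDerivAt (fun h : ℝ => 2 * (p.1 i + h)) 2 0 := by
    simpa using ((hasDerivAt_id (0 : ℝ)).const_add (p.1 i)).const_mul 2
  have h2 := h4.mul h3
  have heq : (fun h : ℝ => dirD (spaceDir i) (modKer c) (p + h • spaceDir i)) =
      (fun h : ℝ => 2 * (p.1 i + h)) *
        (((fun y => (deriv cutoff - fun x => cutoff x / (4 * p.2)) y * c p.2) *
          fun r => gauss N r p.2) ∘
            fun h : ℝ => ‖p.1 + h • EuclideanSpace.basisFun (Fin N) ℝ i‖ ^ 2) := by
    ext h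
    rw [dirD_spaceDir_modKer hcs hτ₀ hc]
    simp [spaceDir]
  rw [heq] at h1
  rw [h1.unique h2]
  simp only [zero_smul, add_zero, Function.comp_def, Pi.mul_apply, Pi.sub_apply]
  have : p.2 = 0 ∨ p.2 ≠ 0 := eq_or_ne _ _
  rcases this with h0 | h0
  · rw [hc p.2 (by linarith)]; simp
  · field_simp
    ring

theorem dirD_timeDir_modKer {c : ℝ → ℝ} (hcs : ContDiff ℝ ∞ c) {τ₀ : ℝ} (hτ₀ : 0 < τ₀)
    (hc : ∀ τ ≤ τ₀, c τ = 0) {p : Vec N × ℝ} (hp : 0 < p.2) :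
    dirD timeDir (modKer c) p = cutoff (‖p.1‖ ^ 2) *
      (deriv c p.2 + c p.2 * (-(N / (2 * p.2)) + ‖p.1‖ ^ 2 / (4 * p.2 ^ 2))) *
        gauss N (‖p.1‖ ^ 2) p.2 := by
  have h1 := hasDerivAt_line
    ((contDiff_modKer (N := N) hcs hτ₀ hc).differentiable (by simp) p) timeDir
  have hA : HasDerivAt c (deriv c p.2) p.2 := (hcs.differentiable (by simp) _).hasDerivAt
  have hB := (hA.const_mul (cutoff (‖p.1‖ ^ 2))).mul
    (hasDerivAt_gauss_right (N := N) hp (‖p.1‖ ^ 2))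
  have h4 : HasDerivAt (fun h : ℝ => p.2 + h) 1 0 := (hasDerivAt_id (0 : ℝ)).const_add p.2
  have h2 := HasDerivAt.comp_of_eq (0 : ℝ) hB h4 (by simp)
  have heq : (fun h : ℝ => modKer c (p + h • timeDir)) =
      ((fun y => cutoff (‖p.1‖ ^ 2) * c y) * fun τ => gauss N (‖p.1‖ ^ 2) τ) ∘
        fun h : ℝ => p.2 + h := by
    ext h
    simp [modKer, timeDir]
  rw [heq] at h1
  rw [h1.unique h2]
  ring

/-- The truncated heat kernel solves the heat equation, up to the term that comes from the cutoff in
time and an error supported where the cutoff in space varies. -/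
theorem heat_modKer {c : ℝ → ℝ} (hcs : ContDiff ℝ ∞ c) {τ₀ : ℝ} (hτ₀ : 0 < τ₀)
    (hc : ∀ τ ≤ τ₀, c τ = 0) (p : Vec N × ℝ) (hp : 0 < p.2) :
    dirD timeDir (modKer c) p - ∑ i, dirD (spaceDir i) (dirD (spaceDir i) (modKer c)) p
      = modKer (deriv c) p - c p.2 * gauss N (‖p.1‖ ^ 2) p.2 *
        (4 * ‖p.1‖ ^ 2 * deriv (deriv cutoff) (‖p.1‖ ^ 2) + 2 * N * deriv cutoff (‖p.1‖ ^ 2)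
          - 2 * ‖p.1‖ ^ 2 / p.2 * deriv cutoff (‖p.1‖ ^ 2)) := by
  have hn : ∑ i, (p.1 i) ^ 2 = ‖p.1‖ ^ 2 := by
    rw [EuclideanSpace.norm_sq_eq]; simp
  simp only [dirD_dirD_spaceDir_modKer hcs hτ₀ hc, Finset.sum_add_distrib, Finset.sum_const,
    Finset.card_univ, Fintype.card_fin, nsmul_eq_mul, ← Finset.sum_mul, ← Finset.mul_sum, hn,
    dirD_timeDir_modKer hcs hτ₀ hc hp, modKer]
  field_simp
  ring


theorem lintegral_gaussian_dilate {b τ : ℝ} (hb : 0 < b) (hτ : 0 < τ) :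
    ∫⁻ v : Vec N, ENNReal.ofReal (τ ^ (-(N : ℝ) / 2) * Real.exp (-‖v‖ ^ 2 / (b * τ)))
      = ENNReal.ofReal ((b * Real.pi) ^ ((N : ℝ) / 2)) := by
  have hbt : 0 < 1 / (b * τ) := by positivity
  have h1 := GaussianFourier.integral_rexp_neg_mul_sq_norm (V := Vec N) hbt
  have hpos : 0 < (Real.pi / (1 / (b * τ))) ^ ((Module.finrank ℝ (Vec N) : ℝ) / 2) := by
    have := Real.pi_pos; positivity
  have hi : Integrable fun v : Vec N => Real.exp (-(1 / (b * τ)) * ‖v‖ ^ 2) := by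
    by_contra h
    rw [integral_undef h] at h1
    exact hpos.ne h1
  have h2 : ∀ v : Vec N, -‖v‖ ^ 2 / (b * τ) = -(1 / (b * τ)) * ‖v‖ ^ 2 := fun v => by ring
  have h3 := ofReal_integral_eq_lintegral_ofReal (hi.const_mul (τ ^ (-(N : ℝ) / 2)))
    (Eventually.of_forall fun v => by positivity)
  rw [integral_const_mul, h1, finrank_euclideanSpace_fin] at h3
  simp_rw [h2]
  rw [← h3]
  congr 1
  have : Real.pi / (1 / (b * τ)) = τ * (b * Real.pi) := by field_simp
  rw [this, Real.mul_rpow hτ.le (by have := Real.pi_pos; positivity), ← mul_assoc, ← Real.rpow_add hτ]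
  ring_nf
  simp

/-- Away from the origin in space the heat kernel is bounded, with all its polynomial weights in
time. -/
theorem exists_gauss_far_le (N : ℕ) : ∃ C, 0 ≤ C ∧ ∀ r τ, 1 / 16 ≤ r → 0 < τ → τ ≤ 1 →
    gauss N r τ * τ⁻¹ ≤ C := by
  refine ⟨64 ^ (N + 1) * (N + 1).factorial, by positivity, fun r τ hr hτ hτ1 => ?_⟩
  have h1 : gauss N r τ ≤ τ⁻¹ ^ N * Real.exp (-(1 / (64 * τ))) := by
    unfold gauss
    apply mul_le_mul _ _ (Real.exp_nonneg _) (by positivity)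
    · rw [inv_pow, ← Real.rpow_natCast, ← Real.rpow_neg hτ.le]
      apply Real.rpow_le_rpow_of_exponent_ge hτ hτ1
      have : (0 : ℝ) ≤ N := by positivity
      linarith
    · apply Real.exp_le_exp.2
      rw [neg_div, neg_le_neg_iff, div_le_div_iff₀ (by positivity) (by positivity)]
      nlinarith
  have h2 := Real.pow_div_factorial_le_exp (x := 1 / (64 * τ)) (by positivity) (N + 1)
  rw [div_le_iff₀ (by positivity)] at h2
  calc gauss N r τ * τ⁻¹ ≤ τ⁻¹ ^ N * Real.exp (-(1 / (64 * τ))) * τ⁻¹ := by gcongr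
    _ = 64 ^ (N + 1) * (1 / (64 * τ)) ^ (N + 1) * Real.exp (-(1 / (64 * τ))) := by
        rw [one_div, mul_inv, mul_pow, pow_succ (τ⁻¹), ← mul_assoc, ← mul_pow]
        norm_num
        ring
    _ ≤ 64 ^ (N + 1) * (Real.exp (1 / (64 * τ)) * (N + 1).factorial) * Real.exp (-(1 / (64 * τ))) := by
        gcongr
    _ = 64 ^ (N + 1) * (N + 1).factorial * (Real.exp (1 / (64 * τ)) * Real.exp (-(1 / (64 * τ)))) := by
        ring
    _ = _ := by rw [← Real.exp_add]; simp

/-- Half of the Gaussian decay absorbs the factor `|v| / τ` of its gradient. -/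
theorem norm_mul_gauss_le {s τ : ℝ} (hτ : 0 < τ) :
    s / τ * gauss N (s ^ 2) τ
      ≤ 4 * τ ^ (-1 / 2 : ℝ) * (τ ^ (-(N : ℝ) / 2) * Real.exp (-s ^ 2 / (8 * τ))) := by
  have hq : 0 < Real.sqrt τ := Real.sqrt_pos.2 hτ
  have hqq : Real.sqrt τ ^ 2 = τ := Real.sq_sqrt hτ.le
  have h0 : τ ^ (-1 / 2 : ℝ) = (Real.sqrt τ)⁻¹ := by
    rw [Real.sqrt_eq_rpow, ← Real.rpow_neg hτ.le]; norm_num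
  have h1 : s / Real.sqrt τ ≤ 4 * Real.exp (s ^ 2 / (8 * τ)) := by
    have h2 := Real.add_one_le_exp (s ^ 2 / (8 * τ))
    have h3 : s ^ 2 / (8 * τ) = (s / Real.sqrt τ) ^ 2 / 8 := by
      rw [div_pow, hqq]; field_simp
    rw [h3] at h2 ⊢
    nlinarith [sq_nonneg (s / Real.sqrt τ - 2)]
  have h4 : Real.exp (-s ^ 2 / (4 * τ)) * Real.exp (s ^ 2 / (8 * τ)) = Real.exp (-s ^ 2 / (8 * τ)) := by
    rw [← Real.exp_add]; congr 1; field_simp; ring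
  have h5 : s / τ = (s / Real.sqrt τ) * (Real.sqrt τ)⁻¹ := by
    nth_rewrite 1 [← hqq]; field_simp
  unfold gauss
  rw [h5, h0, ← h4]
  have h6 : 0 ≤ τ ^ (-(N : ℝ) / 2) := by positivity
  calc s / Real.sqrt τ * (Real.sqrt τ)⁻¹ * (τ ^ (-(N : ℝ) / 2) * Real.exp (-s ^ 2 / (4 * τ)))
      ≤ (4 * Real.exp (s ^ 2 / (8 * τ))) * (Real.sqrt τ)⁻¹ *
          (τ ^ (-(N : ℝ) / 2) * Real.exp (-s ^ 2 / (4 * τ))) := by gcongr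
    _ = _ := by ring

theorem setLIntegral_rpow_neg_half {η : ℝ} (hη : 0 < η) :
    ∫⁻ τ in Ioc 0 η, ENNReal.ofReal (τ ^ (-1 / 2 : ℝ)) = ENNReal.ofReal (2 * Real.sqrt η) := by
  have hi : IntervalIntegrable (fun τ : ℝ => τ ^ (-1 / 2 : ℝ)) volume 0 η :=
    intervalIntegral.intervalIntegrable_rpow' (by norm_num)
  rw [← ofReal_integral_eq_lintegral_ofReal
    ((intervalIntegrable_iff_integrableOn_Ioc_of_le hη.le).1 hi)
    ((ae_restrict_iff' measurableSet_Ioc).2 (Eventually.of_forall fun τ hτ => by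
      have := hτ.1; positivity)),
    ← intervalIntegral.integral_of_le hη.le, integral_rpow (Or.inl (by norm_num)), Real.sqrt_eq_rpow]
  congr 1
  norm_num
  ring

/-- The profile in time of the truncated heat kernel living between the time scales `δ` and `η`. -/
noncomputable def profile (δ η τ : ℝ) : ℝ := step (τ / δ) - step (τ / η)

/-- The derivative of the step at scale `δ`: a bump on `[δ/2, δ]` of total mass one. -/
noncomputable def bump (δ τ : ℝ) : ℝ := δ⁻¹ * deriv step (τ / δ)

theorem contDiff_profile (δ η : ℝ) : ContDiff ℝ ∞ (profile δ η) :=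
  (contDiff_step.comp (contDiff_id.div_const δ)).sub (contDiff_step.comp (contDiff_id.div_const η))

theorem contDiff_bump (δ : ℝ) : ContDiff ℝ ∞ (bump δ) :=
  contDiff_const.mul ((contDiff_infty_iff_deriv.1 contDiff_step).2.comp (contDiff_id.div_const δ))

theorem hasDerivAt_step_div (δ τ : ℝ) : HasDerivAt (fun τ => step (τ / δ)) (bump δ τ) τ := by
  have h1 : HasDerivAt step (deriv step (τ / δ)) (τ / δ) :=
    (contDiff_step.differentiable (by simp) _).hasDerivAt
  have h2 : HasDerivAt (fun τ : ℝ => τ / δ) (1 / δ) τ := (hasDerivAt_id τ).div_const δ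
  refine (h1.comp τ h2).congr_deriv ?_
  rw [bump]; ring

theorem deriv_profile (δ η : ℝ) : deriv (profile δ η) = fun τ => bump δ τ - bump η τ := by
  ext τ
  exact ((hasDerivAt_step_div δ τ).sub (hasDerivAt_step_div η τ)).deriv

theorem bump_nonneg {δ : ℝ} (hδ : 0 < δ) (τ : ℝ) : 0 ≤ bump δ τ :=
  mul_nonneg (by positivity) (deriv_step_nonneg _)

theorem bump_of_lt {δ τ : ℝ} (hδ : 0 < δ) (h : τ < δ / 2) : bump δ τ = 0 := by
  rw [bump, deriv_step_of_lt, mul_zero]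
  rw [div_lt_iff₀ hδ]; linarith

theorem bump_of_gt {δ τ : ℝ} (hδ : 0 < δ) (h : δ < τ) : bump δ τ = 0 := by
  rw [bump, deriv_step_of_gt, mul_zero]
  rwa [lt_div_iff₀ hδ, one_mul]

theorem profile_of_le {δ η τ : ℝ} (hδ : 0 < δ) (hη : δ ≤ η) (h : τ ≤ δ / 2) :
    profile δ η τ = 0 := by
  rw [profile, step_of_le, step_of_le, sub_self]
  · rw [div_le_iff₀ (hδ.trans_le hη)]; linarith
  · rw [div_le_iff₀ hδ]; linarith

theorem profile_of_ge {δ η τ : ℝ} (hδ : 0 < δ) (hη : δ ≤ η) (h : η ≤ τ) :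
    profile δ η τ = 0 := by
  rw [profile, step_of_ge, step_of_ge, sub_self]
  · rw [le_div_iff₀ (hδ.trans_le hη)]; linarith
  · rw [le_div_iff₀ hδ]; linarith

theorem abs_profile_le {δ η : ℝ} (τ : ℝ) :
    |profile δ η τ| ≤ 1 := by
  have h1 : ∀ x, 0 ≤ step x := fun x => Real.smoothTransition.nonneg _
  have h2 : ∀ x, step x ≤ 1 := fun x => Real.smoothTransition.le_one _
  rw [profile, abs_le]
  constructor <;> linarith [h1 (τ / δ), h1 (τ / η), h2 (τ / δ), h2 (τ / η)]

theorem lintegral_bump {δ : ℝ} (hδ : 0 < δ) :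
    ∫⁻ τ in Ioc (δ / 2) δ, ENNReal.ofReal (bump δ τ) = 1 := by
  have hle : δ / 2 ≤ δ := by linarith
  have hc : Continuous (bump δ) := (contDiff_bump δ).continuous
  rw [← ofReal_integral_eq_lintegral_ofReal (hc.integrableOn_Ioc)
    (Eventually.of_forall fun τ => bump_nonneg hδ τ), ← intervalIntegral.integral_of_le hle,
    intervalIntegral.integral_eq_sub_of_hasDerivAt (fun τ _ => hasDerivAt_step_div δ τ)
      (hc.intervalIntegrable _ _), step_of_ge, step_of_le]
  · simp
  · rw [div_le_iff₀ hδ]; linarith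
  · rw [div_self hδ.ne']

theorem enorm_modKer_profile_le (δ η : ℝ) (p : Vec N × ℝ) (hp : 0 < p.2) :
    ‖modKer (profile δ η) p‖ₑ ≤ ENNReal.ofReal (gauss N (‖p.1‖ ^ 2) p.2) := by
  rw [← ofReal_norm]
  apply ENNReal.ofReal_le_ofReal
  rw [modKer, norm_mul, norm_mul, Real.norm_of_nonneg (gauss_nonneg hp.le),
    Real.norm_of_nonneg (cutoff_nonneg _), Real.norm_eq_abs]
  have h1 := gauss_nonneg (N := N) (r := ‖p.1‖ ^ 2) hp.le
  have h2 : cutoff (‖p.1‖ ^ 2) * |profile δ η p.2| ≤ 1 :=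
    mul_le_one₀ (cutoff_le_one _) (abs_nonneg _) (abs_profile_le _)
  nlinarith

theorem lintegral_modKer_profile_le {δ η : ℝ} (hδ : 0 < δ) (hη : δ ≤ η) (τ : ℝ) :
    ∫⁻ v : Vec N, ‖modKer (profile δ η) (v, τ)‖ₑ
      ≤ ENNReal.ofReal ((4 * Real.pi) ^ ((N : ℝ) / 2)) := by
  rcases le_or_gt τ 0 with h | h
  · simp [modKer, profile_of_le hδ hη (show τ ≤ δ / 2 by linarith)]
  · rw [← lintegral_gaussian_dilate (by norm_num : (0 : ℝ) < 4) h]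
    exact lintegral_mono fun v => enorm_modKer_profile_le δ η (v, τ) h

theorem exists_lintegral_dirD_modKer_le (N : ℕ) : ∃ B : ℝ, 0 ≤ B ∧ ∀ δ η : ℝ, 0 < δ → δ ≤ η → η ≤ 1 →
    ∀ i : Fin N, ∫⁻ p : Vec N × ℝ, ‖dirD (spaceDir i) (modKer (profile δ η)) p‖ₑ
      ≤ ENNReal.ofReal (B * Real.sqrt η) := by
  obtain ⟨A, hA, hA'⟩ := exists_deriv_cutoff_le
  set D : ℝ := 8 * (A + 1) with hD
  have hD0 : 0 ≤ D := by positivity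
  refine ⟨D * (8 * Real.pi) ^ ((N : ℝ) / 2) * 2, by have := Real.pi_pos; positivity, ?_⟩
  intro δ η hδ hη hη1 i
  have hη0 : 0 < η := hδ.trans_le hη
  have hsm : ∀ τ ≤ δ / 2, profile δ η τ = 0 := fun τ h => profile_of_le hδ hη h
  have hδ2 : 0 < δ / 2 := by linarith
  have hform := fun p => dirD_spaceDir_modKer (N := N) (contDiff_profile δ η) hδ2 hsm p i
  have hmeas : Continuous (dirD (spaceDir i) (modKer (profile δ η)) : Vec N × ℝ → ℝ) :=
    (contDiff_dirD (contDiff_modKer (contDiff_profile δ η) hδ2 hsm) _).continuous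
  have hzero : ∀ τ, τ ∉ Ioc 0 η → ∀ v, dirD (spaceDir i) (modKer (profile δ η)) ((v, τ) : Vec N × ℝ) = 0 := by
    intro τ hτ v
    rw [hform]
    have : profile δ η τ = 0 := by
      rw [mem_Ioc, not_and_or, not_lt, not_le] at hτ
      rcases hτ with h | h
      · exact hsm _ (by linarith)
      · exact profile_of_ge hδ hη h.le
    simp [this]
  have hbound : ∀ τ, 0 < τ → τ ≤ η → ∀ v : Vec N,
      ‖dirD (spaceDir i) (modKer (profile δ η)) (v, τ)‖ₑ ≤
        ENNReal.ofReal (D * τ ^ (-1 / 2 : ℝ)) *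
          ENNReal.ofReal (τ ^ (-(N : ℝ) / 2) * Real.exp (-‖v‖ ^ 2 / (8 * τ))) := by
    intro τ hτ hτη v
    rw [← ENNReal.ofReal_mul (by positivity), ← ofReal_norm]
    apply ENNReal.ofReal_le_ofReal
    rw [hform]
    have hg := gauss_nonneg (N := N) (r := ‖v‖ ^ 2) hτ.le
    have hv : |v i| ≤ ‖v‖ := PiLp.norm_apply_le v i
    have hτi : 1 ≤ τ⁻¹ := (one_le_inv₀ hτ).2 (hτη.trans hη1)
    have h1 : |deriv cutoff (‖v‖ ^ 2) - cutoff (‖v‖ ^ 2) / (4 * τ)| ≤ (A + 1) * τ⁻¹ := by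
      have h2 : |cutoff (‖v‖ ^ 2) / (4 * τ)| ≤ τ⁻¹ := by
        rw [abs_of_nonneg (div_nonneg (cutoff_nonneg _) (by positivity)), div_le_iff₀ (by positivity)]
        have : τ⁻¹ * (4 * τ) = 4 := by field_simp
        rw [this]
        linarith [cutoff_le_one (‖v‖ ^ 2)]
      have h3 := (hA' (‖v‖ ^ 2) (by positivity)).1
      have h4 := abs_sub (deriv cutoff (‖v‖ ^ 2)) (cutoff (‖v‖ ^ 2) / (4 * τ))
      nlinarith
    calc ‖2 * v i * ((deriv cutoff (‖v‖ ^ 2) - cutoff (‖v‖ ^ 2) / (4 * τ)) * profile δ η τ *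
          gauss N (‖v‖ ^ 2) τ)‖
        = 2 * |v i| * (|deriv cutoff (‖v‖ ^ 2) - cutoff (‖v‖ ^ 2) / (4 * τ)| * |profile δ η τ| *
          gauss N (‖v‖ ^ 2) τ) := by
          simp [abs_of_nonneg hg]
      _ ≤ 2 * ‖v‖ * ((A + 1) * τ⁻¹ * 1 * gauss N (‖v‖ ^ 2) τ) := by
          gcongr
          exact abs_profile_le _
      _ = 2 * (A + 1) * (‖v‖ / τ * gauss N (‖v‖ ^ 2) τ) := by ring
      _ ≤ 2 * (A + 1) * (4 * τ ^ (-1 / 2 : ℝ) *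
            (τ ^ (-(N : ℝ) / 2) * Real.exp (-‖v‖ ^ 2 / (8 * τ)))) := by
          exact mul_le_mul_of_nonneg_left (norm_mul_gauss_le hτ) (by positivity)
      _ = _ := by rw [hD]; ring
  calc ∫⁻ p : Vec N × ℝ, ‖dirD (spaceDir i) (modKer (profile δ η)) p‖ₑ
      = ∫⁻ τ : ℝ, ∫⁻ v : Vec N, ‖dirD (spaceDir i) (modKer (profile δ η)) (v, τ)‖ₑ :=
        lintegral_prod_symm _ hmeas.measurable.enorm.aemeasurable
    _ = ∫⁻ τ in Ioc 0 η, ∫⁻ v : Vec N, ‖dirD (spaceDir i) (modKer (profile δ η)) (v, τ)‖ₑ := by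
        rw [← lintegral_indicator measurableSet_Ioc]
        refine lintegral_congr fun τ => ?_
        by_cases hτ : τ ∈ Ioc 0 η
        · rw [indicator_of_mem hτ]
        · rw [indicator_of_notMem hτ]
          simp [hzero τ hτ]
    _ ≤ ∫⁻ τ in Ioc 0 η, ENNReal.ofReal (D * τ ^ (-1 / 2 : ℝ)) *
          ENNReal.ofReal ((8 * Real.pi) ^ ((N : ℝ) / 2)) := by
        refine setLIntegral_mono' measurableSet_Ioc fun τ hτ => ?_
        rw [← lintegral_gaussian_dilate (by norm_num : (0 : ℝ) < 8) hτ.1,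
          ← lintegral_const_mul' _ _ ENNReal.ofReal_ne_top]
        exact lintegral_mono fun v => hbound τ hτ.1 hτ.2 v
    _ = _ := by
        rw [lintegral_mul_const' _ _ ENNReal.ofReal_ne_top]
        simp only [ENNReal.ofReal_mul hD0]
        rw [lintegral_const_mul' _ _ ENNReal.ofReal_ne_top, setLIntegral_rpow_neg_half hη0,
          ← ENNReal.ofReal_mul hD0, ← ENNReal.ofReal_mul (by positivity)]
        congr 1; ring


theorem hasCompactSupport_sum {X ι : Type*} [TopologicalSpace X] [Fintype ι] {k : ι → X → ℝ}
    (hk : ∀ i, HasCompactSupport (k i)) : HasCompactSupport fun p => ∑ i, k i p := by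
  have : ∀ s : Finset ι, HasCompactSupport fun p => ∑ i ∈ s, k i p := by
    intro s
    classical
    induction s using Finset.induction_on with
    | empty => simp only [Finset.sum_empty]; exact HasCompactSupport.zero
    | insert i s hi ih => simp only [Finset.sum_insert hi]; exact (hk i).add ih
  exact this _

/-- The error in the heat equation made by the truncations at unit scale in space and at scale `η`
in time is of the size of the kernel at scale `η`, and it lives in a cylinder of that height. -/
theorem exists_heat_error_le (N : ℕ) : ∃ B : ℝ, 0 ≤ B ∧ ∀ δ η : ℝ, 0 < δ → δ ≤ η → η ≤ 1 →
    ∀ p : Vec N × ℝ, ‖modKer (bump δ) p - (dirD timeDir (modKer (profile δ η)) p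
        - ∑ i, dirD (spaceDir i) (dirD (spaceDir i) (modKer (profile δ η))) p)‖ₑ
      ≤ (Metric.ball (0 : Vec N) (1 / 2) ×ˢ Ioc 0 η).indicator
        (fun _ => ENNReal.ofReal (B * η ^ (-(N : ℝ) / 2 - 1))) p := by
  obtain ⟨A, hA, hA'⟩ := exists_deriv_cutoff_le
  obtain ⟨Θ, hΘ, hΘ'⟩ := exists_deriv_step_le
  obtain ⟨G, hG, hG'⟩ := exists_gauss_far_le N
  refine ⟨Θ * (1 / 2) ^ (-(N : ℝ) / 2) + G * (A * (6 + 2 * N)), by positivity, ?_⟩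
  intro δ η hδ hη hη1 p
  have hη0 : 0 < η := hδ.trans_le hη
  have hsm : ∀ τ ≤ δ / 2, profile δ η τ = 0 := fun τ h => profile_of_le hδ hη h
  have hδ2 : 0 < δ / 2 := by linarith
  rcases le_or_gt p.2 0 with hp | hp
  · -- the kernel vanishes near such points
    have h0 : modKer (profile δ η) =ᶠ[𝓝 p] fun _ => 0 :=
      modKer_eventually_zero hsm (by linarith)
    have h1 : ∀ e : Vec N × ℝ, dirD e (modKer (profile δ η)) =ᶠ[𝓝 p] fun _ => 0 := by
      intro e
      have : dirD e (modKer (profile δ η)) =ᶠ[𝓝 p] dirD e (fun _ => 0) := by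
        filter_upwards [h0.fderiv (𝕜 := ℝ)] with q hq
        rw [dirD, hq, dirD]
      exact this.trans (Eventually.of_forall fun q => by simp [dirD])
    have h2 : ∀ i, dirD (spaceDir i) (dirD (spaceDir i) (modKer (profile δ η))) p = 0 := by
      intro i
      rw [dirD, (h1 _).fderiv_eq]; simp
    rw [(h1 timeDir).eq_of_nhds]
    simp [h2, modKer, bump_of_lt hδ (show p.2 < δ / 2 by linarith)]
  rw [heat_modKer (contDiff_profile δ η) hδ2 hsm p hp, deriv_profile]
  set r := ‖p.1‖ ^ 2 with hr
  have hr0 : 0 ≤ r := by positivity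
  have hsplit : modKer (bump δ) p - (modKer (fun τ => bump δ τ - bump η τ) p
      - profile δ η p.2 * gauss N r p.2 * (4 * r * deriv (deriv cutoff) r + 2 * N * deriv cutoff r
        - 2 * r / p.2 * deriv cutoff r))
      = cutoff r * bump η p.2 * gauss N r p.2
        + profile δ η p.2 * gauss N r p.2 * (4 * r * deriv (deriv cutoff) r
          + 2 * N * deriv cutoff r - 2 * r / p.2 * deriv cutoff r) := by
    simp only [modKer, ← hr]; ring
  rw [hsplit]
  have hg := gauss_nonneg (N := N) (r := r) hp.le
  by_cases hmem : p ∈ Metric.ball (0 : Vec N) (1 / 2) ×ˢ Ioc 0 η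
  · rw [indicator_of_mem hmem, ← ofReal_norm]
    have hτη : p.2 ≤ η := hmem.2.2
    have hv : ‖p.1‖ < 1 / 2 := by simpa using hmem.1
    have hr1 : r ≤ 1 := by rw [hr]; nlinarith [norm_nonneg p.1]
    apply ENNReal.ofReal_le_ofReal
    have hb1 : ‖cutoff r * bump η p.2 * gauss N r p.2‖
        ≤ Θ * (1 / 2) ^ (-(N : ℝ) / 2) * η ^ (-(N : ℝ) / 2 - 1) := by
      rcases lt_or_ge p.2 (η / 2) with h | h
      · rw [bump_of_lt hη0 h]; simp; positivity
      · have h1 : gauss N r p.2 ≤ (1 / 2) ^ (-(N : ℝ) / 2) * η ^ (-(N : ℝ) / 2) := by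
          rw [← Real.mul_rpow (by norm_num) hη0.le]
          have h2 : p.2 ^ (-(N : ℝ) / 2) ≤ (1 / 2 * η) ^ (-(N : ℝ) / 2) := by
            apply Real.rpow_le_rpow_of_nonpos (by positivity) (by linarith)
            have : (0 : ℝ) ≤ N := by positivity
            linarith
          have h3 : Real.exp (-r / (4 * p.2)) ≤ 1 := by
            apply Real.exp_le_one_iff.2
            apply div_nonpos_of_nonpos_of_nonneg <;> linarith
          exact (mul_le_of_le_one_right (by positivity) h3).trans h2
        have h4 : |bump η p.2| ≤ η⁻¹ * Θ := by
          rw [bump, abs_mul, abs_of_nonneg (by positivity)]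
          gcongr
          exact hΘ' _
        have h5 : |cutoff r| ≤ 1 := by rw [abs_of_nonneg (cutoff_nonneg r)]; exact cutoff_le_one r
        rw [norm_mul, norm_mul, Real.norm_eq_abs, Real.norm_eq_abs, Real.norm_of_nonneg hg]
        calc |cutoff r| * |bump η p.2| * gauss N r p.2
            ≤ 1 * (η⁻¹ * Θ) * ((1 / 2) ^ (-(N : ℝ) / 2) * η ^ (-(N : ℝ) / 2)) := by gcongr
          _ = _ := by rw [Real.rpow_sub_one hη0.ne']; field_simp
    have hη2 : 1 ≤ η ^ (-(N : ℝ) / 2 - 1) := by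
      apply Real.one_le_rpow_of_pos_of_le_one_of_nonpos hη0 hη1
      have : (0 : ℝ) ≤ N := by positivity
      linarith
    have hb2 : ‖profile δ η p.2 * gauss N r p.2 * (4 * r * deriv (deriv cutoff) r
          + 2 * N * deriv cutoff r - 2 * r / p.2 * deriv cutoff r)‖ ≤ G * (A * (6 + 2 * N)) := by
      rcases lt_or_ge r (1 / 16) with h | h
      · rw [(deriv_cutoff_of_lt h).1, (deriv_cutoff_of_lt h).2]; simp; positivity
      · obtain ⟨hA1, hA2⟩ := hA' r hr0
        have hτi : 1 ≤ p.2⁻¹ := (one_le_inv₀ hp).2 (hτη.trans hη1)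
        have h1 : |4 * r * deriv (deriv cutoff) r + 2 * N * deriv cutoff r
            - 2 * r / p.2 * deriv cutoff r| ≤ A * (6 + 2 * N) * p.2⁻¹ := by
          have e1 : |4 * r * deriv (deriv cutoff) r| ≤ 4 * A * p.2⁻¹ := by
            rw [abs_mul, abs_of_nonneg (by positivity)]
            calc 4 * r * |deriv (deriv cutoff) r| ≤ 4 * 1 * A := by gcongr
              _ = 4 * A * 1 := by ring
              _ ≤ _ := by gcongr
          have e2 : |2 * N * deriv cutoff r| ≤ 2 * N * A * p.2⁻¹ := by
            rw [abs_mul, abs_of_nonneg (by positivity)]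
            calc 2 * (N : ℝ) * |deriv cutoff r| ≤ 2 * N * A := by gcongr
              _ = 2 * N * A * 1 := by ring
              _ ≤ _ := by gcongr
          have e3 : |2 * r / p.2 * deriv cutoff r| ≤ 2 * A * p.2⁻¹ := by
            rw [abs_mul, abs_of_nonneg (by positivity)]
            calc 2 * r / p.2 * |deriv cutoff r| ≤ 2 * 1 / p.2 * A := by gcongr
              _ = _ := by ring
          calc _ ≤ |4 * r * deriv (deriv cutoff) r + 2 * N * deriv cutoff r|
                + |2 * r / p.2 * deriv cutoff r| := abs_sub _ _
            _ ≤ |4 * r * deriv (deriv cutoff) r| + |2 * N * deriv cutoff r|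
                + |2 * r / p.2 * deriv cutoff r| := by gcongr; exact abs_add_le _ _
            _ ≤ _ := by linarith
        rw [norm_mul, norm_mul, Real.norm_of_nonneg hg, Real.norm_eq_abs, Real.norm_eq_abs]
        calc |profile δ η p.2| * gauss N r p.2 * _
            ≤ 1 * gauss N r p.2 * (A * (6 + 2 * N) * p.2⁻¹) := by
              gcongr
              exact abs_profile_le _
          _ = (gauss N r p.2 * p.2⁻¹) * (A * (6 + 2 * N)) := by ring
          _ ≤ G * (A * (6 + 2 * N)) := by
              gcongr
              exact hG' r p.2 h hp (hτη.trans hη1)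
    refine (norm_add_le _ _).trans ?_
    rw [add_mul]
    refine add_le_add hb1 (hb2.trans ?_)
    exact le_mul_of_one_le_right (by positivity) hη2
  · rw [indicator_of_notMem hmem]
    rw [mem_prod, not_and_or] at hmem
    have : cutoff r * bump η p.2 * gauss N r p.2
        + profile δ η p.2 * gauss N r p.2 * (4 * r * deriv (deriv cutoff) r
          + 2 * N * deriv cutoff r - 2 * r / p.2 * deriv cutoff r) = 0 := by
      rcases hmem with h | h
      · have hv : 1 / 2 ≤ ‖p.1‖ := by simpa using h
        have hr2 : 1 / 5 < r := by rw [hr]; nlinarith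
        rw [cutoff_of_ge hr2.le, (deriv_cutoff_of_gt hr2).1, (deriv_cutoff_of_gt hr2).2]; simp
      · have h' : η < p.2 := by
          by_contra h3
          exact h ⟨hp, not_lt.1 h3⟩
        rw [bump_of_gt hη0 h', profile_of_ge hδ hη h'.le]; simp
    rw [this]; simp

/-- The mass that the heat kernel puts in a parabolic cylinder around the origin at a given time is
bounded below independently of that time. -/
theorem exists_le_lintegral_bump (N : ℕ) : ∃ c₀ : ℝ, 0 < c₀ ∧ ∀ δ ρ : ℝ, 0 < δ → δ ≤ 1 / 16 →
    δ < ρ → Real.sqrt δ < ρ →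
    ENNReal.ofReal c₀ ≤ ∫⁻ p in Metric.ball (0 : Vec N × ℝ) ρ, ‖modKer (bump δ) p‖ₑ := by
  set κ := (volume : Measure (Vec N)) (Metric.ball 0 1) with hκ
  have hκ0 : κ ≠ 0 := (Metric.measure_ball_pos _ _ one_pos).ne'
  have hκt : κ ≠ ⊤ := measure_ball_lt_top.ne
  refine ⟨Real.exp (-1 / 4) * κ.toReal, mul_pos (Real.exp_pos _) (ENNReal.toReal_pos hκ0 hκt), ?_⟩
  intro δ ρ hδ hδ1 hδρ hδρ'
  have hδ2 : 0 < δ / 2 := by linarith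
  have hm : Measurable fun p : Vec N × ℝ => ‖modKer (bump δ) p‖ₑ :=
    (contDiff_modKer (contDiff_bump δ) (by linarith : 0 < δ / 4)
      (fun τ h => bump_of_lt hδ (by linarith))).continuous.measurable.enorm
  have hlow : ∀ τ ∈ Ioc (δ / 2) δ, ENNReal.ofReal (bump δ τ) * (ENNReal.ofReal (Real.exp (-1 / 4)) * κ)
      ≤ ∫⁻ v : Vec N, (Metric.ball (0 : Vec N × ℝ) ρ).indicator
        (fun p => ‖modKer (bump δ) p‖ₑ) (v, τ) := by
    intro τ hτ
    have hτ0 : 0 < τ := hδ2.trans hτ.1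
    have hsq : 0 < Real.sqrt τ := Real.sqrt_pos.2 hτ0
    have hsqq : Real.sqrt τ ^ 2 = τ := Real.sq_sqrt hτ0.le
    calc ENNReal.ofReal (bump δ τ) * (ENNReal.ofReal (Real.exp (-1 / 4)) * κ)
        = ∫⁻ v in Metric.ball (0 : Vec N) (Real.sqrt τ),
            ENNReal.ofReal (bump δ τ * (τ ^ (-(N : ℝ) / 2) * Real.exp (-1 / 4))) := by
          rw [lintegral_const, Measure.restrict_apply_univ, Measure.addHaar_ball_of_pos _ _ hsq,
            finrank_euclideanSpace_fin, ENNReal.ofReal_mul (bump_nonneg hδ _),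
            ENNReal.ofReal_mul (by positivity), mul_assoc, mul_assoc]
          congr 1
          rw [← hκ, mul_comm (ENNReal.ofReal (Real.exp (-1 / 4))) (_ * _), mul_comm _ κ, mul_assoc,
            mul_comm κ, ← mul_assoc, mul_assoc]
          rw [← mul_assoc, ← mul_assoc, ← ENNReal.ofReal_mul (by positivity)]
          have : τ ^ (-(N : ℝ) / 2) * Real.sqrt τ ^ N = 1 := by
            rw [Real.sqrt_eq_rpow, ← Real.rpow_natCast, ← Real.rpow_mul hτ0.le, ← Real.rpow_add hτ0]
            ring_nf
            simp
          rw [this]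
          simp
      _ ≤ ∫⁻ v in Metric.ball (0 : Vec N) (Real.sqrt τ), (Metric.ball (0 : Vec N × ℝ) ρ).indicator
            (fun p => ‖modKer (bump δ) p‖ₑ) (v, τ) := by
          refine setLIntegral_mono' measurableSet_ball fun v hv => ?_
          have hv1 : ‖v‖ < Real.sqrt τ := by simpa using hv
          have hv2 : ‖v‖ ^ 2 ≤ τ := by rw [← hsqq]; gcongr
          have hmem : (v, τ) ∈ Metric.ball (0 : Vec N × ℝ) ρ := by
            rw [mem_ball_zero_iff, Prod.norm_def, max_lt_iff]
            refine ⟨hv1.trans_le ((Real.sqrt_le_sqrt hτ.2).trans hδρ'.le), ?_⟩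
            rw [Real.norm_of_nonneg hτ0.le]
            exact hτ.2.trans_lt hδρ
          rw [indicator_of_mem hmem, ← ofReal_norm]
          apply ENNReal.ofReal_le_ofReal
          refine le_trans ?_ (le_abs_self _)
          simp only [modKer]
          rw [cutoff_of_le (by linarith [hτ.2]), one_mul]
          refine mul_le_mul_of_nonneg_left ?_ (bump_nonneg hδ _)
          refine mul_le_mul_of_nonneg_left (Real.exp_le_exp.2 ?_) (by positivity)
          rw [div_le_div_iff₀ (by norm_num) (by positivity)]
          linarith
      _ ≤ _ := setLIntegral_le_lintegral _ _
  calc ENNReal.ofReal (Real.exp (-1 / 4) * κ.toReal)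
      = (∫⁻ τ in Ioc (δ / 2) δ, ENNReal.ofReal (bump δ τ)) * (ENNReal.ofReal (Real.exp (-1 / 4)) * κ) := by
        rw [lintegral_bump hδ, ENNReal.ofReal_mul (Real.exp_nonneg _), ENNReal.ofReal_toReal hκt, one_mul]
    _ = ∫⁻ τ in Ioc (δ / 2) δ, ENNReal.ofReal (bump δ τ) * (ENNReal.ofReal (Real.exp (-1 / 4)) * κ) :=
        (lintegral_mul_const' _ _ (ENNReal.mul_ne_top ENNReal.ofReal_ne_top hκt)).symm
    _ ≤ ∫⁻ τ in Ioc (δ / 2) δ, ∫⁻ v : Vec N, (Metric.ball (0 : Vec N × ℝ) ρ).indicator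
        (fun p => ‖modKer (bump δ) p‖ₑ) (v, τ) := setLIntegral_mono' measurableSet_Ioc hlow
    _ ≤ ∫⁻ τ : ℝ, ∫⁻ v : Vec N, (Metric.ball (0 : Vec N × ℝ) ρ).indicator
        (fun p => ‖modKer (bump δ) p‖ₑ) (v, τ) := setLIntegral_le_lintegral _ _
    _ = ∫⁻ p : Vec N × ℝ, (Metric.ball (0 : Vec N × ℝ) ρ).indicator
        (fun p => ‖modKer (bump δ) p‖ₑ) p :=
        (lintegral_prod_symm _ (hm.indicator measurableSet_ball).aemeasurable).symm
    _ = _ := lintegral_indicator measurableSet_ball _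

/-- A truncated fundamental solution of the heat equation at the time scale `η`: the heat operator
maps the kernel `K` to an approximate identity `R` up to an error `S`. The bounds on `K` and `S`
depend on `η` only, while `R` can be made as concentrated as one likes. -/
theorem exists_heat_parametrix (N : ℕ) : ∃ c₀ B : ℝ, 0 < c₀ ∧ 0 < B ∧
    ∀ η, 0 < η → η ≤ 1 → ∀ ρ, 0 < ρ → ∃ K R S : Vec N × ℝ → ℝ, ∃ τ₀ > 0,
      ContDiff ℝ ∞ K ∧ HasCompactSupport K ∧ (∀ p, p.2 ≤ τ₀ → K p = 0) ∧
      (∀ τ, ∫⁻ v, ‖K (v, τ)‖ₑ ≤ ENNReal.ofReal B) ∧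
      (∀ i, ∫⁻ p, ‖dirD (spaceDir i) K p‖ₑ ≤ ENNReal.ofReal (B * Real.sqrt η)) ∧
      Continuous R ∧ HasCompactSupport R ∧ (∀ p, 0 ≤ R p) ∧
      ENNReal.ofReal c₀ ≤ ∫⁻ p in Metric.ball 0 ρ, ‖R p‖ₑ ∧
      Continuous S ∧ HasCompactSupport S ∧
      (∀ p, ‖S p‖ₑ ≤ (Metric.ball (0 : Vec N) (1 / 2) ×ˢ Ioc 0 η).indicator
        (fun _ => ENNReal.ofReal (B * η ^ (-(N : ℝ) / 2 - 1))) p) ∧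
      ∀ p, dirD timeDir K p - ∑ i, dirD (spaceDir i) (dirD (spaceDir i) K) p = R p - S p := by
  obtain ⟨B₁, hB₁, h₁⟩ := exists_lintegral_dirD_modKer_le N
  obtain ⟨B₂, hB₂, h₂⟩ := exists_heat_error_le N
  obtain ⟨c₀, hc₀, h₃⟩ := exists_le_lintegral_bump N
  set B₃ : ℝ := (4 * Real.pi) ^ ((N : ℝ) / 2) with hB₃
  have hB₃0 : 0 < B₃ := by have := Real.pi_pos; positivity
  refine ⟨c₀, B₁ + B₂ + B₃, hc₀, by positivity, fun η hη hη1 ρ hρ => ?_⟩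
  obtain ⟨δ, hδ, hδη, hδ16, hδρ, hδρ'⟩ : ∃ δ, 0 < δ ∧ δ ≤ η ∧ δ ≤ 1 / 16 ∧ δ < ρ ∧ Real.sqrt δ < ρ := by
    refine ⟨min (min η (1 / 16)) (min (ρ / 2) ((ρ / 2) ^ 2)), by positivity,
      (min_le_left _ _).trans (min_le_left _ _), (min_le_left _ _).trans (min_le_right _ _),
      ((min_le_right _ _).trans (min_le_left _ _)).trans_lt (by linarith), ?_⟩
    have : Real.sqrt (min (min η (1 / 16)) (min (ρ / 2) ((ρ / 2) ^ 2))) ≤ Real.sqrt ((ρ / 2) ^ 2) :=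
      Real.sqrt_le_sqrt ((min_le_right _ _).trans (min_le_right _ _))
    rw [Real.sqrt_sq (by positivity)] at this
    linarith
  have hδ2 : 0 < δ / 2 := by linarith
  have hsm : ∀ τ ≤ δ / 2, profile δ η τ = 0 := fun τ h => profile_of_le hδ hδη h
  have hK : ContDiff ℝ ∞ (modKer (profile δ η) : Vec N × ℝ → ℝ) :=
    contDiff_modKer (contDiff_profile δ η) hδ2 hsm
  have hKc : HasCompactSupport (modKer (profile δ η) : Vec N × ℝ → ℝ) :=
    hasCompactSupport_modKer (fun τ h => hsm τ (by linarith))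
      fun τ h => profile_of_ge hδ hδη (by linarith)
  have hR : Continuous (modKer (bump δ) : Vec N × ℝ → ℝ) :=
    (contDiff_modKer (contDiff_bump δ) (by linarith : 0 < δ / 4)
      (fun τ h => bump_of_lt hδ (by linarith))).continuous
  have hRc : HasCompactSupport (modKer (bump δ) : Vec N × ℝ → ℝ) :=
    hasCompactSupport_modKer (fun τ h => bump_of_lt hδ (by linarith))
      fun τ h => bump_of_gt hδ (by linarith)
  have hD := fun e => contDiff_dirD hK e
  have hDc := fun e => hasCompactSupport_dirD hKc e
  have hη' : 0 ≤ η ^ (-(N : ℝ) / 2 - 1) := by positivity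
  refine ⟨modKer (profile δ η), modKer (bump δ), fun p => modKer (bump δ) p -
    (dirD timeDir (modKer (profile δ η)) p
      - ∑ i, dirD (spaceDir i) (dirD (spaceDir i) (modKer (profile δ η))) p), δ / 2, hδ2, hK, hKc,
    fun p hp => by simp [modKer, hsm _ hp], fun τ => ?_, fun i => ?_, hR, hRc, fun p => ?_,
    h₃ δ ρ hδ hδ16 hδρ hδρ', ?_, ?_, fun p => ?_, fun p => by ring⟩
  · exact (lintegral_modKer_profile_le hδ hδη τ).trans (ENNReal.ofReal_le_ofReal (by linarith))
  · refine (h₁ δ η hδ hδη hη1 i).trans (ENNReal.ofReal_le_ofReal ?_)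
    gcongr; linarith
  · rcases le_or_gt p.2 0 with h | h
    · simp [modKer, bump_of_lt hδ (show p.2 < δ / 2 by linarith)]
    · exact mul_nonneg (mul_nonneg (cutoff_nonneg _) (bump_nonneg hδ _)) (gauss_nonneg h.le)
  · exact hR.sub ((hD _).continuous.sub
      (continuous_finsetSum _ fun i _ => (contDiff_dirD (hD _) _).continuous))
  · refine hRc.sub ((hDc _).sub ?_)
    exact hasCompactSupport_sum fun i => hasCompactSupport_dirD (hDc (spaceDir i)) (spaceDir i)
  · refine (h₂ δ η hδ hδη hη1 p).trans ?_
    refine indicator_le_indicator (ENNReal.ofReal_le_ofReal ?_)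
    gcongr; linarith

/-! ### A priori estimate for the Fokker-Planck equation on test densities -/

theorem cyl_eq_restrict (N : ℕ) (T : ℝ) :
    cyl N T = (volume : Measure (Torus N × ℝ)).restrict (univ ×ˢ Ioo 0 T) := by
  rw [cyl, Measure.volume_eq_prod, ← Measure.prod_restrict, Measure.restrict_univ]

theorem ae_aemeasurable_slice {T : ℝ} {m : Torus N × ℝ → ℝ} (hm : AEMeasurable m (cyl N T)) :
    ∀ᵐ t ∂(volume.restrict (Ioo 0 T)), AEMeasurable (fun x => m (x, t)) volume := by
  have h1 : AEStronglyMeasurable m (volume.prod (volume.restrict (Ioo 0 T))) :=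
    AEMeasurable.aestronglyMeasurable hm
  filter_upwards [h1.prod_swap.prodMk_left] with t ht using ht.aemeasurable

theorem measurable_slice_mass {ψ : Torus N × ℝ → ℝ} (hψ : Continuous ψ) :
    Measurable fun s => ∫⁻ x, ‖ψ (x, s)‖ₑ :=
  Measurable.lintegral_prod_left' (f := fun z : Torus N × ℝ => ‖ψ z‖ₑ) hψ.measurable.enorm

theorem lintegral_slice_mass {ψ : Torus N × ℝ → ℝ} (hψ : Continuous ψ) :
    ∫⁻ s, ∫⁻ x, ‖ψ (x, s)‖ₑ = ∫⁻ z, ‖ψ z‖ₑ :=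
  (lintegral_prod_symm _ hψ.measurable.enorm.aemeasurable).symm

/-- Correlation with a kernel that is bounded by `C` and supported in the cylinder of height `η` over
the ball of radius `1/2`, averaged against a density of unit mass at almost every time. -/
theorem lintegral_mul_corr_le {ψ : Torus N × ℝ → ℝ} (hψ : Continuous ψ) {k : Vec N × ℝ → ℝ}
    {C : ℝ≥0∞} (hC : C ≠ ⊤) {η : ℝ}
    (hk : ∀ p, ‖k p‖ₑ ≤ (Metric.ball (0 : Vec N) (1 / 2) ×ˢ Ioc 0 η).indicator (fun _ => C) p)
    {T : ℝ} {m : Torus N × ℝ → ℝ} (hm : AEMeasurable m (cyl N T))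
    (hmass : ∀ᵐ t ∂(volume.restrict (Ioo 0 T)), ∫⁻ x, ENNReal.ofReal (m (x, t)) = 1) :
    ∫⁻ z, ENNReal.ofReal (m z) * ‖corr ψ k z‖ₑ ∂(cyl N T)
      ≤ C * ENNReal.ofReal η * ∫⁻ z, ‖ψ z‖ₑ := by
  set Ψ : ℝ → ℝ≥0∞ := fun s => ∫⁻ x, ‖ψ (x, s)‖ₑ with hΨ
  have hΨm : Measurable Ψ := measurable_slice_mass hψ
  set h : ℝ → ℝ≥0∞ := fun t => C * ∫⁻ τ in Ioc 0 η, Ψ (t + τ) with hh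
  have hpair : Measurable fun q : ℝ × ℝ => Ψ (q.1 + q.2) :=
    hΨm.comp (measurable_fst.add measurable_snd)
  have hhm : Measurable h := measurable_const.mul
    (Measurable.lintegral_prod_right' (ν := volume.restrict (Ioc 0 η)) hpair)
  have hpt : ∀ z : Torus N × ℝ, ‖corr ψ k z‖ₑ ≤ h z.2 := by
    intro z
    have hmz : Measurable fun p : Vec N × ℝ => ‖ψ (z.1 + toTorus p.1, z.2 + p.2)‖ₑ :=
      (measurable_corr_integrand hψ).comp (measurable_const.prodMk measurable_id)
    calc ‖corr ψ k z‖ₑ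
        ≤ ∫⁻ p : Vec N × ℝ, ‖ψ (z.1 + toTorus p.1, z.2 + p.2)‖ₑ * ‖k p‖ₑ := enorm_corr_le ψ k z
      _ ≤ ∫⁻ p : Vec N × ℝ, (Metric.ball (0 : Vec N) (1 / 2) ×ˢ Ioc 0 η).indicator
            (fun p => ‖ψ (z.1 + toTorus p.1, z.2 + p.2)‖ₑ * C) p := by
          refine lintegral_mono fun p => ?_
          refine (mul_le_mul_right (hk p) _).trans ?_
          by_cases hp : p ∈ Metric.ball (0 : Vec N) (1 / 2) ×ˢ Ioc 0 η
          · rw [indicator_of_mem hp, indicator_of_mem hp]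
          · rw [indicator_of_notMem hp, indicator_of_notMem hp, mul_zero]
      _ = ∫⁻ p : Vec N × ℝ in Metric.ball (0 : Vec N) (1 / 2) ×ˢ Ioc 0 η,
            ‖ψ (z.1 + toTorus p.1, z.2 + p.2)‖ₑ * C :=
          lintegral_indicator (measurableSet_ball.prod measurableSet_Ioc) _
      _ = ∫⁻ τ in Ioc 0 η, ∫⁻ v in Metric.ball (0 : Vec N) (1 / 2),
            ‖ψ (z.1 + toTorus v, z.2 + τ)‖ₑ * C := by
          rw [Measure.volume_eq_prod, ← Measure.prod_restrict]
          exact lintegral_prod_symm _ (hmz.mul_const C).aemeasurable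
      _ ≤ ∫⁻ τ in Ioc 0 η, Ψ (z.2 + τ) * C := by
          refine lintegral_mono fun τ => ?_
          simp only
          rw [lintegral_mul_const' _ _ hC]
          gcongr
          exact setLIntegral_ball_toTorus_le (g := fun x => ‖ψ (x, z.2 + τ)‖ₑ)
            (hψ.comp (by fun_prop : Continuous fun x : Torus N => (x, z.2 + τ))).measurable.enorm z.1
      _ = h z.2 := by rw [lintegral_mul_const' _ _ hC, mul_comm]
  calc ∫⁻ z, ENNReal.ofReal (m z) * ‖corr ψ k z‖ₑ ∂(cyl N T)
      ≤ ∫⁻ z, ENNReal.ofReal (m z) * h z.2 ∂(cyl N T) :=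
        lintegral_mono fun z => mul_le_mul_right (hpt z) _
    _ = ∫⁻ t in Ioo 0 T, ∫⁻ x, ENNReal.ofReal (m (x, t)) * h t :=
        lintegral_prod_symm _ (hm.ennreal_ofReal.mul (hhm.comp measurable_snd).aemeasurable)
    _ = ∫⁻ t in Ioo 0 T, h t := by
        refine lintegral_congr_ae ?_
        filter_upwards [hmass, ae_aemeasurable_slice hm] with t ht ht'
        rw [lintegral_mul_const'' _ ht'.ennreal_ofReal, ht, one_mul]
    _ ≤ ∫⁻ t, h t := setLIntegral_le_lintegral _ _
    _ = C * ∫⁻ t, ∫⁻ τ in Ioc 0 η, Ψ (t + τ) := lintegral_const_mul' _ _ hC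
    _ = C * ∫⁻ τ in Ioc 0 η, ∫⁻ t, Ψ (t + τ) := by
        rw [lintegral_lintegral_swap hpair.aemeasurable]
    _ = C * ∫⁻ τ in Ioc 0 η, ∫⁻ t, Ψ t := by
        congr 1
        refine lintegral_congr fun τ => lintegral_add_right_eq_self Ψ τ
    _ = _ := by
        rw [lintegral_const, Measure.restrict_apply_univ, Real.volume_Ioc, sub_zero,
          lintegral_slice_mass hψ]
        ring

/-- The trace at a fixed time of a correlation is controlled in `L^1`. -/
theorem lintegral_corr_zero_le {ψ : Torus N × ℝ → ℝ} (hψ : Continuous ψ) {k : Vec N × ℝ → ℝ}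
    (hk : Continuous k) {B : ℝ≥0∞} (hB : ∀ τ, ∫⁻ v, ‖k (v, τ)‖ₑ ≤ B) :
    ∫⁻ x, ‖corr ψ k (x, 0)‖ₑ ≤ B * ∫⁻ z, ‖ψ z‖ₑ := by
  have hk' : Measurable fun p => ‖k p‖ₑ := hk.measurable.enorm
  have hm1 : Measurable fun q : Torus N × (Vec N × ℝ) => ‖ψ (q.1 + toTorus q.2.1, 0 + q.2.2)‖ₑ := by
    have := (continuous_toTorus (N := N))
    refine (Continuous.measurable ?_).enorm
    fun_prop
  calc ∫⁻ x, ‖corr ψ k (x, 0)‖ₑ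
      ≤ ∫⁻ x : Torus N, ∫⁻ p : Vec N × ℝ, ‖ψ (x + toTorus p.1, 0 + p.2)‖ₑ * ‖k p‖ₑ :=
        lintegral_mono fun x => enorm_corr_le ψ k (x, 0)
    _ = ∫⁻ p : Vec N × ℝ, ∫⁻ x : Torus N, ‖ψ (x + toTorus p.1, 0 + p.2)‖ₑ * ‖k p‖ₑ :=
        lintegral_lintegral_swap (hm1.mul (hk'.comp measurable_snd)).aemeasurable
    _ = ∫⁻ p : Vec N × ℝ, (∫⁻ x, ‖ψ (x, p.2)‖ₑ) * ‖k p‖ₑ := by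
        refine lintegral_congr fun p => ?_
        have hm : Measurable fun x : Torus N => ‖ψ (x + toTorus p.1, 0 + p.2)‖ₑ :=
          hm1.comp (measurable_id.prodMk measurable_const)
        rw [lintegral_mul_const _ hm, zero_add]
        congr 1
        exact lintegral_add_right_eq_self (fun x => ‖ψ (x, p.2)‖ₑ) (toTorus p.1)
    _ = ∫⁻ τ : ℝ, ∫⁻ v : Vec N, (∫⁻ x, ‖ψ (x, τ)‖ₑ) * ‖k (v, τ)‖ₑ :=
        lintegral_prod_symm _ (((measurable_slice_mass hψ).comp measurable_snd).mul hk').aemeasurable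
    _ ≤ ∫⁻ τ : ℝ, (∫⁻ x, ‖ψ (x, τ)‖ₑ) * B := by
        refine lintegral_mono fun τ => ?_
        simp only
        have hkτ : Measurable fun v => ‖k (v, τ)‖ₑ :=
          hk'.comp (measurable_id.prodMk measurable_const)
        rw [lintegral_const_mul _ hkτ]
        exact mul_le_mul_right (hB τ) _
    _ = _ := by
        rw [lintegral_mul_const _ (measurable_slice_mass hψ), lintegral_slice_mass hψ, mul_comm]

/-- An approximate identity does not lose more than a fixed factor of a test function, up to the
oscillation `κ` of that function at the scale of the approximation. -/
theorem mul_sub_le_corr {ψ : Torus N × ℝ → ℝ} (hψ : Continuous ψ) (hψ0 : ∀ z, 0 ≤ ψ z)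
    {R : Vec N × ℝ → ℝ} (hR : Continuous R) (hRc : HasCompactSupport R) (hR0 : ∀ p, 0 ≤ R p)
    {c₀ κ ρ : ℝ} (hc₀ : 0 ≤ c₀) (hmass : ENNReal.ofReal c₀ ≤ ∫⁻ p in Metric.ball 0 ρ, ‖R p‖ₑ)
    (z : Torus N × ℝ)
    (hosc : ∀ p ∈ Metric.ball (0 : Vec N × ℝ) ρ, ψ z - κ ≤ ψ (z.1 + toTorus p.1, z.2 + p.2)) :
    c₀ * (ψ z - κ) ≤ corr ψ R z := by
  have hi := integrable_corr_integrand hψ hR hRc z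
  have hpos : ∀ p : Vec N × ℝ, 0 ≤ ψ (z.1 + toTorus p.1, z.2 + p.2) * R p :=
    fun p => mul_nonneg (hψ0 _) (hR0 p)
  rcases le_or_gt (ψ z - κ) 0 with h | h
  · exact (mul_nonpos_of_nonneg_of_nonpos hc₀ h).trans (integral_nonneg hpos)
  · have hRi : Integrable R := hR.integrable_of_hasCompactSupport hRc
    have h1 : c₀ ≤ ∫ p in Metric.ball 0 ρ, R p := by
      have h2 := ofReal_integral_eq_lintegral_ofReal hRi.integrableOn
        (Eventually.of_forall hR0 : 0 ≤ᵐ[volume.restrict (Metric.ball (0 : Vec N × ℝ) ρ)] R)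
      have h3 : ∫⁻ p in Metric.ball (0 : Vec N × ℝ) ρ, ‖R p‖ₑ
          = ∫⁻ p in Metric.ball (0 : Vec N × ℝ) ρ, ENNReal.ofReal (R p) :=
        lintegral_congr fun p => by rw [Real.enorm_of_nonneg (hR0 p)]
      rw [h3, ← h2] at hmass
      exact (ENNReal.ofReal_le_ofReal_iff (integral_nonneg hR0)).1 hmass
    calc c₀ * (ψ z - κ) ≤ (∫ p in Metric.ball 0 ρ, R p) * (ψ z - κ) := by gcongr
      _ = ∫ p in Metric.ball 0 ρ, (ψ z - κ) * R p := by
          rw [integral_const_mul, mul_comm]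
      _ ≤ ∫ p in Metric.ball (0 : Vec N × ℝ) ρ, ψ (z.1 + toTorus p.1, z.2 + p.2) * R p := by
          refine setIntegral_mono_on (hRi.integrableOn.const_mul _) hi.integrableOn
            measurableSet_ball fun p hp => ?_
          exact mul_le_mul_of_nonneg_right (hosc p hp) (hR0 p)
      _ ≤ corr ψ R z := setIntegral_le_integral hi (Eventually.of_forall hpos)

theorem exists_norm_corr_le {ψ : Torus N × ℝ → ℝ} (hψ : ∀ z, ‖ψ z‖ ≤ 1) {k : Vec N × ℝ → ℝ}
    (hk : Continuous k) (hkc : HasCompactSupport k) : ∃ C, ∀ z, ‖corr ψ k z‖ ≤ C := by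
  have hfin : ∫⁻ p, ‖k p‖ₑ < ⊤ := (hk.integrable_of_hasCompactSupport hkc).2
  refine ⟨(∫⁻ p, ‖k p‖ₑ).toReal, fun z => ?_⟩
  have := ENNReal.toReal_mono hfin.ne (enorm_corr_le_of_norm_le_one hψ k z)
  simpa using this

theorem continuous_grad_corr {ψ : Torus N × ℝ → ℝ} (hψ : Continuous ψ) {k : Vec N × ℝ → ℝ}
    (hk : ContDiff ℝ ∞ k) (hkc : HasCompactSupport k) :
    Continuous fun z : Torus N × ℝ => grad (fun x => corr ψ k (x, z.2)) z.1 := by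
  have h : (fun z : Torus N × ℝ => grad (fun x => corr ψ k (x, z.2)) z.1)
      = fun z => WithLp.toLp 2 fun i => -corr ψ (dirD (spaceDir i) k) z := by
    ext z i
    rw [grad_corr_apply hψ hk hkc]
  rw [h]
  refine (PiLp.continuous_toLp 2 _).comp (continuous_pi fun i => ?_)
  exact (continuous_corr hψ (contDiff_dirD hk _).continuous (hasCompactSupport_dirD hkc _)).neg


theorem isTest_corr {T : ℝ} {ψ : Torus N × ℝ → ℝ} (hψ : Continuous ψ)
    (hψT : ∀ x t, T ≤ t → ψ (x, t) = 0) {K : Vec N × ℝ → ℝ} (hK : ContDiff ℝ ∞ K)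
    (hKc : HasCompactSupport K) {τ₀ : ℝ} (hτ₀ : 0 < τ₀) (hK0 : ∀ p, p.2 ≤ τ₀ → K p = 0) :
    IsTest T (corr ψ K) := by
  refine ⟨contDiff_lift_corr hψ hK hKc, T - τ₀, by linarith, fun x t ht => ?_⟩
  unfold corr
  rw [← integral_zero (Vec N × ℝ) ℝ]
  refine integral_congr_ae (Eventually.of_forall fun p => ?_)
  rcases le_or_gt p.2 τ₀ with h | h
  · simp [hK0 p h]
  · simp [hψT (x + toTorus p.1) (t + p.2) (by linarith)]

/-- The oscillation of a compactly supported continuous function under small translations. -/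
theorem exists_ball_sub_le {ψ : Torus N × ℝ → ℝ} (hψ : Continuous ψ) (hψc : HasCompactSupport ψ)
    {κ : ℝ} (hκ : 0 < κ) : ∃ ρ > 0, ∀ z : Torus N × ℝ, ∀ p ∈ Metric.ball (0 : Vec N × ℝ) ρ,
      ψ z - κ ≤ ψ (z.1 + toTorus p.1, z.2 + p.2) := by
  have hu := hψc.uniformContinuous_of_continuous hψ
  obtain ⟨ε, hε, h⟩ := Metric.uniformContinuous_iff.1 hu κ hκ
  have hc : ContinuousAt (fun p : Vec N × ℝ => ((toTorus p.1, p.2) : Torus N × ℝ)) 0 :=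
    ((continuous_toTorus.comp continuous_fst).prodMk continuous_snd).continuousAt
  obtain ⟨ρ, hρ, h'⟩ := Metric.continuousAt_iff.1 hc ε hε
  refine ⟨ρ, hρ, fun z p hp => ?_⟩
  have h1 := h' hp
  simp only [Prod.fst_zero, Prod.snd_zero, toTorus_zero] at h1
  have h2 : dist ((z.1 + toTorus p.1, z.2 + p.2) : Torus N × ℝ) z < ε := by
    have : ((z.1 + toTorus p.1, z.2 + p.2) : Torus N × ℝ) = z + (toTorus p.1, p.2) := rfl
    rw [this, dist_eq_norm, add_sub_cancel_left]
    have h3 : ((0, 0) : Torus N × ℝ) = 0 := rfl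
    rwa [h3, dist_zero_right] at h1
  have h4 := h h2
  rw [Real.dist_eq, abs_lt] at h4
  linarith [h4.1]

/-- Testing the Fokker-Planck equation with the solution of a truncated backward heat equation whose
right-hand side is `ψ`. The first term on the right comes from the total mass of `m`, through the
`L^1`-`L^∞` smoothing of the heat flow over times `η`; the factor `g` of the flux is the modulus of
the gradient of the test function, which is of size `√η` both in `L^1` relative to `ψ` and in
`L^∞`. -/
theorem exists_duality_estimate (N : ℕ) : ∃ c₀ B : ℝ, 0 < c₀ ∧ 0 < B ∧
    ∀ (T M₀ : ℝ) (m₀ : Torus N → ℝ) (m : Torus N × ℝ → ℝ) (w : Torus N × ℝ → Vec N),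
      (∀ x, |m₀ x| ≤ M₀) → Integrable m (cyl N T) → Integrable w (cyl N T) →
      (∀ᵐ z ∂(cyl N T), 0 ≤ m z) →
      (∀ᵐ t ∂(volume.restrict (Ioo 0 T)), ∫⁻ x, ENNReal.ofReal (m (x, t)) = 1) →
      SolvesFP T m₀ m w →
      ∀ η, 0 < η → η ≤ 1 → ∀ ψ : Torus N × ℝ → ℝ, Continuous ψ → HasCompactSupport ψ →
        (∀ z, 0 ≤ ψ z) → (∀ z, ψ z ≤ 1) → (∀ x t, T ≤ t → ψ (x, t) = 0) → ∀ κ, 0 < κ →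
        ∃ g : Torus N × ℝ → ℝ, Continuous g ∧ (∀ z, 0 ≤ g z) ∧ (∀ z, g z ≤ B * Real.sqrt η) ∧
          ∫⁻ z, ENNReal.ofReal (g z) ∂(cyl N T) ≤ ENNReal.ofReal (B * Real.sqrt η) * ∫⁻ z, ‖ψ z‖ₑ ∧
          c₀ * ∫ z, m z * (ψ z - κ) ∂(cyl N T) ≤
            (B * η ^ (-(N : ℝ) / 2) + B * M₀) * (∫⁻ z, ‖ψ z‖ₑ).toReal
              + ∫ z, ‖w z‖ * g z ∂(cyl N T) := by
  obtain ⟨c₀, B, hc₀, hB, hpar⟩ := exists_heat_parametrix N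
  refine ⟨c₀, B * (N + 1), hc₀, by positivity, ?_⟩
  intro T M₀ m₀ m w hm₀ hm hw hm0 hmass hFP η hη hη1 ψ hψ hψc hψ0 hψ1 hψT κ hκ
  obtain ⟨ρ, hρ, hosc⟩ := exists_ball_sub_le hψ hψc hκ
  obtain ⟨K, R, S, τ₀, hτ₀, hK, hKc, hK0, hKmass, hKgrad, hR, hRc, hR0, hRmass, hS, hSc, hSle, heq⟩ :=
    hpar η hη hη1 ρ hρ
  have hψn : ∀ z, ‖ψ z‖ ≤ 1 := fun z => by rw [Real.norm_of_nonneg (hψ0 z)]; exact hψ1 z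
  have hM₀ : 0 ≤ M₀ := (abs_nonneg _).trans (hm₀ 0)
  have hD := fun i => contDiff_dirD hK (spaceDir i)
  have hDc := fun i => hasCompactSupport_dirD hKc (spaceDir i)
  have hDD := fun i => contDiff_dirD (hD i) (spaceDir i)
  have hDDc := fun i => hasCompactSupport_dirD (hDc i) (spaceDir i)
  set I : ℝ≥0∞ := ∫⁻ z, ‖ψ z‖ₑ with hI
  have hIfin : I < ⊤ := (hψ.integrable_of_hasCompactSupport hψc).2
  have hbdd : ∀ i z, |corr ψ (dirD (spaceDir i) K) z| ≤ B * Real.sqrt η := fun i z => by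
    have h := (enorm_corr_le_of_norm_le_one hψn (dirD (spaceDir i) K) z).trans (hKgrad i)
    rw [← ofReal_norm] at h
    exact (ENNReal.ofReal_le_ofReal_iff (by positivity)).1 h
  set g : Torus N × ℝ → ℝ := fun z => ∑ i, |corr ψ (dirD (spaceDir i) K) z| with hg
  have hgc : Continuous g := continuous_finsetSum _ fun i _ =>
    (continuous_corr hψ (hD i).continuous (hDc i)).abs
  have hg0 : ∀ z, 0 ≤ g z := fun z => Finset.sum_nonneg fun i _ => abs_nonneg _
  have hgle : ∀ z, g z ≤ N * (B * Real.sqrt η) := fun z =>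
    (Finset.sum_le_sum fun i _ => hbdd i z).trans (by simp)
  have hNB : N * (B * Real.sqrt η) ≤ B * (N + 1) * Real.sqrt η := by
    have : 0 ≤ B * Real.sqrt η := by positivity
    nlinarith
  refine ⟨g, hgc, hg0, fun z => (hgle z).trans hNB, ?_, ?_⟩
  · calc ∫⁻ z, ENNReal.ofReal (g z) ∂(cyl N T)
        ≤ ∫⁻ z, ENNReal.ofReal (g z) := by
          rw [cyl_eq_restrict]; exact setLIntegral_le_lintegral _ _
      _ = ∫⁻ z, ∑ i, ‖corr ψ (dirD (spaceDir i) K) z‖ₑ := by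
          refine lintegral_congr fun z => ?_
          rw [hg, ENNReal.ofReal_sum_of_nonneg fun i _ => abs_nonneg _]
          exact Finset.sum_congr rfl fun i _ => (ofReal_norm (corr ψ (dirD (spaceDir i) K) z))
      _ = ∑ i, ∫⁻ z, ‖corr ψ (dirD (spaceDir i) K) z‖ₑ :=
          lintegral_finsetSum _ fun i _ =>
            (continuous_corr hψ (hD i).continuous (hDc i)).measurable.enorm
      _ ≤ ∑ i : Fin N, I * ENNReal.ofReal (B * Real.sqrt η) := by
          refine Finset.sum_le_sum fun i _ => ?_
          exact (lintegral_enorm_corr_le hψ (hD i).continuous).trans (mul_le_mul_right (hKgrad i) _)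
      _ = ENNReal.ofReal (N * (B * Real.sqrt η)) * I := by
          rw [Finset.sum_const, Finset.card_univ, Fintype.card_fin, nsmul_eq_mul,
            ENNReal.ofReal_mul (by positivity : (0 : ℝ) ≤ N), ENNReal.ofReal_natCast]
          ring
      _ ≤ _ := by gcongr
  -- with `φ = corr ψ K` the equation bounds `∫ m corr ψ R`, which dominates `∫ m ψ`, by the
  -- contributions of the error `S`, of the flux and of the initial datum
  set φ := corr ψ K with hφ
  have hop : ∀ z : Torus N × ℝ, deriv (fun s => φ (z.1, s)) z.2 + lap (fun x => φ (x, z.2)) z.1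
      = corr ψ S z - corr ψ R z := by
    intro z
    have h1 := corr_sub hψ (contDiff_dirD hK timeDir).continuous (hasCompactSupport_dirD hKc timeDir)
      (continuous_finsetSum Finset.univ fun i _ => (hDD i).continuous) (hasCompactSupport_sum hDDc) z
    have h2 := corr_sub hψ hR hRc hS hSc z
    rw [corr_sum hψ _ (fun i => (hDD i).continuous) hDDc] at h1
    have h3 : corr ψ (fun p => dirD timeDir K p - ∑ i, dirD (spaceDir i) (dirD (spaceDir i) K) p) z
        = corr ψ (fun p => R p - S p) z := by
      congr 1; ext p; exact heq p
    rw [hφ, deriv_time_corr hψ hK hKc, lap_corr hψ hK hKc]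
    linarith
  have hFPφ := hFP φ (isTest_corr hψ hψT hK hKc hτ₀ hK0)
  have hint : ∀ z : Torus N × ℝ, m z * deriv (fun s => φ (z.1, s)) z.2
        + inner ℝ (w z) (grad (fun x => φ (x, z.2)) z.1) + m z * lap (fun x => φ (x, z.2)) z.1
      = (m z * corr ψ S z + inner ℝ (w z) (grad (fun x => φ (x, z.2)) z.1)) - m z * corr ψ R z := by
    intro z
    have := hop z
    linear_combination m z * this
  simp_rw [hint] at hFPφ
  have hintmul : ∀ k : Vec N × ℝ → ℝ, Continuous k → HasCompactSupport k →
      Integrable (fun z => m z * corr ψ k z) (cyl N T) := by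
    intro k hk hkc
    obtain ⟨C, hC⟩ := exists_norm_corr_le hψn hk hkc
    exact hm.mul_bdd (c := C) (continuous_corr hψ hk hkc).aestronglyMeasurable (Eventually.of_forall hC)
  have hnormgrad : ∀ z : Torus N × ℝ, ‖grad (fun x => φ (x, z.2)) z.1‖ ≤ g z :=
    fun z => norm_grad_corr_le hψ hK hKc z
  have hwg : Integrable (fun z => ‖w z‖ * g z) (cyl N T) :=
    hw.norm.mul_bdd (c := N * (B * Real.sqrt η)) hgc.aestronglyMeasurable
      (Eventually.of_forall fun z => by rw [Real.norm_of_nonneg (hg0 z)]; exact hgle z)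
  have hinner : ∀ z : Torus N × ℝ, ‖inner ℝ (w z) (grad (fun x => φ (x, z.2)) z.1)‖ ≤ ‖w z‖ * g z :=
    fun z => (norm_inner_le_norm _ _).trans (mul_le_mul_of_nonneg_left (hnormgrad z) (norm_nonneg _))
  have hwi : Integrable (fun z => inner ℝ (w z) (grad (fun x => φ (x, z.2)) z.1)) (cyl N T) :=
    hwg.mono' (hw.aestronglyMeasurable.inner (continuous_grad_corr hψ hK hKc).aestronglyMeasurable)
      (Eventually.of_forall hinner)
  rw [integral_sub (f := fun z => m z * corr ψ S z + inner ℝ (w z) (grad (fun x => φ (x, z.2)) z.1))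
    ((hintmul S hS hSc).add hwi) (hintmul R hR hRc), integral_add (hintmul S hS hSc) hwi] at hFPφ
  have hlow : c₀ * ∫ z, m z * (ψ z - κ) ∂(cyl N T) ≤ ∫ z, m z * corr ψ R z ∂(cyl N T) := by
    rw [← integral_const_mul]
    have hi1 : Integrable (fun z => m z * (ψ z - κ)) (cyl N T) :=
      hm.mul_bdd (c := 1 + κ) (hψ.sub continuous_const).aestronglyMeasurable
        (Eventually.of_forall fun z => (norm_sub_le _ _).trans
          (add_le_add (hψn z) (by rw [Real.norm_of_nonneg hκ.le])))
    refine integral_mono_ae (hi1.const_mul c₀) (hintmul R hR hRc) ?_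
    filter_upwards [hm0] with z hz
    have := mul_le_mul_of_nonneg_left (mul_sub_le_corr hψ hψ0 hR hRc hR0 hc₀.le hRmass z (hosc z)) hz
    linarith
  have hSb : ∫ z, m z * corr ψ S z ∂(cyl N T) ≤ B * η ^ (-(N : ℝ) / 2) * I.toReal := by
    have h1 : ∫⁻ z, ‖m z * corr ψ S z‖ₑ ∂(cyl N T)
        ≤ ENNReal.ofReal (B * η ^ (-(N : ℝ) / 2 - 1)) * ENNReal.ofReal η * I := by
      refine le_trans (lintegral_mono_ae ?_)
        (lintegral_mul_corr_le hψ ENNReal.ofReal_ne_top hSle hm.aemeasurable hmass)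
      filter_upwards [hm0] with z hz
      rw [enorm_mul, Real.enorm_of_nonneg hz]
    rw [← ENNReal.ofReal_mul (by positivity)] at h1
    have h2 : ‖∫ z, m z * corr ψ S z ∂(cyl N T)‖ₑ ≤ _ := (enorm_integral_le_lintegral_enorm _).trans h1
    have h3 := ENNReal.toReal_mono (ENNReal.mul_ne_top ENNReal.ofReal_ne_top hIfin.ne) h2
    rw [ENNReal.toReal_mul, ENNReal.toReal_ofReal (by positivity), toReal_enorm] at h3
    refine (le_abs_self _).trans (h3.trans_eq ?_)
    rw [Real.rpow_sub_one hη.ne']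
    field_simp
  have hm₀b : ∫ x, m₀ x * φ (x, 0) ≤ B * M₀ * I.toReal := by
    have h1 : ∫⁻ x, ‖m₀ x * φ (x, 0)‖ₑ ≤ ENNReal.ofReal M₀ * (ENNReal.ofReal B * I) := by
      calc ∫⁻ x, ‖m₀ x * φ (x, 0)‖ₑ ≤ ∫⁻ x, ENNReal.ofReal M₀ * ‖φ (x, 0)‖ₑ := by
            refine lintegral_mono fun x => ?_
            rw [enorm_mul]
            gcongr
            rw [← ofReal_norm]
            exact ENNReal.ofReal_le_ofReal (hm₀ x)
        _ = ENNReal.ofReal M₀ * ∫⁻ x, ‖φ (x, 0)‖ₑ := lintegral_const_mul' _ _ ENNReal.ofReal_ne_top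
        _ ≤ _ := by
            gcongr
            exact lintegral_corr_zero_le hψ hK.continuous hKmass
    have h2 : ‖∫ x, m₀ x * φ (x, 0)‖ₑ ≤ _ := (enorm_integral_le_lintegral_enorm _).trans h1
    have h3 := ENNReal.toReal_mono (ENNReal.mul_ne_top ENNReal.ofReal_ne_top
      (ENNReal.mul_ne_top ENNReal.ofReal_ne_top hIfin.ne)) h2
    rw [ENNReal.toReal_mul, ENNReal.toReal_mul, ENNReal.toReal_ofReal hM₀, ENNReal.toReal_ofReal hB.le,
      toReal_enorm] at h3
    refine (le_abs_self _).trans (h3.trans_eq ?_)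
    ring
  have hwb : ∫ z, inner ℝ (w z) (grad (fun x => φ (x, z.2)) z.1) ∂(cyl N T)
      ≤ ∫ z, ‖w z‖ * g z ∂(cyl N T) :=
    integral_mono hwi hwg fun z => (le_abs_self _).trans (hinner z)
  have hBN : B ≤ B * (N + 1) := by
    have : (0 : ℝ) ≤ N := by positivity
    nlinarith
  calc c₀ * ∫ z, m z * (ψ z - κ) ∂(cyl N T)
      ≤ ∫ z, m z * corr ψ R z ∂(cyl N T) := hlow
    _ = ∫ z, m z * corr ψ S z ∂(cyl N T) + ∫ z, inner ℝ (w z) (grad (fun x => φ (x, z.2)) z.1) ∂(cyl N T)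
        + ∫ x, m₀ x * φ (x, 0) := by linarith
    _ ≤ B * η ^ (-(N : ℝ) / 2) * I.toReal + ∫ z, ‖w z‖ * g z ∂(cyl N T) + B * M₀ * I.toReal := by
        gcongr
    _ = (B * η ^ (-(N : ℝ) / 2) + B * M₀) * I.toReal + ∫ z, ‖w z‖ * g z ∂(cyl N T) := by ring
    _ ≤ _ := by gcongr

/-! ### From the duality estimate to integrability of the density -/

/-- Splitting the product of the flux and of the gradient of a test function by Young's inequality;
the gradient is interpolated between `L^1` and `L^∞`. -/
theorem integral_norm_mul_le {T r r' G μ : ℝ} (hr : r.HolderConjugate r') (hG : 0 ≤ G) (hμ : 0 < μ)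
    {w : Torus N × ℝ → Vec N}
    (hwr : Integrable (fun z => ‖w z‖ ^ r) (cyl N T))
    {g : Torus N × ℝ → ℝ} (hg : Continuous g) (hg0 : ∀ z, 0 ≤ g z) (hgG : ∀ z, g z ≤ G) {I : ℝ≥0∞}
    (hI : I ≠ ⊤) (hgI : ∫⁻ z, ENNReal.ofReal (g z) ∂(cyl N T) ≤ ENNReal.ofReal G * I) :
    ∫ z, ‖w z‖ * g z ∂(cyl N T)
      ≤ μ ^ r * ∫ z, ‖w z‖ ^ r ∂(cyl N T) + (G / μ) ^ r' * I.toReal := by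
  have hr1 := hr.lt
  have hr1' := hr.symm.lt
  have hgi : Integrable g (cyl N T) :=
    (integrable_const G).mono' hg.aestronglyMeasurable
      (Eventually.of_forall fun z => by rw [Real.norm_of_nonneg (hg0 z)]; exact hgG z)
  have hgint : ∫ z, g z ∂(cyl N T) ≤ G * I.toReal := by
    rw [integral_eq_lintegral_of_nonneg_ae (Eventually.of_forall hg0) hg.aestronglyMeasurable]
    have := ENNReal.toReal_mono (ENNReal.mul_ne_top ENNReal.ofReal_ne_top hI) hgI
    rwa [ENNReal.toReal_mul, ENNReal.toReal_ofReal hG] at this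
  set c : ℝ := G ^ (r' - 1) / μ ^ r' with hc
  have hpt : ∀ z, ‖w z‖ * g z ≤ μ ^ r * ‖w z‖ ^ r + c * g z := by
    intro z
    have h1 := Real.young_inequality_of_nonneg (a := μ * ‖w z‖) (b := g z / μ) (by positivity)
      (div_nonneg (hg0 z) hμ.le) hr
    have h2 : μ * ‖w z‖ * (g z / μ) = ‖w z‖ * g z := by field_simp
    have h3 : (μ * ‖w z‖) ^ r / r ≤ μ ^ r * ‖w z‖ ^ r := by
      rw [Real.mul_rpow hμ.le (norm_nonneg _)]
      exact div_le_self (by positivity) hr1.le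
    have h4 : (g z / μ) ^ r' / r' ≤ c * g z := by
      refine (div_le_self (Real.rpow_nonneg (div_nonneg (hg0 z) hμ.le) _) hr1'.le).trans ?_
      rw [Real.div_rpow (hg0 z) hμ.le, hc, div_mul_eq_mul_div]
      apply div_le_div_of_nonneg_right _ (by positivity)
      rcases (hg0 z).eq_or_lt with h | h
      · rw [← h, Real.zero_rpow (by linarith)]; simp
      · calc g z ^ r' = g z ^ (r' - 1) * g z := by rw [Real.rpow_sub_one h.ne']; field_simp
          _ ≤ G ^ (r' - 1) * g z :=
            mul_le_mul_of_nonneg_right (Real.rpow_le_rpow h.le (hgG z) (by linarith)) h.le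
    linarith
  have hc0 : 0 ≤ c := by positivity
  calc ∫ z, ‖w z‖ * g z ∂(cyl N T)
      ≤ ∫ z, (μ ^ r * ‖w z‖ ^ r + c * g z) ∂(cyl N T) := by
        refine integral_mono_of_nonneg (Eventually.of_forall fun z => mul_nonneg (norm_nonneg _) (hg0 z))
          ((hwr.const_mul _).add (hgi.const_mul _)) (Eventually.of_forall hpt)
    _ = μ ^ r * ∫ z, ‖w z‖ ^ r ∂(cyl N T) + c * ∫ z, g z ∂(cyl N T) := by
        rw [integral_add (hwr.const_mul _) (hgi.const_mul _), integral_const_mul, integral_const_mul]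
    _ ≤ μ ^ r * ∫ z, ‖w z‖ ^ r ∂(cyl N T) + c * (G * I.toReal) := by gcongr
    _ = _ := by
        congr 1
        rw [← mul_assoc, hc, div_mul_eq_mul_div, Real.div_rpow hG hμ.le]
        congr 2
        rcases hG.eq_or_lt with h | h
        · rw [← h, Real.zero_rpow (by linarith : r' ≠ 0)]; simp
        · rw [Real.rpow_sub_one h.ne']; field_simp

/-- Decay of the superlevel sets of the density. The time scale `η` of the duality estimate is tied to
the level, so that the part of `m` controlled by its mass only stays below the level. -/
theorem exists_superlevel_estimate (N : ℕ) (hN : 0 < N) : ∃ c₀ B : ℝ, 0 < c₀ ∧ 0 < B ∧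
    ∀ (T M₀ : ℝ) (m₀ : Torus N → ℝ) (m : Torus N × ℝ → ℝ) (w : Torus N × ℝ → Vec N),
      (∀ x, |m₀ x| ≤ M₀) → Integrable m (cyl N T) → Integrable w (cyl N T) →
      (∀ᵐ z ∂(cyl N T), 0 ≤ m z) →
      (∀ᵐ t ∂(volume.restrict (Ioo 0 T)), ∫⁻ x, ENNReal.ofReal (m (x, t)) = 1) →
      SolvesFP T m₀ m w →
      ∀ r : ℝ, 1 < r → Integrable (fun z => ‖w z‖ ^ r) (cyl N T) → ∀ L, B * (1 + M₀) ≤ L →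
        (cyl N T) {z | 4 * L / c₀ < m z}
          ≤ ENNReal.ofReal ((B / L) ^ (r * (1 + 1 / N)) * ∫ z, ‖w z‖ ^ r ∂(cyl N T)) := by
  obtain ⟨c₀, B, hc₀, hB, hdual⟩ := exists_duality_estimate N
  refine ⟨c₀, B, hc₀, hB, ?_⟩
  intro T M₀ m₀ m w hm₀ hm hw hm0 hmass hFP r hr hwr L hL
  have hM₀ : 0 ≤ M₀ := (abs_nonneg _).trans (hm₀ 0)
  have hBL : B ≤ L := le_trans (by nlinarith) hL
  have hBML : B * M₀ ≤ L := le_trans (by nlinarith) hL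
  have hL0 : 0 < L := hB.trans_le hBL
  have hN' : (0 : ℝ) < N := by exact_mod_cast hN
  set Y := ∫ z, ‖w z‖ ^ r ∂(cyl N T) with hY
  have hY0 : 0 ≤ Y := integral_nonneg fun z => by positivity
  have hrr : r.HolderConjugate (r.conjExponent) := Real.HolderConjugate.conjExponent hr
  set r' := r.conjExponent with hr'
  set Q : Set (Torus N × ℝ) := univ ×ˢ Ioo 0 T with hQ
  have hQo : IsOpen Q := isOpen_univ.prod isOpen_Ioo
  -- on a compact set the indicator function can be approximated by test densities `ψ`
  have hcompact : ∀ A : Set (Torus N × ℝ), IsCompact A → A ⊆ Q →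
      (∀ᵐ z ∂(cyl N T), z ∈ A → 4 * L / c₀ ≤ m z) →
      (volume A) ≤ ENNReal.ofReal ((B / L) ^ (r * (1 + 1 / N)) * Y) := by
    intro A hA hAQ hAm
    have hAfin : volume A ≠ ⊤ := hA.measure_lt_top.ne
    set a := (volume A).toReal with ha
    -- at this time scale the smoothing constant `B η^{-N/2}` equals the level `L`
    set η : ℝ := (B / L) ^ (2 / (N : ℝ)) with hη
    have hBL0 : 0 < B / L := by positivity
    have hη0 : 0 < η := Real.rpow_pos_of_pos hBL0 _
    have hη1 : η ≤ 1 := Real.rpow_le_one hBL0.le ((div_le_one hL0).2 hBL) (by positivity)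
    have hηN : B * η ^ (-(N : ℝ) / 2) = L := by
      rw [hη, ← Real.rpow_mul hBL0.le]
      have : 2 / (N : ℝ) * (-(N : ℝ) / 2) = -1 := by field_simp
      rw [this, Real.rpow_neg_one]
      field_simp
    have hsη : Real.sqrt η = (B / L) ^ (1 / (N : ℝ)) := by
      rw [Real.sqrt_eq_rpow, hη, ← Real.rpow_mul hBL0.le]
      congr 1; field_simp
    set G := B * Real.sqrt η with hG
    have hG0 : 0 < G := mul_pos hB (Real.sqrt_pos.2 hη0)
    -- this weight in Young's inequality lets the gradient of the test function contribute `L ∫ ψ`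
    set μ := G * L ^ (-(1 / r')) with hμ
    have hμ0 : 0 < μ := mul_pos hG0 (Real.rpow_pos_of_pos hL0 _)
    have hr'0 : r' ≠ 0 := hrr.symm.ne_zero
    have hGμ : (G / μ) ^ r' = L := by
      have : G / μ = L ^ (1 / r') := by
        rw [hμ, Real.rpow_neg hL0.le]; field_simp
      rw [this, ← Real.rpow_mul hL0.le, one_div_mul_cancel hr'0, Real.rpow_one]
    have hμr : μ ^ r = L * (B / L) ^ (r * (1 + 1 / N)) := by
      have e1 : -(1 / r') * r = 1 - r := by
        have := hrr.sub_one_mul_conj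
        rw [one_div, ← hrr.one_sub_inv]
        have hr0 : r ≠ 0 := by linarith
        field_simp
        ring
      have e2 : (B / L) ^ (r * (1 + 1 / (N : ℝ))) = B ^ r / L ^ r * (B / L) ^ (1 / (N : ℝ) * r) := by
        rw [← Real.div_rpow hB.le hL0.le, ← Real.rpow_add hBL0]
        congr 1; ring
      rw [hμ, Real.mul_rpow hG0.le (by positivity), hG, hsη, Real.mul_rpow hB.le (by positivity),
        ← Real.rpow_mul hBL0.le, ← Real.rpow_mul hL0.le, e1, e2, Real.rpow_sub hL0, Real.rpow_one]
      ring
    have hmA : L * a ≤ μ ^ r * Y := by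
      set Mm := ∫ z, m z ∂(cyl N T) with hMm
      have hMm0 : 0 ≤ Mm := integral_nonneg_of_ae hm0
      have hkey : ∀ ε : ℝ, 0 < ε → L * a ≤ μ ^ r * Y + ε * (3 * L + c₀ * Mm) := by
        intro ε hε
        obtain ⟨U, hAU, hU, hUε⟩ := hA.exists_isOpen_lt_add (μ := volume)
          (ENNReal.ofReal_pos.2 hε).ne'
        obtain ⟨ψ, hψ1, hψ0, hψc, hψ01⟩ := exists_continuous_one_zero_of_isCompact hA
          (hU.inter hQo).isClosed_compl
          (disjoint_compl_right_iff_subset.2 (subset_inter hAU hAQ))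
        have hψQ : ∀ z, z ∉ U ∩ Q → ψ z = 0 := fun z hz => hψ0 hz
        obtain ⟨g, hg, hg0, hgG, hgI, hest⟩ := hdual T M₀ m₀ m w hm₀ hm hw hm0 hmass hFP η hη0 hη1 ψ
          ψ.continuous hψc (fun z => (hψ01 z).1) (fun z => (hψ01 z).2)
          (fun x t ht => hψQ _ fun h => not_lt.2 ht h.2.2.2) ε hε
        set I := ∫⁻ z, ‖ψ z‖ₑ with hI
        have hIle : I ≤ volume A + ENNReal.ofReal ε := by
          calc I ≤ ∫⁻ z, U.indicator 1 z := by
                refine lintegral_mono fun z => ?_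
                by_cases hz : z ∈ U
                · rw [indicator_of_mem hz, Real.enorm_of_nonneg (hψ01 z).1]
                  exact ENNReal.ofReal_le_one.2 (hψ01 z).2
                · rw [hψQ z fun h => hz h.1]; simp
            _ = volume U := lintegral_indicator_one hU.measurableSet
            _ ≤ _ := hUε.le
        have hItop : I ≠ ⊤ := ne_top_of_le_ne_top (ENNReal.add_ne_top.2 ⟨hAfin, ENNReal.ofReal_ne_top⟩) hIle
        have hIa : I.toReal ≤ a + ε := by
          have := ENNReal.toReal_mono (ENNReal.add_ne_top.2 ⟨hAfin, ENNReal.ofReal_ne_top⟩) hIle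
          rwa [ENNReal.toReal_add hAfin ENNReal.ofReal_ne_top, ENNReal.toReal_ofReal hε.le] at this
        have hyoung := integral_norm_mul_le (T := T) hrr hG0.le hμ0 hwr hg hg0
          hgG hItop hgI
        rw [hGμ, ← hY] at hyoung
        have hψi : Integrable (fun z => m z * ψ z) (cyl N T) :=
          hm.mul_bdd (c := 1) ψ.continuous.aestronglyMeasurable
            (Eventually.of_forall fun z => by rw [Real.norm_of_nonneg (hψ01 z).1]; exact (hψ01 z).2)
        have hsplit : ∫ z, m z * (ψ z - ε) ∂(cyl N T) = ∫ z, m z * ψ z ∂(cyl N T) - ε * Mm := by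
          rw [hMm, ← integral_const_mul, ← integral_sub hψi (hm.const_mul ε)]
          congr 1; ext z; ring
        have hlow : 4 * L / c₀ * a ≤ ∫ z, m z * ψ z ∂(cyl N T) := by
          have h1 : ∫ z, A.indicator (fun _ => 4 * L / c₀) z ∂(cyl N T) = 4 * L / c₀ * a := by
            rw [integral_indicator_const _ hA.measurableSet, cyl_eq_restrict, measureReal_def,
              Measure.restrict_apply hA.measurableSet, inter_eq_self_of_subset_left hAQ, smul_eq_mul,
              mul_comm]
          rw [← h1]
          refine integral_mono_ae ((integrable_const _).indicator hA.measurableSet) hψi ?_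
          filter_upwards [hAm, hm0] with z hz hz0
          by_cases hzA : z ∈ A
          · rw [indicator_of_mem hzA, hψ1 hzA]; simpa using hz hzA
          · rw [indicator_of_notMem hzA]
            exact mul_nonneg hz0 (hψ01 z).1
        rw [hsplit, hηN] at hest
        have h4 : 4 * L * a ≤ c₀ * ∫ z, m z * ψ z ∂(cyl N T) := by
          have := mul_le_mul_of_nonneg_left hlow hc₀.le
          calc 4 * L * a = c₀ * (4 * L / c₀ * a) := by field_simp
            _ ≤ _ := this
        have hI0 : 0 ≤ I.toReal := ENNReal.toReal_nonneg
        have h5 : (L + B * M₀) * I.toReal ≤ 2 * L * (a + ε) := by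
          have h6 : (L + B * M₀) * I.toReal ≤ 2 * L * I.toReal := by gcongr; linarith
          exact h6.trans (by gcongr)
        have h7 : L * I.toReal ≤ L * (a + ε) := by gcongr
        nlinarith
      refine le_of_forall_pos_le_add fun ε' hε' => ?_
      have hpos : 0 < 3 * L + c₀ * Mm := by positivity
      have := hkey (ε' / (3 * L + c₀ * Mm)) (by positivity)
      rwa [div_mul_cancel₀ _ hpos.ne'] at this
    rw [hμr, mul_assoc] at hmA
    rw [← ENNReal.ofReal_toReal hAfin]
    exact ENNReal.ofReal_le_ofReal (le_of_mul_le_mul_left hmA hL0)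
  -- compact sets exhaust the superlevel set, once `m` is replaced by a measurable representative
  set mk := hm.aestronglyMeasurable.mk m with hmk
  have hmkm : Measurable mk := hm.aestronglyMeasurable.stronglyMeasurable_mk.measurable
  have hmkeq : m =ᵐ[cyl N T] mk := hm.aestronglyMeasurable.ae_eq_mk
  have hset : MeasurableSet ({z | 4 * L / c₀ < mk z} ∩ Q) :=
    (measurableSet_lt measurable_const hmkm).inter hQo.measurableSet
  have hQfin : volume Q ≠ ⊤ := by
    have h : (cyl N T) univ ≠ ⊤ := measure_ne_top _ _
    rwa [cyl_eq_restrict, Measure.restrict_apply_univ] at h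
  have h1 : (cyl N T) {z | 4 * L / c₀ < m z} = volume ({z | 4 * L / c₀ < mk z} ∩ Q) := by
    have : {z | 4 * L / c₀ < m z} =ᵐ[cyl N T] {z | 4 * L / c₀ < mk z} := by
      filter_upwards [hmkeq] with z hz
      have : (4 * L / c₀ < m z) = (4 * L / c₀ < mk z) := by rw [hz]
      exact this
    rw [measure_congr this, cyl_eq_restrict,
      Measure.restrict_apply (measurableSet_lt measurable_const hmkm)]
  rw [h1]
  by_contra hcon
  rw [not_le] at hcon
  obtain ⟨A, hAsub, hA, hlt⟩ := hset.exists_lt_isCompact_of_ne_top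
    (measure_ne_top_of_subset inter_subset_right hQfin) hcon
  refine absurd (hcompact A hA (hAsub.trans inter_subset_right) ?_) (not_le.2 hlt)
  filter_upwards [hmkeq] with z hz hzA
  rw [hz]
  exact (hAsub hzA).1.le


theorem setLIntegral_Ioc_rpow {s Λ : ℝ} (hs : 0 < s) (hΛ : 0 ≤ Λ) :
    ENNReal.ofReal s * ∫⁻ t in Ioc 0 Λ, ENNReal.ofReal (t ^ (s - 1)) = ENNReal.ofReal (Λ ^ s) := by
  have hi : IntervalIntegrable (fun t : ℝ => t ^ (s - 1)) volume 0 Λ :=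
    intervalIntegral.intervalIntegrable_rpow' (by linarith)
  rw [← ofReal_integral_eq_lintegral_ofReal
    ((intervalIntegrable_iff_integrableOn_Ioc_of_le hΛ).1 hi)
    ((ae_restrict_iff' measurableSet_Ioc).2 (Eventually.of_forall fun τ hτ => by
      have := hτ.1; positivity)),
    ← intervalIntegral.integral_of_le hΛ, integral_rpow (Or.inl (by linarith)),
    ← ENNReal.ofReal_mul hs.le]
  congr 1
  rw [sub_add_cancel, Real.zero_rpow hs.ne']
  field_simp
  ring

theorem setLIntegral_Ioi_rpow {q Λ : ℝ} (hq : q < -1) (hΛ : 0 < Λ) :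
    ∫⁻ t in Ioi Λ, ENNReal.ofReal (t ^ q) = ENNReal.ofReal (-Λ ^ (q + 1) / (q + 1)) := by
  rw [← ofReal_integral_eq_lintegral_ofReal (integrableOn_Ioi_rpow_of_lt hq hΛ)
    ((ae_restrict_iff' measurableSet_Ioi).2 (Eventually.of_forall fun τ hτ => by
      have := hΛ.trans hτ; positivity)), integral_Ioi_rpow_of_lt hq hΛ]

/-- Layer cake: a decay of order `p > s` of the superlevel sets beyond the level `Λ`. -/
theorem lintegral_rpow_le_of_superlevel {X : Type*} [MeasurableSpace X] {μ : Measure X}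
    {m : X → ℝ} (hm : AEMeasurable m μ) (hm0 : 0 ≤ᵐ[μ] m)
    {s p D Λ : ℝ} (hs : 0 < s) (hsp : s < p) (hD : 0 ≤ D) (hΛ : 0 < Λ)
    (hlev : ∀ t, Λ < t → μ {z | t < m z} ≤ ENNReal.ofReal (D * t ^ (-p))) :
    ∫⁻ z, ENNReal.ofReal (m z ^ s) ∂μ
      ≤ ENNReal.ofReal (Λ ^ s) * μ univ + ENNReal.ofReal (s * D / (p - s) * Λ ^ (-(p - s))) := by
  rw [lintegral_rpow_eq_lintegral_meas_lt_mul μ hm0 hm hs, ← Ioc_union_Ioi_eq_Ioi hΛ.le,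
    lintegral_union measurableSet_Ioi (Ioc_disjoint_Ioi le_rfl), mul_add]
  apply add_le_add
  · calc ENNReal.ofReal s * ∫⁻ t in Ioc 0 Λ, μ {a | t < m a} * ENNReal.ofReal (t ^ (s - 1))
        ≤ ENNReal.ofReal s * ∫⁻ t in Ioc 0 Λ, ENNReal.ofReal (t ^ (s - 1)) * μ univ := by
          refine mul_le_mul_right (lintegral_mono fun t => ?_) _
          rw [mul_comm (ENNReal.ofReal (t ^ (s - 1)))]
          exact mul_le_mul_left (measure_mono (subset_univ _)) _
      _ = ENNReal.ofReal (Λ ^ s) * μ univ := by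
          rw [lintegral_mul_const _ (by fun_prop), ← mul_assoc, setLIntegral_Ioc_rpow hs hΛ.le]
  · calc ENNReal.ofReal s * ∫⁻ t in Ioi Λ, μ {a | t < m a} * ENNReal.ofReal (t ^ (s - 1))
        ≤ ENNReal.ofReal s * ∫⁻ t in Ioi Λ, ENNReal.ofReal D * ENNReal.ofReal (t ^ (s - p - 1)) := by
          refine mul_le_mul_right (setLIntegral_mono' measurableSet_Ioi fun t ht => ?_) _
          have ht0 : 0 < t := hΛ.trans ht
          rw [← ENNReal.ofReal_mul hD]
          refine (mul_le_mul_left (hlev t ht) _).trans ?_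
          rw [← ENNReal.ofReal_mul (by positivity)]
          apply ENNReal.ofReal_le_ofReal
          rw [mul_assoc, ← Real.rpow_add ht0]
          ring_nf
          rfl
      _ = ENNReal.ofReal (s * D / (p - s) * Λ ^ (-(p - s))) := by
          rw [lintegral_const_mul' _ _ ENNReal.ofReal_ne_top, setLIntegral_Ioi_rpow (by linarith) hΛ,
            ← ENNReal.ofReal_mul hD, ← ENNReal.ofReal_mul hs.le]
          congr 1
          have : s - p - 1 + 1 = -(p - s) := by ring
          rw [this]
          have h2 : p - s ≠ 0 := by linarith
          field_simp

/-- Interpolation of the flux between the kinetic energy and the power of the density. -/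
theorem ofReal_norm_rpow_le_kinetic_add {γ' s m : ℝ} (hγ' : 1 < γ') (hs : 1 < s) (hm : 0 ≤ m)
    (w : Vec N) : ENNReal.ofReal (‖w‖ ^ (γ' * s / (s + γ' - 1)))
      ≤ kinetic γ' m w + ENNReal.ofReal (m ^ s) := by
  have hden : 0 < s + γ' - 1 := by linarith
  have hr0 : 0 < γ' * s / (s + γ' - 1) := by positivity
  rcases hm.eq_or_lt with h | h
  · unfold kinetic
    rw [← h, if_neg (lt_irrefl _)]
    split_ifs with hw
    · rw [hw, norm_zero, Real.zero_rpow hr0.ne']; simp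
    · simp
  · rw [kinetic, if_pos h, ← ENNReal.ofReal_add (by positivity) (by positivity)]
    apply ENNReal.ofReal_le_ofReal
    set θ := s / (s + γ' - 1) with hθ
    have hθ0 : 0 ≤ θ := by positivity
    have hθ1 : θ ≤ 1 := (div_le_one hden).2 (by linarith)
    have h1 := Real.geom_mean_le_arith_mean2_weighted hθ0 (sub_nonneg.2 hθ1)
      (show 0 ≤ ‖w‖ ^ γ' * m ^ (1 - γ') by positivity) (show 0 ≤ m ^ s by positivity) (by ring)
    have h2 : (‖w‖ ^ γ' * m ^ (1 - γ')) ^ θ * (m ^ s) ^ (1 - θ) = ‖w‖ ^ (γ' * s / (s + γ' - 1)) := by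
      rw [Real.mul_rpow (by positivity) (by positivity), ← Real.rpow_mul (norm_nonneg _),
        ← Real.rpow_mul h.le, ← Real.rpow_mul h.le, mul_assoc, ← Real.rpow_add h]
      have e1 : (1 - γ') * θ + s * (1 - θ) = 0 := by rw [hθ]; field_simp; ring
      rw [e1, Real.rpow_zero, mul_one, hθ, mul_div_assoc]
    rw [h2] at h1
    have h3 : 0 ≤ ‖w‖ ^ γ' * m ^ (1 - γ') := by positivity
    have h4 : 0 ≤ m ^ s := by positivity
    nlinarith

/-- The basic a priori estimate: below the critical growth the `L^{α+1}` norm of the density is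
dominated by an arbitrarily small multiple of the kinetic energy, up to a constant. -/
theorem exists_density_estimate (hN : 0 < N) {γ' α : ℝ} (hγ' : 1 < γ') (hα : 0 < α)
    (hsub : α < γ' / N) (T : ℝ) {m₀ : Torus N → ℝ} (hm₀ : Continuous m₀) {δ : ℝ} (hδ : 0 < δ) :
    ∃ C : ℝ, 0 ≤ C ∧ ∀ m w, (m, w) ∈ K T α γ' m₀ →
      (∀ᵐ t ∂(volume.restrict (Ioo 0 T)), ∫⁻ x, ENNReal.ofReal (m (x, t)) = 1) →
      ∫⁻ z, ENNReal.ofReal (m z ^ (α + 1)) ∂(cyl N T) < ⊤ ∧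
      ∫⁻ z, ENNReal.ofReal (m z ^ (α + 1)) ∂(cyl N T)
        ≤ ENNReal.ofReal δ * (∫⁻ z, kinetic γ' (m z) (w z) ∂(cyl N T)) + ENNReal.ofReal C := by
  obtain ⟨c₀, B, hc₀, hB, hlevel⟩ := exists_superlevel_estimate N hN
  obtain ⟨M₀, hM₀, hm₀M⟩ := exists_norm_le_of_continuous hm₀
  have hN' : (0 : ℝ) < N := by exact_mod_cast hN
  set s := α + 1 with hs
  -- `r` is the integrability of the flux given by the kinetic energy and by `m ∈ L^s`; the decay of
  -- the superlevel sets then has order `p`, and `s < p` expresses the bound on `α`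
  set r := γ' * s / (s + γ' - 1) with hr
  set p := r * (1 + 1 / N) with hp
  have hden : 0 < s + γ' - 1 := by linarith
  have hs1 : 1 < s := by linarith
  have hr1 : 1 < r := by
    rw [hr, lt_div_iff₀ hden]; nlinarith
  have hsp : s < p := by
    have h1 : α * N < γ' := by rwa [lt_div_iff₀ hN'] at hsub
    have h2 : p = s * ((γ' + γ' / N) / (s + γ' - 1)) := by rw [hp, hr]; field_simp
    rw [h2]
    apply lt_mul_of_one_lt_right (by linarith)
    rw [lt_div_iff₀ hden, hs]
    linarith
  set Λ₁ : ℝ := 4 * B * (1 + M₀) / c₀ with hΛ₁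
  set D : ℝ := (4 * B / c₀) ^ p with hD
  have hD0 : 0 ≤ D := by positivity
  set ε : ℝ := min (1 / 2) (δ / 2) with hε
  have hε0 : 0 < ε := by positivity
  have hps : 0 < p - s := by linarith
  obtain ⟨Λ, hΛΛ₁, hΛ0, hΛε⟩ : ∃ Λ, Λ₁ ≤ Λ ∧ 0 < Λ ∧ s * D / (p - s) * Λ ^ (-(p - s)) ≤ ε := by
    have h1 : Tendsto (fun Λ : ℝ => s * D / (p - s) * Λ ^ (-(p - s))) atTop (𝓝 0) := by
      simpa using (tendsto_rpow_neg_atTop hps).const_mul (s * D / (p - s))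
    have h2 := h1.eventually_le_const hε0
    obtain ⟨Λ, h⟩ := (h2.and ((eventually_ge_atTop Λ₁).and (eventually_gt_atTop 0))).exists
    exact ⟨Λ, h.2.1, h.2.2, h.1⟩
  set V : ℝ := ((cyl N T) univ).toReal with hV
  refine ⟨2 * (Λ ^ s * V), by positivity, ?_⟩
  rintro m w ⟨hmL, hw, hkin, hm0, hFP⟩ hmass
  simp only at hmL hw hkin hm0 hFP
  have hm0' : 0 ≤ᵐ[cyl N T] m := hm0
  have hmi : Integrable m (cyl N T) := by
    refine hmL.integrable ?_
    rw [← ENNReal.ofReal_one]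
    exact ENNReal.ofReal_le_ofReal hs1.le
  set X := ∫⁻ z, ENNReal.ofReal (m z ^ s) ∂(cyl N T) with hX
  set E := ∫⁻ z, kinetic γ' (m z) (w z) ∂(cyl N T) with hE
  have hXfin : X < ⊤ := by
    have h1 := lintegral_rpow_enorm_lt_top_of_eLpNorm_lt_top
      (by simpa using by linarith : ENNReal.ofReal s ≠ 0) ENNReal.ofReal_ne_top hmL.2
    rw [ENNReal.toReal_ofReal (by linarith)] at h1
    refine lt_of_eq_of_lt (lintegral_congr_ae ?_) h1
    filter_upwards [hm0] with z hz
    rw [Real.enorm_of_nonneg hz, ENNReal.ofReal_rpow_of_nonneg hz (by linarith)]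
  refine ⟨hXfin, ?_⟩
  have hYle : ∫⁻ z, ENNReal.ofReal (‖w z‖ ^ r) ∂(cyl N T) ≤ E + X := by
    have hXm : AEMeasurable (fun z => ENNReal.ofReal (m z ^ s)) (cyl N T) :=
      (hmi.aemeasurable.pow_const s).ennreal_ofReal
    rw [hE, hX, ← lintegral_add_right' _ hXm]
    refine lintegral_mono_ae ?_
    filter_upwards [hm0] with z hz
    exact ofReal_norm_rpow_le_kinetic_add hγ' hs1 hz (w z)
  have hwm : AEStronglyMeasurable (fun z => ‖w z‖ ^ r) (cyl N T) :=
    (hw.aestronglyMeasurable.norm.aemeasurable.pow_const r).aestronglyMeasurable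
  have hw0 : 0 ≤ᵐ[cyl N T] fun z => ‖w z‖ ^ r := Eventually.of_forall fun z => by positivity
  have hEX : E + X < ⊤ := ENNReal.add_lt_top.2 ⟨hkin, hXfin⟩
  have hwr : Integrable (fun z => ‖w z‖ ^ r) (cyl N T) :=
    ⟨hwm, (hasFiniteIntegral_iff_ofReal hw0).2 (hYle.trans_lt hEX)⟩
  set Y := ∫ z, ‖w z‖ ^ r ∂(cyl N T) with hY
  have hY0 : 0 ≤ Y := integral_nonneg fun z => by positivity
  have hYEX : Y ≤ E.toReal + X.toReal := by
    rw [← ofReal_integral_eq_lintegral_ofReal hwr hw0, ← hY] at hYle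
    have := ENNReal.toReal_mono hEX.ne hYle
    rwa [ENNReal.toReal_ofReal hY0, ENNReal.toReal_add hkin.ne hXfin.ne] at this
  have hlev : ∀ t, Λ < t → (cyl N T) {z | t < m z} ≤ ENNReal.ofReal (D * Y * t ^ (-p)) := by
    intro t ht
    have ht0 : 0 < t := hΛ0.trans ht
    have hL : B * (1 + M₀) ≤ c₀ * t / 4 := by
      have : Λ₁ ≤ t := hΛΛ₁.trans ht.le
      rw [hΛ₁, div_le_iff₀ hc₀] at this
      linarith
    have h1 := hlevel T M₀ m₀ m w hm₀M hmi hw hm0 hmass hFP r hr1 hwr (c₀ * t / 4) hL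
    have h2 : 4 * (c₀ * t / 4) / c₀ = t := by field_simp
    rw [h2, ← hp, ← hY] at h1
    refine h1.trans_eq ?_
    congr 1
    have h3 : B / (c₀ * t / 4) = (4 * B / c₀) * t⁻¹ := by field_simp
    rw [h3, Real.mul_rpow (by positivity) (by positivity), Real.inv_rpow ht0.le, ← Real.rpow_neg ht0.le,
      hD]
    ring
  have hlayer := lintegral_rpow_le_of_superlevel hmi.aemeasurable hm0' (by linarith : 0 < s) hsp
    (mul_nonneg hD0 hY0) hΛ0 hlev
  rw [← hX] at hlayer
  have hVtop : (cyl N T) univ ≠ ⊤ := measure_ne_top _ _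
  have h1 := ENNReal.toReal_mono (ENNReal.add_ne_top.2
    ⟨ENNReal.mul_ne_top ENNReal.ofReal_ne_top hVtop, ENNReal.ofReal_ne_top⟩) hlayer
  rw [ENNReal.toReal_add (ENNReal.mul_ne_top ENNReal.ofReal_ne_top hVtop) ENNReal.ofReal_ne_top,
    ENNReal.toReal_mul, ENNReal.toReal_ofReal (by positivity), ENNReal.toReal_ofReal (by positivity),
    ← hV] at h1
  have h2 : s * (D * Y) / (p - s) * Λ ^ (-(p - s)) ≤ ε * Y := by
    calc _ = s * D / (p - s) * Λ ^ (-(p - s)) * Y := by ring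
      _ ≤ _ := by gcongr
  have hE0 : 0 ≤ E.toReal := ENNReal.toReal_nonneg
  have hX0 : 0 ≤ X.toReal := ENNReal.toReal_nonneg
  have h3 : ε * Y ≤ δ / 2 * E.toReal + 1 / 2 * X.toReal := by
    calc ε * Y ≤ ε * (E.toReal + X.toReal) := by gcongr
      _ = ε * E.toReal + ε * X.toReal := by ring
      _ ≤ _ := by
          gcongr
          · exact min_le_right _ _
          · exact min_le_left _ _
  have h4 : X.toReal ≤ δ * E.toReal + 2 * (Λ ^ s * V) := by linarith
  rw [← ENNReal.ofReal_toReal hXfin.ne, ← ENNReal.ofReal_toReal hkin.ne, ← ENNReal.ofReal_mul hδ.le,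
    ← ENNReal.ofReal_add (by positivity) (by positivity)]
  exact ENNReal.ofReal_le_ofReal h4

/-! ### Moments of the density as functions of time -/

theorem contDiffAt_local {n : WithTop ℕ∞} {u : Torus N → ℝ} (hu : TorusContDiff n u) (x : Torus N) :
    ContDiffAt ℝ n (fun v : Vec N => u (x + toTorus v)) 0 := by
  obtain ⟨y, rfl⟩ := toTorus_surjective x
  rw [lift_add]
  exact (ContDiff.comp hu (contDiff_const.add contDiff_id)).contDiffAt

theorem grad_mul_const {u : Torus N → ℝ} (hu : TorusContDiff 1 u) (c : ℝ) (x : Torus N) :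
    grad (fun x => u x * c) x = c • grad u x := by
  unfold grad gradient
  rw [fderiv_mul_const ((contDiffAt_local hu x).differentiableAt one_ne_zero)]
  simp

theorem lap_mul_const {u : Torus N → ℝ} (hu : TorusContDiff 2 u) (c : ℝ) (x : Torus N) :
    lap (fun x => u x * c) x = lap u x * c := by
  unfold lap
  have h := InnerProductSpace.laplacian_smul c (contDiffAt_local hu x)
  have h2 : (fun v : Vec N => u (x + toTorus v) * c) = c • fun v : Vec N => u (x + toTorus v) := by
    ext v; simp [mul_comm]
  rw [h2, h, smul_eq_mul, mul_comm]

/-- The time derivative, according to the Fokker-Planck equation, of the moment `∫ m(x, t) ψ(x) dx`. -/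
noncomputable def fluxMoment (m : Torus N × ℝ → ℝ) (w : Torus N × ℝ → Vec N) (ψ : Torus N → ℝ)
    (t : ℝ) : ℝ :=
  ∫ x, (inner ℝ (w (x, t)) (grad ψ x) + m (x, t) * lap ψ x)

theorem integrable_cyl_mul {T : ℝ} {m : Torus N × ℝ → ℝ} (hm : Integrable m (cyl N T))
    {ψ : Torus N → ℝ} (hψ : Continuous ψ) : Integrable (fun z => m z * ψ z.1) (cyl N T) := by
  obtain ⟨C, -, hC⟩ := exists_norm_le_of_continuous hψ
  exact hm.mul_bdd (c := C) (hψ.comp continuous_fst).aestronglyMeasurable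
    (Eventually.of_forall fun z => hC z.1)

theorem integrable_cyl_inner {T : ℝ} {w : Torus N × ℝ → Vec N} (hw : Integrable w (cyl N T))
    {ψ : Torus N → Vec N} (hψ : Continuous ψ) :
    Integrable (fun z => inner ℝ (w z) (ψ z.1)) (cyl N T) := by
  obtain ⟨C, -, hC⟩ := exists_norm_le_of_continuous hψ
  refine (hw.norm.mul_const C).mono'
    (hw.aestronglyMeasurable.inner (hψ.comp continuous_fst).aestronglyMeasurable)
    (Eventually.of_forall fun z => ?_)
  exact (norm_inner_le_norm _ _).trans (mul_le_mul_of_nonneg_left (hC _) (norm_nonneg _))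

theorem integrable_fluxMoment {T : ℝ} {m : Torus N × ℝ → ℝ} {w : Torus N × ℝ → Vec N}
    (hm : Integrable m (cyl N T)) (hw : Integrable w (cyl N T)) {ψ : Torus N → ℝ}
    (hψ : TorusContDiff 2 ψ) :
    Integrable (fluxMoment m w ψ) (volume.restrict (Ioo 0 T)) := by
  have h1 := (integrable_cyl_inner hw (TorusContDiff.continuous_grad (ContDiff.of_le hψ (by norm_num)))).add
    (integrable_cyl_mul hm hψ.continuous_lap)
  exact Integrable.integral_prod_right h1

theorem exists_lt_forall_ge_eq_zero {ξ : ℝ → ℝ} {T : ℝ} (hc : HasCompactSupport ξ)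
    (hT : tsupport ξ ⊆ Iio T) : ∃ τ < T, ∀ t, τ ≤ t → ξ t = 0 := by
  rcases (tsupport ξ).eq_empty_or_nonempty with h | h
  · refine ⟨T - 1, by linarith, fun t _ => ?_⟩
    exact image_eq_zero_of_notMem_tsupport (by rw [h]; exact notMem_empty t)
  · obtain ⟨g, hg, hmax⟩ := hc.exists_isGreatest h
    have hgT : g < T := hT hg
    refine ⟨(g + T) / 2, by linarith, fun t ht => ?_⟩
    exact image_eq_zero_of_notMem_tsupport fun h => by linarith [hmax h]

/-- The weak formulation determines the moments of the density: they are, for almost every time, equal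
to an absolutely continuous function that starts from the moment of the initial datum. -/
theorem ae_moment_eq {T : ℝ} (hT : 0 < T) {m₀ : Torus N → ℝ} {m : Torus N × ℝ → ℝ}
    {w : Torus N × ℝ → Vec N} (hm : Integrable m (cyl N T)) (hw : Integrable w (cyl N T))
    (hFP : SolvesFP T m₀ m w) {ψ : Torus N → ℝ} (hψ : TorusContDiff ∞ ψ) :
    ∀ᵐ t ∂(volume.restrict (Ioo 0 T)), ∫ x, m (x, t) * ψ x
      = (∫ x, m₀ x * ψ x) + ∫ s in (0 : ℝ)..t, fluxMoment m w ψ s := by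
  have hψ2 : TorusContDiff 2 ψ :=
    ContDiff.of_le hψ (WithTop.coe_le_coe.2 (le_top : (2 : ℕ∞) ≤ ⊤))
  have hψ1 : TorusContDiff 1 ψ := ContDiff.of_le hψ (by exact_mod_cast le_top)
  set h := fluxMoment m w ψ with hh
  set c := ∫ x, m₀ x * ψ x with hc
  have hhI : Integrable h (volume.restrict (Ioo 0 T)) := integrable_fluxMoment hm hw hψ2
  have hhi : IntervalIntegrable h volume 0 T := by
    rw [intervalIntegrable_iff_integrableOn_Ioc_of_le hT.le]
    exact (integrableOn_Ioc_iff_integrableOn_Ioo).2 hhI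
  set u : ℝ → ℝ := fun t => ∫ x, m (x, t) * ψ x with hu
  have hmψ := integrable_cyl_mul hm hψ.continuous
  have huI : Integrable u (volume.restrict (Ioo 0 T)) := Integrable.integral_prod_right hmψ
  set U : ℝ → ℝ := fun t => ∫ s in (0 : ℝ)..t, h s with hU
  have hUac : AbsolutelyContinuousOnInterval U 0 T :=
    hhi.absolutelyContinuousOnInterval_intervalIntegral (by simp)
  have hUI : Integrable U (volume.restrict (Ioo 0 T)) := by
    have := hUac.continuousOn
    rw [uIcc_of_le hT.le] at this
    exact this.integrableOn_Icc.mono_set Ioo_subset_Icc_self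
  have hf : Integrable (fun t => u t - (c + U t)) (volume.restrict (Ioo 0 T)) :=
    huI.sub ((integrable_const c).add hUI)
  have hkey := isOpen_Ioo.ae_eq_zero_of_integral_contDiff_smul_eq_zero (μ := volume)
    (f := fun t => u t - (c + U t)) (U := Ioo 0 T) (IntegrableOn.locallyIntegrableOn hf) ?_
  · rw [ae_restrict_iff' measurableSet_Ioo]
    filter_upwards [hkey] with t ht htm
    linarith [ht htm]
  intro ξ hξ hξc hξs
  obtain ⟨τ, hτT, hτ⟩ := exists_lt_forall_ge_eq_zero hξc fun t ht => (hξs ht).2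
  -- the primitive of `ξ` that vanishes near `T`, multiplied by `ψ`, is an admissible test function
  set η : ℝ → ℝ := fun t => ∫ s in T..t, ξ s with hη
  have hηd : ∀ t, HasDerivAt η (ξ t) t := fun t =>
    intervalIntegral.integral_hasDerivAt_right (hξ.continuous.intervalIntegrable _ _)
      (hξ.continuous.stronglyMeasurableAtFilter _ _) hξ.continuous.continuousAt
  have hηs : ContDiff ℝ ∞ η := by
    rw [contDiff_infty_iff_deriv]
    refine ⟨fun t => (hηd t).differentiableAt, ?_⟩
    have : deriv η = ξ := funext fun t => (hηd t).deriv
    rwa [this]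
  have hη0 : ∀ t, τ ≤ t → η t = 0 := by
    intro t ht
    rw [hη]
    apply intervalIntegral.integral_zero_ae
    refine Eventually.of_forall fun s hs => hτ s ?_
    rw [mem_uIoc] at hs
    rcases hs with hs | hs <;> linarith [hs.1]
  have htest : IsTest T (fun z : Torus N × ℝ => ψ z.1 * η z.2) := by
    refine ⟨?_, τ, hτT, fun x t ht => ?_⟩
    · exact (ContDiff.comp hψ contDiff_fst).mul (hηs.comp contDiff_snd)
    · simp [hη0 t ht]
  have hmain := hFP _ htest
  have hint : ∀ z : Torus N × ℝ, m z * deriv (fun s => ψ z.1 * η s) z.2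
        + inner ℝ (w z) (grad (fun x => ψ x * η z.2) z.1) + m z * lap (fun x => ψ x * η z.2) z.1
      = ξ z.2 * (m z * ψ z.1) + η z.2 * (inner ℝ (w z) (grad ψ z.1) + m z * lap ψ z.1) := by
    intro z
    rw [((hηd z.2).const_mul (ψ z.1)).deriv, grad_mul_const hψ1, lap_mul_const hψ2, inner_smul_right]
    ring
  simp only [hint] at hmain
  obtain ⟨Cξ, hCξ⟩ := hξ.continuous.bounded_above_of_compact_support hξc
  have hηb : ∀ᵐ z ∂(cyl N T), ‖η z.2‖ ≤ Cξ * T := by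
    rw [cyl_eq_restrict, ae_restrict_iff' (MeasurableSet.univ.prod measurableSet_Ioo)]
    refine Eventually.of_forall fun z hz => ?_
    have hz2 : z.2 ∈ Ioo 0 T := hz.2
    refine (intervalIntegral.norm_integral_le_of_norm_le_const fun s _ => hCξ s).trans ?_
    have : 0 ≤ Cξ := (norm_nonneg _).trans (hCξ 0)
    gcongr
    rw [abs_le]; constructor <;> linarith [hz2.1, hz2.2]
  have hi1 : Integrable (fun z : Torus N × ℝ => ξ z.2 * (m z * ψ z.1)) (cyl N T) :=
    hmψ.bdd_mul (c := Cξ) (hξ.continuous.comp continuous_snd).aestronglyMeasurable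
      (Eventually.of_forall fun z => hCξ z.2)
  have hi2 : Integrable (fun z : Torus N × ℝ =>
      η z.2 * (inner ℝ (w z) (grad ψ z.1) + m z * lap ψ z.1)) (cyl N T) :=
    ((integrable_cyl_inner hw hψ1.continuous_grad).add
      (integrable_cyl_mul hm hψ2.continuous_lap)).bdd_mul (c := Cξ * T)
        (hηs.continuous.comp continuous_snd).aestronglyMeasurable hηb
  rw [integral_add hi1 hi2] at hmain
  have hF1 : ∫ z : Torus N × ℝ, ξ z.2 * (m z * ψ z.1) ∂(cyl N T) = ∫ t in Ioo 0 T, ξ t * u t := by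
    rw [cyl, integral_prod_symm _ hi1]
    simp only [integral_const_mul, hu]
  have hF2 : ∫ z : Torus N × ℝ, η z.2 * (inner ℝ (w z) (grad ψ z.1) + m z * lap ψ z.1) ∂(cyl N T)
      = ∫ t in Ioo 0 T, η t * h t := by
    rw [cyl, integral_prod_symm _ hi2]
    simp only [integral_const_mul, hh, fluxMoment]
  have hF3 : ∫ x, m₀ x * (ψ x * η 0) = η 0 * c := by
    rw [hc, ← integral_const_mul]
    congr 1; ext x; ring
  rw [hF1, hF2, hF3] at hmain
  -- `η` vanishes at `T` and `U` at `0`: no boundary terms in the integration by parts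
  have hηT : η T = 0 := hη0 T hτT.le
  have hIoo : ∀ f : ℝ → ℝ, ∫ t in Ioo 0 T, f t = ∫ t in (0 : ℝ)..T, f t := fun f => by
    rw [intervalIntegral.integral_of_le hT.le, integral_Ioc_eq_integral_Ioo]
  have hibp : ∫ t in (0 : ℝ)..T, η t * h t = -∫ t in (0 : ℝ)..T, ξ t * U t := by
    have h1 := AbsolutelyContinuousOnInterval.integral_mul_deriv_eq_deriv_mul
      (ContDiffOn.absolutelyContinuousOnInterval
        (hηs.of_le (by exact_mod_cast le_top)).contDiffOn : AbsolutelyContinuousOnInterval η 0 T) hUac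
    have h2 : ∫ t in (0 : ℝ)..T, η t * deriv U t = ∫ t in (0 : ℝ)..T, η t * h t := by
      apply intervalIntegral.integral_congr_ae
      filter_upwards [hhi.ae_hasDerivAt_integral] with t ht htm
      rw [(ht (uIoc_subset_uIcc htm) 0 (by simp)).deriv]
    have h3 : deriv η = ξ := funext fun t => (hηd t).deriv
    rw [h2, hηT, h3] at h1
    rw [h1, hU]
    simp
  have hξc' : ∫ t in (0 : ℝ)..T, ξ t = -η 0 := by
    rw [hη, ← intervalIntegral.integral_symm]
  have hzero : ∀ t, t ∉ Ioo 0 T → ξ t • (u t - (c + U t)) = 0 := fun t ht => by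
    rw [image_eq_zero_of_notMem_tsupport fun h => ht (hξs h), zero_smul]
  rw [← setIntegral_eq_integral_of_forall_compl_eq_zero hzero]
  have hj1 : Integrable (fun t => ξ t * u t) (volume.restrict (Ioo 0 T)) :=
    huI.bdd_mul (c := Cξ) hξ.continuous.aestronglyMeasurable (Eventually.of_forall hCξ)
  have hj2 : Integrable (fun t => ξ t * U t) (volume.restrict (Ioo 0 T)) :=
    hUI.bdd_mul (c := Cξ) hξ.continuous.aestronglyMeasurable (Eventually.of_forall hCξ)
  have hj3 : Integrable (fun t => ξ t * c) (volume.restrict (Ioo 0 T)) :=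
    (integrable_const c).bdd_mul (c := Cξ) hξ.continuous.aestronglyMeasurable
      (Eventually.of_forall hCξ)
  calc ∫ t in Ioo 0 T, ξ t • (u t - (c + U t))
      = ∫ t in Ioo 0 T, (ξ t * u t - (ξ t * c + ξ t * U t)) := by
        congr 1; ext t; rw [smul_eq_mul]; ring
    _ = (∫ t in Ioo 0 T, ξ t * u t) - ((∫ t in Ioo 0 T, ξ t * c) + ∫ t in Ioo 0 T, ξ t * U t) := by
        rw [integral_sub (g := fun t => ξ t * c + ξ t * U t) hj1 (hj3.add hj2), integral_add hj3 hj2]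
    _ = 0 := by
        rw [hIoo (fun t => η t * h t), hibp] at hmain
        rw [integral_mul_const, hIoo ξ, hξc', hIoo fun t => ξ t * U t]
        linarith

theorem ae_integrable_slice {T : ℝ} {m : Torus N × ℝ → ℝ} (hm : Integrable m (cyl N T)) :
    ∀ᵐ t ∂(volume.restrict (Ioo 0 T)), Integrable (fun x => m (x, t)) volume := by
  have h2 : Integrable m (volume.prod (volume.restrict (Ioo 0 T))) := hm
  exact h2.prod_left_ae

theorem ae_slice_nonneg {T : ℝ} {m : Torus N × ℝ → ℝ} (hm0 : ∀ᵐ z ∂(cyl N T), 0 ≤ m z) :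
    ∀ᵐ t ∂(volume.restrict (Ioo 0 T)), ∀ᵐ x : Torus N, 0 ≤ m (x, t) := by
  have h2 : ∀ᵐ z ∂((volume.restrict (Ioo 0 T)).prod (volume : Measure (Torus N))), 0 ≤ m z.swap :=
    (Measure.measurePreserving_swap (μ := volume.restrict (Ioo 0 T))
      (ν := (volume : Measure (Torus N)))).quasiMeasurePreserving.ae hm0
  exact Measure.ae_ae_of_ae_prod h2

/-- Conservation of mass. -/
theorem ae_lintegral_eq_one {T : ℝ} (hT : 0 < T) {m₀ : Torus N → ℝ} {m : Torus N × ℝ → ℝ}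
    {w : Torus N × ℝ → Vec N} (hm : Integrable m (cyl N T)) (hw : Integrable w (cyl N T))
    (hm0 : ∀ᵐ z ∂(cyl N T), 0 ≤ m z) (hmass : ∫ x, m₀ x = 1) (hFP : SolvesFP T m₀ m w) :
    ∀ᵐ t ∂(volume.restrict (Ioo 0 T)), ∫⁻ x, ENNReal.ofReal (m (x, t)) = 1 := by
  have h1 := ae_moment_eq hT hm hw hFP (ψ := fun _ => 1) contDiff_const
  have hflux : fluxMoment m w (fun _ => 1) = fun _ => 0 := by
    ext t
    have hg : ∀ x : Torus N, grad (fun _ : Torus N => (1 : ℝ)) x = 0 := fun x => by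
      simp [grad, gradient]
    have hl : ∀ x : Torus N, lap (fun _ : Torus N => (1 : ℝ)) x = 0 := fun x => by
      unfold lap; rw [InnerProductSpace.laplacian_const]; rfl
    simp [fluxMoment, hg, hl]
  filter_upwards [h1, ae_integrable_slice hm, ae_slice_nonneg hm0] with t ht hti htn
  rw [hflux] at ht
  simp only [mul_one, intervalIntegral.integral_zero, add_zero, hmass] at ht
  rw [← ofReal_integral_eq_lintegral_ofReal hti htn, ht, ENNReal.ofReal_one]

/-! ### The weakly continuous version of the density and its trace -/

theorem contDiff_mFourier_toTorus (k : Fin N → ℤ) :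
    ContDiff ℝ ∞ fun y : Vec N => UnitAddTorus.mFourier k (toTorus y) := by
  have h : (fun y : Vec N => UnitAddTorus.mFourier k (toTorus y))
      = fun y : Vec N => ∏ i, Complex.exp (2 * Real.pi * Complex.I * k i * (y i : ℝ)) := by
    ext y
    simp [UnitAddTorus.mFourier, toTorus]
  rw [h]
  refine contDiff_prod fun i _ => Complex.contDiff_exp.comp ?_
  exact contDiff_const.mul (Complex.ofRealCLM.contDiff.comp (by fun_prop))

/-- Countably many smooth functions, the real and imaginary parts of the Fourier modes, determine
a probability measure on the torus. -/
theorem exists_countable_determining (N : ℕ) : ∃ S : Set (Torus N → ℝ), S.Countable ∧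
    (∀ ψ ∈ S, TorusContDiff ∞ ψ) ∧ ∀ μ ν : ProbabilityMeasure (Torus N),
      (∀ ψ ∈ S, ∫ x, ψ x ∂(μ : Measure (Torus N)) = ∫ x, ψ x ∂(ν : Measure (Torus N))) → μ = ν := by
  refine ⟨range (fun (k : Fin N → ℤ) x => (UnitAddTorus.mFourier k x).re) ∪
    range (fun (k : Fin N → ℤ) x => (UnitAddTorus.mFourier k x).im),
    (countable_range _).union (countable_range _), ?_, ?_⟩
  · rintro _ (⟨k, rfl⟩ | ⟨k, rfl⟩)
    · exact Complex.reCLM.contDiff.comp (contDiff_mFourier_toTorus k)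
    · exact Complex.imCLM.contDiff.comp (contDiff_mFourier_toTorus k)
  intro μ ν h
  have hint : ∀ (ρ : ProbabilityMeasure (Torus N)) (g : C(Torus N, ℂ)),
      Integrable g (ρ : Measure (Torus N)) := fun ρ g =>
    g.continuous.integrable_of_hasCompactSupport (HasCompactSupport.of_compactSpace _)
  have hcont : ∀ ρ : ProbabilityMeasure (Torus N),
      Continuous fun g : C(Torus N, ℂ) => ∫ x, g x ∂(ρ : Measure (Torus N)) := by
    intro ρ
    refine (LipschitzWith.of_dist_le_mul (K := 1) fun g g' => ?_).continuous
    rw [dist_eq_norm, dist_eq_norm, ← integral_sub (hint ρ g) (hint ρ g')]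
    refine (norm_integral_le_of_norm_le_const (C := ‖g - g'‖)
      (Eventually.of_forall fun x => (g - g').norm_coe_le_norm x)).trans ?_
    simp
  have hall : ∀ g : C(Torus N, ℂ),
      ∫ x, g x ∂(μ : Measure (Torus N)) = ∫ x, g x ∂(ν : Measure (Torus N)) := by
    have hclosed : IsClosed {g : C(Torus N, ℂ) |
      ∫ x, g x ∂(μ : Measure (Torus N)) = ∫ x, g x ∂(ν : Measure (Torus N))} :=
      isClosed_eq (hcont μ) (hcont ν)
    intro g
    have hg : g ∈ closure (Submodule.span ℂ (range (UnitAddTorus.mFourier (d := Fin N))) :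
        Set C(Torus N, ℂ)) := by
      rw [← Submodule.topologicalClosure_coe, UnitAddTorus.span_mFourier_closure_eq_top]
      trivial
    refine closure_minimal (fun g hg => ?_) hclosed hg
    induction hg using Submodule.span_induction with
    | mem g hg =>
      obtain ⟨k, rfl⟩ := hg
      simp only [mem_ofPred_eq]
      rw [← integral_re_add_im (hint μ _), ← integral_re_add_im (hint ν _)]
      have h1 := h _ (Or.inl ⟨k, rfl⟩)
      have h2 := h _ (Or.inr ⟨k, rfl⟩)
      simp only [RCLike.re_to_complex, RCLike.im_to_complex]
      rw [h1, h2]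
    | zero => simp
    | add g g' _ _ h h' =>
      simp only [mem_ofPred_eq, ContinuousMap.add_apply] at h h' ⊢
      rw [integral_add (hint μ g) (hint μ g'), integral_add (hint ν g) (hint ν g'), h, h']
    | smul c g _ h =>
      simp only [mem_ofPred_eq, ContinuousMap.smul_apply] at h ⊢
      rw [integral_smul, integral_smul, h]
  refine Subtype.ext (?_ : (μ : Measure (Torus N)) = ν)
  apply ext_of_forall_integral_eq_of_IsFiniteMeasure
  intro g
  have h1 := hall ⟨fun x => (g x : ℂ), Complex.continuous_ofReal.comp g.continuous⟩
  simpa only [ContinuousMap.coe_mk, integral_complex_ofReal, Complex.ofReal_inj] using h1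

/-- In the compact space of probability measures, convergence of a determining family of moments
implies convergence. -/
theorem exists_tendsto_of_moments {S : Set (Torus N → ℝ)} (hSc : ∀ ψ ∈ S, Continuous ψ)
    (hS : ∀ μ ν : ProbabilityMeasure (Torus N),
      (∀ ψ ∈ S, ∫ x, ψ x ∂(μ : Measure (Torus N)) = ∫ x, ψ x ∂(ν : Measure (Torus N))) → μ = ν)
    {l : Filter ℝ} [l.NeBot] {f : ℝ → ProbabilityMeasure (Torus N)}
    (hf : ∀ ψ ∈ S, ∃ c, Tendsto (fun t => ∫ x, ψ x ∂(f t : Measure (Torus N))) l (𝓝 c)) :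
    ∃ μ, Tendsto f l (𝓝 μ) := by
  have hcl : ∀ ψ (hψ : ψ ∈ S), ∀ μ, MapClusterPt μ l f →
      ∫ x, ψ x ∂(μ : Measure (Torus N)) = (hf ψ hψ).choose := by
    intro ψ hψ μ hμ
    have hcont : Continuous fun ρ : ProbabilityMeasure (Torus N) =>
        ∫ x, ψ x ∂(ρ : Measure (Torus N)) := by
      rw [continuous_iff_continuousAt]
      intro ρ
      exact (ProbabilityMeasure.tendsto_iff_forall_integral_tendsto.1 tendsto_id)
        (BoundedContinuousFunction.mkOfCompact ⟨ψ, hSc ψ hψ⟩)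
    have h1 := hμ.continuousAt_comp hcont.continuousAt
    have h2 := (hf ψ hψ).choose_spec
    have h3 : ClusterPt (∫ x, ψ x ∂(μ : Measure (Torus N))) (𝓝 (hf ψ hψ).choose) :=
      ClusterPt.mono h1 h2
    exact eq_of_nhds_neBot h3
  obtain ⟨μ, hμ⟩ := exists_clusterPt_of_compactSpace (map f l)
  refine ⟨μ, tendsto_nhds_of_unique_mapClusterPt fun ν hν => hS _ _ fun ψ hψ => ?_⟩
  rw [hcl ψ hψ ν hν, hcl ψ hψ μ hμ]

theorem Icc_subset_closure_of_ae {T : ℝ} (hT : 0 < T) {p : ℝ → Prop}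
    (h : ∀ᵐ t ∂(volume.restrict (Ioo 0 T)), p t) : Icc 0 T ⊆ closure (Ioo 0 T ∩ {t | p t}) := by
  rw [← closure_Ioo hT.ne]
  apply closure_minimal _ isClosed_closure
  have h1 : Dense {t | t ∈ Ioo 0 T → p t} :=
    Measure.dense_of_ae ((ae_restrict_iff' measurableSet_Ioo).1 h)
  refine (h1.open_subset_closure_inter isOpen_Ioo).trans (closure_mono ?_)
  exact fun t ht => ⟨ht.1, ht.2 ht.1⟩

/-- The trace is the limit of `m(·, t) dx` as `t` tends to `T` among the times where the moments agree
with their continuous versions; these times have full measure, hence they are dense. -/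
theorem existsUnique_isTerminalTrace {T : ℝ} (hT : 0 < T) {m₀ : Torus N → ℝ} {m : Torus N × ℝ → ℝ}
    {w : Torus N × ℝ → Vec N} (hm : Integrable m (cyl N T)) (hw : Integrable w (cyl N T))
    (hm0 : ∀ᵐ z ∂(cyl N T), 0 ≤ m z) (hmass : ∫ x, m₀ x = 1) (hFP : SolvesFP T m₀ m w) :
    ∃! μ : ProbabilityMeasure (Torus N), IsTerminalTrace T m μ := by
  classical
  obtain ⟨S, hScount, hSsmooth, hSdet⟩ := exists_countable_determining N
  have hSc : ∀ ψ ∈ S, Continuous ψ := fun ψ hψ => (hSsmooth ψ hψ).continuous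
  set P : ℝ → Measure (Torus N) := fun t =>
    (volume : Measure (Torus N)).withDensity fun x => ENNReal.ofReal (m (x, t)) with hP
  set U : (Torus N → ℝ) → ℝ → ℝ := fun ψ t =>
    (∫ x, m₀ x * ψ x) + ∫ s in (0 : ℝ)..t, fluxMoment m w ψ s with hU
  have hUc : ∀ ψ ∈ S, ContinuousOn (U ψ) (Icc 0 T) := by
    intro ψ hψ
    have hψ2 : TorusContDiff 2 ψ :=
      ContDiff.of_le (hSsmooth ψ hψ) (WithTop.coe_le_coe.2 (le_top : (2 : ℕ∞) ≤ ⊤))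
    have h1 : IntegrableOn (fluxMoment m w ψ) (Icc 0 T) :=
      (integrableOn_Icc_iff_integrableOn_Ioo).2 (integrable_fluxMoment hm hw hψ2)
    have h2 := intervalIntegral.continuousOn_primitive_interval (a := 0) (b := T)
      (by rwa [uIcc_of_le hT.le])
    rw [uIcc_of_le hT.le] at h2
    exact continuousOn_const.add h2
  have hgood : ∀ᵐ t ∂(volume.restrict (Ioo 0 T)), IsProbabilityMeasure (P t) ∧
      ∀ ψ ∈ S, ∫ x, ψ x ∂(P t) = U ψ t := by
    have hmom : ∀ᵐ t ∂(volume.restrict (Ioo 0 T)), ∀ ψ ∈ S, ∫ x, m (x, t) * ψ x = U ψ t :=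
      (ae_ball_iff hScount).2 fun ψ hψ => ae_moment_eq hT hm hw hFP (hSsmooth ψ hψ)
    filter_upwards [ae_integrable_slice hm, ae_slice_nonneg hm0, hmom,
      ae_lintegral_eq_one hT hm hw hm0 hmass hFP]
      with t hti htn htm ht1
    refine ⟨⟨by rw [hP]; simpa using ht1⟩, fun ψ hψ => ?_⟩
    rw [← htm ψ hψ, hP]
    rw [integral_withDensity_eq_integral_toReal_smul₀ hti.aemeasurable.ennreal_ofReal
      (Eventually.of_forall fun x => ENNReal.ofReal_lt_top)]
    refine integral_congr_ae ?_
    filter_upwards [htn] with x hx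
    rw [ENNReal.toReal_ofReal hx, smul_eq_mul]
  set p : ℝ → Prop := fun t => IsProbabilityMeasure (P t) ∧ ∀ ψ ∈ S, ∫ x, ψ x ∂(P t) = U ψ t with hp
  set G := Ioo 0 T ∩ {t | p t} with hG
  have hGcl : Icc 0 T ⊆ closure G := Icc_subset_closure_of_ae hT hgood
  have hGI : G ⊆ Icc 0 T := fun t ht => Ioo_subset_Icc_self ht.1
  set f : ℝ → ProbabilityMeasure (Torus N) := fun t =>
    if h : IsProbabilityMeasure (P t) then ⟨P t, h⟩ else ⟨volume, inferInstance⟩ with hf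
  have hfP : ∀ t ∈ G, (f t : Measure (Torus N)) = P t := by
    intro t ht
    have h1 : IsProbabilityMeasure (P t) := ht.2.1
    simp [hf, h1]
  have hmomf : ∀ t ∈ Icc 0 T, ∀ ψ ∈ S,
      Tendsto (fun s => ∫ x, ψ x ∂(f s : Measure (Torus N))) (𝓝[G] t) (𝓝 (U ψ t)) := by
    intro t ht ψ hψ
    refine ((hUc ψ hψ t ht).mono_left (nhdsWithin_mono t hGI)).congr' ?_
    filter_upwards [self_mem_nhdsWithin] with s hs
    rw [hfP s hs, hs.2.2 ψ hψ]
  have hlim : ∀ t ∈ Icc 0 T, ∃ μ, Tendsto f (𝓝[G] t) (𝓝 μ) := by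
    intro t ht
    have : (𝓝[G] t).NeBot := mem_closure_iff_nhdsWithin_neBot.1 (hGcl ht)
    exact exists_tendsto_of_moments hSc hSdet fun ψ hψ => ⟨_, hmomf t ht ψ hψ⟩
  set ρ := extendFrom G f with hρ
  have hρc : ContinuousOn ρ (Icc 0 T) := continuousOn_extendFrom hGcl hlim
  have hρf : ∀ t ∈ G, ρ t = f t := by
    intro t ht
    have : (𝓝[G] t).NeBot := mem_closure_iff_nhdsWithin_neBot.1 (subset_closure ht)
    have h1 := tendsto_extendFrom (hlim t (hGI ht))
    refine hSdet _ _ fun ψ hψ => ?_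
    have h2 := (ProbabilityMeasure.tendsto_iff_forall_integral_tendsto.1 h1)
      (BoundedContinuousFunction.mkOfCompact ⟨ψ, hSc ψ hψ⟩)
    rw [hfP t ht, ht.2.2 ψ hψ]
    exact tendsto_nhds_unique h2 (hmomf t (hGI ht) ψ hψ)
  have hGae : ∀ᵐ t ∂(volume.restrict (Ioo 0 T)), t ∈ G := by
    filter_upwards [hgood, ae_restrict_mem measurableSet_Ioo] with t h1 h2 using ⟨h2, h1⟩
  refine ⟨ρ T, ⟨ρ, hρc, ?_, rfl⟩, ?_⟩
  · filter_upwards [hGae] with t ht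
    rw [hρf t ht, hfP t ht]
  · rintro _ ⟨ρ', hρ'c, hρ', rfl⟩
    have hG' : ∀ᵐ t ∂(volume.restrict (Ioo 0 T)), ρ' t = ρ t := by
      filter_upwards [hGae, hρ'] with t ht h1
      refine Subtype.ext (?_ : (ρ' t : Measure (Torus N)) = ρ t)
      rw [h1, hρf t ht]
      exact (hfP t ht).symm
    have hcl := Icc_subset_closure_of_ae hT hG'
    exact EqOn.of_subset_closure (fun t ht => ht.2) hρ'c hρc
      (fun t ht => Ioo_subset_Icc_self ht.1) hcl (right_mem_Icc.2 hT.le)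

/-! ### Bounds on the energy -/

/-- The Legendre transform turns growth of order `γ` into growth of the conjugate order `γ'`. -/
theorem legendre_growth {γ γ' : ℝ} (hγ : γ.HolderConjugate γ') {H : Vec N → ℝ} {CH : ℝ}
    (hCH : 0 < CH) (hH : ∀ p, CH⁻¹ * ‖p‖ ^ γ ≤ H p ∧ H p ≤ CH * (‖p‖ ^ γ + 1)) :
    ∃ c A : ℝ, 0 < c ∧ 0 < A ∧ ∀ q, BddAbove (range fun p : Vec N => inner ℝ p q - H p) ∧
      c * ‖q‖ ^ γ' - CH ≤ legendre H q ∧ legendre H q ≤ A * ‖q‖ ^ γ' := by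
  have hγ1 := hγ.lt
  have hγ'1 := hγ.symm.lt
  have hγ0 := hγ.pos
  have hγ'0 := hγ.symm.pos
  set ε : ℝ := CH ^ (-(1 / γ)) with hε
  have hε0 : 0 < ε := Real.rpow_pos_of_pos hCH _
  set θ : ℝ := (2 * CH) ^ (-(1 / (γ - 1))) with hθ
  have hθ0 : 0 < θ := Real.rpow_pos_of_pos (by linarith) _
  have hεγ : ε ^ γ = CH⁻¹ := by
    rw [hε, ← Real.rpow_mul hCH.le, show -(1 / γ) * γ = -1 by field_simp, Real.rpow_neg_one]
  have hθγ : CH * θ ^ γ = θ / 2 := by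
    have h1 : θ ^ (γ - 1) = (2 * CH)⁻¹ := by
      have : γ - 1 ≠ 0 := by linarith
      rw [hθ, ← Real.rpow_mul (by linarith), show -(1 / (γ - 1)) * (γ - 1) = -1 by field_simp,
        Real.rpow_neg_one]
    have h2 : θ ^ γ = θ ^ (γ - 1) * θ := by
      rw [← Real.rpow_add_one hθ0.ne', sub_add_cancel]
    rw [h2, h1]
    field_simp
  have hup : ∀ q p : Vec N, inner ℝ p q - H p ≤ (ε⁻¹) ^ γ' * ‖q‖ ^ γ' := by
    intro q p
    have h1 := real_inner_le_norm p q
    have h2 := Real.young_inequality_of_nonneg (a := ε * ‖p‖) (b := ε⁻¹ * ‖q‖) (by positivity)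
      (by positivity) hγ
    have h3 : ε * ‖p‖ * (ε⁻¹ * ‖q‖) = ‖p‖ * ‖q‖ := by field_simp
    have h4 : (ε * ‖p‖) ^ γ / γ ≤ CH⁻¹ * ‖p‖ ^ γ := by
      rw [Real.mul_rpow hε0.le (norm_nonneg _), hεγ]
      exact div_le_self (by positivity) hγ1.le
    have h5 : (ε⁻¹ * ‖q‖) ^ γ' / γ' ≤ (ε⁻¹) ^ γ' * ‖q‖ ^ γ' := by
      rw [Real.mul_rpow (by positivity) (norm_nonneg _)]
      exact div_le_self (by positivity) hγ'1.le
    linarith [(hH p).1]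
  have hbdd : ∀ q, BddAbove (range fun p : Vec N => inner ℝ p q - H p) := fun q =>
    ⟨_, by rintro _ ⟨p, rfl⟩; exact hup q p⟩
  refine ⟨θ / 2, (ε⁻¹) ^ γ', by positivity, by positivity, fun q => ⟨hbdd q, ?_, ciSup_le (hup q)⟩⟩
  -- the momentum `p` below is the maximizer, up to a constant, for `H(p) = |p|^γ`
  refine le_trans ?_ (le_ciSup (hbdd q) ((θ * ‖q‖ ^ (γ' - 2)) • q))
  have hp : ‖(θ * ‖q‖ ^ (γ' - 2)) • q‖ ^ γ = θ ^ γ * ‖q‖ ^ γ' := by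
    rcases eq_or_ne q 0 with rfl | hq
    · simp [Real.zero_rpow hγ0.ne', Real.zero_rpow hγ'0.ne']
    · have hq0 : 0 < ‖q‖ := norm_pos_iff.2 hq
      rw [norm_smul, Real.norm_of_nonneg (by positivity), mul_assoc, ← Real.rpow_add_one hq0.ne',
        Real.mul_rpow hθ0.le (by positivity), ← Real.rpow_mul hq0.le]
      congr 2
      have := hγ.symm.sub_one_mul_conj
      linarith
  have hi : inner ℝ ((θ * ‖q‖ ^ (γ' - 2)) • q) q = θ * ‖q‖ ^ γ' := by
    rcases eq_or_ne q 0 with rfl | hq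
    · simp [Real.zero_rpow hγ'0.ne']
    · have hq0 : 0 < ‖q‖ := norm_pos_iff.2 hq
      rw [inner_smul_left, real_inner_self_eq_norm_sq, ← Real.rpow_two]
      simp only [conj_trivial]
      rw [mul_assoc, ← Real.rpow_add hq0, sub_add_cancel]
  have h2 := (hH ((θ * ‖q‖ ^ (γ' - 2)) • q)).2
  rw [hp] at h2
  rw [hi]
  have h3 : CH * (θ ^ γ * ‖q‖ ^ γ' + 1) = θ / 2 * ‖q‖ ^ γ' + CH := by rw [← hθγ]; ring
  rw [h3] at h2
  linarith

theorem measurable_legendre {H : Vec N → ℝ}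
    (hb : ∀ q, BddAbove (range fun p : Vec N => inner ℝ p q - H p)) : Measurable (legendre H) := by
  have h : LowerSemicontinuous (legendre H) :=
    lowerSemicontinuous_ciSup hb fun p => Continuous.lowerSemicontinuous (by fun_prop)
  exact h.measurable

theorem toReal_runningCost (H : Vec N → ℝ) (m : ℝ) (w : Vec N) :
    (runningCost H m w).toReal = if 0 < m then m * legendre H (-(m⁻¹ • w)) else 0 := by
  unfold runningCost
  split_ifs <;> simp only [EReal.toReal_coe, EReal.toReal_zero, EReal.toReal_top]

theorem aemeasurable_toReal_runningCost {X : Type*} [MeasurableSpace X] {μ : Measure X}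
    {H : Vec N → ℝ} (hH : Measurable (legendre H)) {m : X → ℝ} {w : X → Vec N}
    (hm : AEMeasurable m μ) (hw : AEMeasurable w μ) :
    AEMeasurable (fun z => (runningCost H (m z) (w z)).toReal) μ := by
  have h : Measurable fun v : ℝ × Vec N =>
      if 0 < v.1 then v.1 * legendre H (-(v.1⁻¹ • v.2)) else 0 := by
    refine Measurable.ite (measurableSet_lt measurable_const measurable_fst) ?_ measurable_const
    exact measurable_fst.mul (hH.comp (measurable_fst.inv.smul measurable_snd).neg)
  simp only [toReal_runningCost]
  exact h.comp_aemeasurable (hm.prodMk hw)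

theorem aemeasurable_kinetic {X : Type*} [MeasurableSpace X] {μ : Measure X} (γ' : ℝ)
    {m : X → ℝ} {w : X → Vec N} (hm : AEMeasurable m μ) (hw : AEMeasurable w μ) :
    AEMeasurable (fun z => kinetic γ' (m z) (w z)) μ := by
  have h : Measurable fun v : ℝ × Vec N => kinetic γ' v.1 v.2 := by
    unfold kinetic
    refine Measurable.ite (measurableSet_lt measurable_const measurable_fst) ?_
      (Measurable.ite (measurable_snd (measurableSet_singleton 0)) measurable_const measurable_const)
    exact ((measurable_snd.norm.pow_const _).mul (measurable_fst.pow_const _)).ennreal_ofReal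
  exact h.comp_aemeasurable (hm.prodMk hw)

/-- The running cost is comparable to the kinetic energy. -/
theorem runningCost_bounds {γ' c A CH : ℝ} {H : Vec N → ℝ}
    (hL : ∀ q, c * ‖q‖ ^ γ' - CH ≤ legendre H q ∧ legendre H q ≤ A * ‖q‖ ^ γ')
    {m : ℝ} {w : Vec N} (hm : 0 ≤ m) (hkin : kinetic γ' m w ≠ ⊤) :
    runningCost H m w ≠ ⊤ ∧
      c * (kinetic γ' m w).toReal - CH * m ≤ (runningCost H m w).toReal ∧
      (runningCost H m w).toReal ≤ A * (kinetic γ' m w).toReal := by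
  rcases hm.eq_or_lt with rfl | hm0
  · have hw : w = 0 := by
      by_contra hw
      exact hkin (by simp [kinetic, hw])
    simp [kinetic, runningCost, hw]
  · have h1 : (kinetic γ' m w).toReal = ‖w‖ ^ γ' * m ^ (1 - γ') := by
      simp only [kinetic, hm0, if_true]
      exact ENNReal.toReal_ofReal (by positivity)
    have h2 : m * ‖-(m⁻¹ • w)‖ ^ γ' = ‖w‖ ^ γ' * m ^ (1 - γ') := by
      rw [norm_neg, norm_smul, norm_inv, Real.norm_of_nonneg hm,
        Real.mul_rpow (by positivity) (norm_nonneg _), Real.inv_rpow hm, Real.rpow_sub hm0,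
        Real.rpow_one]
      field_simp
    have h3 := hL (-(m⁻¹ • w))
    refine ⟨?_, ?_, ?_⟩
    · simp only [runningCost, hm0, if_true]
      exact EReal.coe_ne_top _
    · rw [toReal_runningCost, if_pos hm0, h1, ← h2]
      nlinarith [mul_le_mul_of_nonneg_left h3.1 hm]
    · rw [toReal_runningCost, if_pos hm0, h1, ← h2]
      nlinarith [mul_le_mul_of_nonneg_left h3.2 hm]

/-- Growth of the coupling and of its primitive, from the bound on its derivative. -/
theorem exists_primitive_le {α : ℝ} (hα : 0 < α) {f : Torus N → ℝ → ℝ}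
    (hfnonneg : ∀ x, ∀ s, 0 ≤ s → 0 ≤ f x s)
    (hfcont : ContinuousOn (fun z : Torus N × ℝ => f z.1 z.2) (univ ×ˢ Ici 0))
    (hfdiff : ∀ x, DifferentiableOn ℝ (f x) (Ici 0)) {cf : ℝ}
    (hf : ∀ x, ∀ s, 0 ≤ s → |derivWithin (f x) (Ici 0) s| ≤ cf * (s + 1) ^ (α - 1)) :
    ∃ C, 0 ≤ C ∧ ∀ x m, 0 ≤ m → primitive f x m ≤ C * (m ^ (α + 1) + 1) := by
  have hf0 : Continuous fun x => f x 0 :=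
    (hfcont.comp_continuous (f := fun x : Torus N => (x, (0 : ℝ))) (by fun_prop)
      fun x => ⟨trivial, le_refl (0 : ℝ)⟩)
  obtain ⟨M, hM0, hM⟩ := exists_norm_le_of_continuous hf0
  have hcf : 0 ≤ cf := by
    have := (abs_nonneg _).trans (hf 0 0 le_rfl)
    simpa using this
  have hrpow : ∀ t : ℝ, 0 ≤ t → 1 ≤ (t + 1) ^ α := fun t ht =>
    Real.one_le_rpow (by linarith) hα.le
  have hfle : ∀ x s, 0 ≤ s → f x s ≤ (M + cf / α) * (s + 1) ^ α := by
    intro x s hs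
    have hpd : ∀ t : ℝ, 0 ≤ t → HasDerivAt (fun t : ℝ => cf / α * (t + 1) ^ α)
        (cf * (t + 1) ^ (α - 1)) t := by
      intro t ht
      have h1 : HasDerivAt (fun t : ℝ => cf / α * (t + 1) ^ α)
          (cf / α * (1 * α * (t + 1) ^ (α - 1))) t := (((hasDerivAt_id t).add_const 1).rpow_const (p := α)
        (Or.inl (by simp only [id]; linarith))).const_mul (cf / α)
      convert h1 using 1
      field_simp
    have hanti : AntitoneOn (fun t => f x t - cf / α * (t + 1) ^ α) (Ici 0) := by
      refine antitoneOn_of_deriv_nonpos (convex_Ici 0) ?_ ?_ ?_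
      · exact (hfdiff x).continuousOn.sub fun t ht => (hpd t ht).continuousAt.continuousWithinAt
      · rw [interior_Ici]
        intro t ht
        exact (((hfdiff x t (mem_Ici.2 (le_of_lt ht))).differentiableAt (Ici_mem_nhds ht)).sub
          (hpd t (le_of_lt ht)).differentiableAt).differentiableWithinAt
      · rw [interior_Ici]
        intro t ht
        have ht0 : 0 ≤ t := le_of_lt ht
        have hd := (hfdiff x t ht0).differentiableAt (Ici_mem_nhds ht)
        have h1 := (hd.hasDerivAt.sub (hpd t ht0)).deriv
        have h2 := hf x t ht0
        rw [derivWithin_of_mem_nhds (Ici_mem_nhds ht)] at h2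
        have h3 := le_of_abs_le h2
        have h4 : deriv (fun t => f x t - cf / α * (t + 1) ^ α) t
            = deriv (f x) t - cf * (t + 1) ^ (α - 1) := h1
        rw [h4]
        linarith
    have h1 := hanti (mem_Ici.2 le_rfl) (mem_Ici.2 hs) hs
    have h2 := le_of_abs_le (hM x)
    have h3 := hrpow s hs
    simp only [zero_add, Real.one_rpow, mul_one] at h1
    have h4 : 0 ≤ cf / α := by positivity
    nlinarith
  set C := M + cf / α with hC
  have hC0 : 0 ≤ C := by positivity
  refine ⟨C * 2 ^ (α + 1), by positivity, fun x m hm => ?_⟩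
  have h1 : primitive f x m ≤ C * (m + 1) ^ α * m := by
    have h2 : ‖primitive f x m‖ ≤ C * (m + 1) ^ α * |m - 0| := by
      refine intervalIntegral.norm_integral_le_of_norm_le_const fun s hs => ?_
      rw [uIoc_of_le hm] at hs
      rw [Real.norm_of_nonneg (hfnonneg x s hs.1.le)]
      refine (hfle x s hs.1.le).trans (mul_le_mul_of_nonneg_left ?_ hC0)
      exact Real.rpow_le_rpow (by linarith [hs.1]) (by linarith [hs.2]) hα.le
    rw [sub_zero, abs_of_nonneg hm] at h2
    exact (le_abs_self _).trans h2
  have h2 : (m + 1) ^ α * m ≤ (m + 1) ^ (α + 1) := by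
    rw [Real.rpow_add_one (by linarith)]
    gcongr
    linarith
  have h3 : (m + 1) ^ (α + 1) ≤ 2 ^ (α + 1) * (m ^ (α + 1) + 1) := by
    rcases le_total m 1 with h | h
    · calc (m + 1) ^ (α + 1) ≤ 2 ^ (α + 1) := by gcongr; linarith
        _ ≤ _ := by
          apply le_mul_of_one_le_right (by positivity)
          have : 0 ≤ m ^ (α + 1) := by positivity
          linarith
    · calc (m + 1) ^ (α + 1) ≤ (2 * m) ^ (α + 1) := by gcongr; linarith
        _ = 2 ^ (α + 1) * m ^ (α + 1) := Real.mul_rpow (by norm_num) hm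
        _ ≤ _ := by gcongr; linarith
  calc primitive f x m ≤ C * ((m + 1) ^ α * m) := by rw [← mul_assoc]; exact h1
    _ ≤ C * (2 ^ (α + 1) * (m ^ (α + 1) + 1)) := mul_le_mul_of_nonneg_left (h2.trans h3) hC0
    _ = _ := by ring

theorem primitive_nonneg {f : Torus N → ℝ → ℝ} (hf : ∀ x, ∀ s, 0 ≤ s → 0 ≤ f x s) (x : Torus N)
    {m : ℝ} (hm : 0 ≤ m) : 0 ≤ primitive f x m :=
  intervalIntegral.integral_nonneg hm fun s hs => hf x s hs.1

theorem aestronglyMeasurable_primitive {f : Torus N → ℝ → ℝ}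
    (hfcont : ContinuousOn (fun z : Torus N × ℝ => f z.1 z.2) (univ ×ˢ Ici 0)) {T : ℝ}
    {m : Torus N × ℝ → ℝ} (hm : AEMeasurable m (cyl N T)) (hm0 : ∀ᵐ z ∂(cyl N T), 0 ≤ m z) :
    AEStronglyMeasurable (fun z => primitive f z.1 (m z)) (cyl N T) := by
  -- only the values of `f` at nonnegative arguments matter, so that `f` may be made continuous
  have hg : Continuous fun v : (Torus N × ℝ) × ℝ => f v.1.1 (max v.2 0) :=
    hfcont.comp_continuous (f := fun v : (Torus N × ℝ) × ℝ => (v.1.1, max v.2 0)) (by fun_prop)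
      fun v => ⟨trivial, mem_Ici.2 (le_max_right _ _)⟩
  have h1 : Continuous fun v : Torus N × ℝ => ∫ σ in (0 : ℝ)..v.2, f v.1 (max σ 0) :=
    intervalIntegral.continuous_parametric_intervalIntegral_of_continuous
      (f := fun (v : Torus N × ℝ) σ => f v.1 (max σ 0)) hg continuous_snd
  have h2 := h1.measurable.comp_aemeasurable (measurable_fst.aemeasurable.prodMk hm)
  refine h2.aestronglyMeasurable.congr ?_
  filter_upwards [hm0] with z hz
  refine intervalIntegral.integral_congr fun s hs => ?_
  rw [uIcc_of_le hz] at hs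
  simp only [max_eq_left hs.1]

theorem abs_integral_terminalMeasure_le {T : ℝ} {m : Torus N × ℝ → ℝ}
    (h : ∃ μ : ProbabilityMeasure (Torus N), IsTerminalTrace T m μ) {u : Torus N → ℝ} {C : ℝ}
    (hu : ∀ x, ‖u x‖ ≤ C) : |∫ x, u x ∂(terminalMeasure T m)| ≤ C := by
  rw [terminalMeasure, dif_pos h]
  refine (norm_integral_le_of_norm_le_const (Eventually.of_forall hu)).trans ?_
  simp

/-! ### Coercivity of the energy -/

theorem integrable_of_mem_K {T α γ' : ℝ} (hα : 0 < α) {m₀ : Torus N → ℝ} {m : Torus N × ℝ → ℝ}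
    {w : Torus N × ℝ → Vec N} (h : (m, w) ∈ K T α γ' m₀) : Integrable m (cyl N T) := by
  have h1 : MemLp m (ENNReal.ofReal (α + 1)) (cyl N T) := h.1
  refine h1.integrable ?_
  rw [← ENNReal.ofReal_one]
  exact ENNReal.ofReal_le_ofReal (by linarith)

theorem existsUnique_trace_of_mem_K {T α γ' : ℝ} (hT : 0 < T) (hα : 0 < α) {m₀ : Torus N → ℝ}
    (hmass : ∫ x, m₀ x = 1) {m : Torus N × ℝ → ℝ} {w : Torus N × ℝ → Vec N}
    (h : (m, w) ∈ K T α γ' m₀) : ∃! μ : ProbabilityMeasure (Torus N), IsTerminalTrace T m μ :=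
  existsUnique_isTerminalTrace hT (integrable_of_mem_K hα h) h.2.1 h.2.2.2.1 hmass h.2.2.2.2

/-- On the constraint set the energy is well defined, and it controls both the kinetic energy and the
`L^{α+1}` norm of the density: the a priori estimate on the density makes `∫ F(x, m)` negligible
with respect to the kinetic energy. -/
theorem exists_energy_coercive (hN : 0 < N) {T : ℝ} (hT : 0 < T) {γ γ' α : ℝ}
    (hγ : γ.HolderConjugate γ') (hα : 0 < α) (hsub : α < γ' / N) {H : Vec N → ℝ} {CH : ℝ}
    (hCH : 0 < CH) (hHgrowth : ∀ p, CH⁻¹ * ‖p‖ ^ γ ≤ H p ∧ H p ≤ CH * (‖p‖ ^ γ + 1))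
    {f : Torus N → ℝ → ℝ} (hfnonneg : ∀ x, ∀ s, 0 ≤ s → 0 ≤ f x s)
    (hfcont : ContinuousOn (fun z : Torus N × ℝ => f z.1 z.2) (univ ×ˢ Ici 0))
    (hfdiff : ∀ x, DifferentiableOn ℝ (f x) (Ici 0)) {cf : ℝ}
    (hf : ∀ x, ∀ s, 0 ≤ s → |derivWithin (f x) (Ici 0) s| ≤ cf * (s + 1) ^ (α - 1))
    {m₀ uT : Torus N → ℝ} (hm₀ : Continuous m₀) (hmass : ∫ x, m₀ x = 1) (huT : Continuous uT) :
    ∃ a C : ℝ, 0 < a ∧ ∀ m w, (m, w) ∈ K T α γ' m₀ → EnergyWellDefined T H f m w ∧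
      a * (∫⁻ z, kinetic γ' (m z) (w z) ∂(cyl N T)).toReal ≤ energy T H f uT m w + C ∧
      ∫⁻ z, ENNReal.ofReal (m z) ^ (α + 1) ∂(cyl N T)
        ≤ (∫⁻ z, kinetic γ' (m z) (w z) ∂(cyl N T)) + ENNReal.ofReal C := by
  obtain ⟨c, A, hc, hA, hL⟩ := legendre_growth hγ hCH hHgrowth
  obtain ⟨CF, hCF, hF⟩ := exists_primitive_le hα hfnonneg hfcont hfdiff hf
  obtain ⟨Cu, hCu, hu⟩ := exists_norm_le_of_continuous huT
  set b := CH + CF with hb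
  have hb0 : 0 < b := by positivity
  -- the size of `δ` lets half of the kinetic energy absorb the negative terms
  set δ := min 1 (c / (2 * b)) with hδ
  have hδ0 : 0 < δ := by positivity
  obtain ⟨C, hC, hest⟩ := exists_density_estimate hN hγ.symm.lt hα hsub T hm₀ hδ0
  set V : ℝ := ((cyl N T) univ).toReal with hV
  have hV0 : 0 ≤ V := ENNReal.toReal_nonneg
  refine ⟨c / 2, b * (C + V) + Cu + C, by positivity, fun m w hK => ?_⟩
  have hmi := integrable_of_mem_K hα hK
  have htr := existsUnique_trace_of_mem_K hT hα hmass hK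
  obtain ⟨hmL, hw, hkin, hm0, hFP⟩ := hK
  simp only at hmL hw hkin hm0 hFP
  obtain ⟨hXfin, hX⟩ := hest m w ⟨hmL, hw, hkin, hm0, hFP⟩ (ae_lintegral_eq_one hT hmi hw hm0 hmass hFP)
  have hkm := aemeasurable_kinetic γ' hmi.aemeasurable hw.aemeasurable
  set E := ∫⁻ z, kinetic γ' (m z) (w z) ∂(cyl N T) with hE
  set X := ∫⁻ z, ENNReal.ofReal (m z ^ (α + 1)) ∂(cyl N T) with hXdef
  have hkint : Integrable (fun z => (kinetic γ' (m z) (w z)).toReal) (cyl N T) :=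
    integrable_toReal_of_lintegral_ne_top hkm hkin.ne
  have hkE : ∫ z, (kinetic γ' (m z) (w z)).toReal ∂(cyl N T) = E.toReal :=
    integral_toReal hkm (ae_lt_top' hkm hkin.ne)
  have hp0 : 0 ≤ᵐ[cyl N T] fun z => m z ^ (α + 1) := by
    filter_upwards [hm0] with z hz using Real.rpow_nonneg hz _
  have hpint : Integrable (fun z => m z ^ (α + 1)) (cyl N T) :=
    ⟨(hmi.aemeasurable.pow_const _).aestronglyMeasurable, (hasFiniteIntegral_iff_ofReal hp0).2 hXfin⟩
  have hpX : ∫ z, m z ^ (α + 1) ∂(cyl N T) = X.toReal :=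
    integral_eq_lintegral_of_nonneg_ae hp0 hpint.aestronglyMeasurable
  have hp1 : Integrable (fun z => m z ^ (α + 1) + 1) (cyl N T) := hpint.add (integrable_const 1)
  have hrun : ∀ᵐ z ∂(cyl N T), runningCost H (m z) (w z) ≠ ⊤ ∧
      c * (kinetic γ' (m z) (w z)).toReal - CH * m z ≤ (runningCost H (m z) (w z)).toReal ∧
      (runningCost H (m z) (w z)).toReal ≤ A * (kinetic γ' (m z) (w z)).toReal := by
    filter_upwards [hm0, ae_lt_top' hkm hkin.ne] with z hz hkz
    exact runningCost_bounds (fun q => (hL q).2) hz hkz.ne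
  have hRint : Integrable (fun z => (runningCost H (m z) (w z)).toReal) (cyl N T) := by
    refine ((hkint.const_mul (c + A)).add (hmi.norm.const_mul CH)).mono'
      (aemeasurable_toReal_runningCost (measurable_legendre fun q => (hL q).1) hmi.aemeasurable
        hw.aemeasurable).aestronglyMeasurable ?_
    filter_upwards [hrun, hm0] with z hz hz0
    simp only [Pi.add_apply, Real.norm_eq_abs, abs_of_nonneg hz0]
    have hk0 : 0 ≤ (kinetic γ' (m z) (w z)).toReal := ENNReal.toReal_nonneg
    have h1 := mul_nonneg hc.le hk0
    have h2 := mul_nonneg hA.le hk0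
    have h3 := mul_nonneg hCH.le hz0
    rw [abs_le]
    constructor <;> linarith [hz.2.1, hz.2.2]
  have hFb : ∀ᵐ z ∂(cyl N T), 0 ≤ primitive f z.1 (m z) ∧
      primitive f z.1 (m z) ≤ CF * (m z ^ (α + 1) + 1) := by
    filter_upwards [hm0] with z hz
    exact ⟨primitive_nonneg hfnonneg _ hz, hF _ _ hz⟩
  have hFint : Integrable (fun z => primitive f z.1 (m z)) (cyl N T) := by
    refine (hp1.const_mul CF).mono' (aestronglyMeasurable_primitive hfcont hmi.aemeasurable hm0) ?_
    filter_upwards [hFb] with z hz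
    rw [Real.norm_of_nonneg hz.1]
    exact hz.2
  refine ⟨⟨htr, hrun.mono fun z hz => hz.1, hRint, hFint⟩, ?_, ?_⟩
  · have hterm := neg_le_of_abs_le (abs_integral_terminalMeasure_le htr.exists hu)
    have hmle : ∀ᵐ z ∂(cyl N T), m z ≤ m z ^ (α + 1) + 1 := by
      filter_upwards [hm0] with z hz
      rcases le_total (m z) 1 with h | h
      · linarith [Real.rpow_nonneg hz (α + 1)]
      · have := Real.self_le_rpow_of_one_le h (by linarith : (1 : ℝ) ≤ α + 1)
        linarith
    have hmono : ∫ z, (c * (kinetic γ' (m z) (w z)).toReal - b * (m z ^ (α + 1) + 1)) ∂(cyl N T)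
        ≤ ∫ z, ((runningCost H (m z) (w z)).toReal - primitive f z.1 (m z)) ∂(cyl N T) := by
      refine integral_mono_ae ((hkint.const_mul c).sub (hp1.const_mul b)) (hRint.sub hFint) ?_
      filter_upwards [hrun, hFb, hmle] with z h1 h2 h3
      have h4 := mul_le_mul_of_nonneg_left h3 hCH.le
      simp only [hb]
      linarith [h1.2.1, h2.2]
    rw [integral_sub (hkint.const_mul c) (hp1.const_mul b), integral_const_mul, integral_const_mul, hkE,
      integral_add hpint (integrable_const 1), hpX, integral_const, smul_eq_mul, mul_one,
      measureReal_def, ← hV] at hmono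
    have hXr : X.toReal ≤ δ * E.toReal + C := by
      have h1 := ENNReal.toReal_mono (ENNReal.add_ne_top.2
        ⟨ENNReal.mul_ne_top ENNReal.ofReal_ne_top hkin.ne, ENNReal.ofReal_ne_top⟩) hX
      rwa [ENNReal.toReal_add (ENNReal.mul_ne_top ENNReal.ofReal_ne_top hkin.ne) ENNReal.ofReal_ne_top,
        ENNReal.toReal_mul, ENNReal.toReal_ofReal hδ0.le, ENNReal.toReal_ofReal hC] at h1
    have hE0 : 0 ≤ E.toReal := ENNReal.toReal_nonneg
    have hbδ : b * (δ * E.toReal) ≤ c / 2 * E.toReal := by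
      have h1 : b * δ ≤ c / 2 := by
        calc b * δ ≤ b * (c / (2 * b)) := by gcongr; exact min_le_right _ _
          _ = c / 2 := by field_simp
      rw [← mul_assoc]
      gcongr
    have h5 := mul_le_mul_of_nonneg_left hXr hb0.le
    unfold energy
    nlinarith
  · have h1 : ∫⁻ z, ENNReal.ofReal (m z) ^ (α + 1) ∂(cyl N T) = X := by
      refine lintegral_congr_ae ?_
      filter_upwards [hm0] with z hz
      rw [ENNReal.ofReal_rpow_of_nonneg hz (by linarith)]
    rw [h1]
    refine hX.trans (add_le_add ?_ (ENNReal.ofReal_le_ofReal ?_))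
    · calc ENNReal.ofReal δ * E ≤ 1 * E := by
            gcongr
            rw [ENNReal.ofReal_le_one]
            exact min_le_left _ _
        _ = E := one_mul E
    · have : 0 ≤ b * (C + V) := by positivity
      linarith

/-! ### The constraint set is nonempty -/

theorem inner_grad_toTorus (u : Torus N → ℝ) (y v : Vec N) :
    inner ℝ (grad u (toTorus y)) v = fderiv ℝ (fun z => u (toTorus z)) y v := by
  rw [grad_toTorus, gradient, InnerProductSpace.toDual_symm_apply]

theorem integral_inner_grad_eq_zero {u : Torus N → ℝ} (hu : TorusContDiff 1 u) (v : Vec N) :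
    ∫ x, inner ℝ (grad u x) v = 0 := by
  obtain ⟨C, hC, hg⟩ := exists_norm_le_of_continuous hu.continuous_grad
  have hcs : ∀ s : ℝ, Continuous fun x => u (x + toTorus (s • v)) := fun s =>
    hu.continuous.comp (by fun_prop)
  have hint : ∀ {g : Torus N → ℝ}, Continuous g → Integrable g volume := fun hg =>
    hg.integrable_of_hasCompactSupport (HasCompactSupport.of_compactSpace _)
  have hd : ∀ (x : Torus N) (s : ℝ), HasDerivAt (fun s : ℝ => u (x + toTorus (s • v)))
      (inner ℝ (grad u (x + toTorus (s • v))) v) s := by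
    intro x s
    obtain ⟨y, rfl⟩ := toTorus_surjective x
    simp only [← toTorus_add]
    rw [inner_grad_toTorus]
    have h1 : HasFDerivAt (fun z => u (toTorus z)) (fderiv ℝ (fun z => u (toTorus z)) (y + s • v))
        (y + s • v) := (ContDiff.differentiable hu one_ne_zero _).hasFDerivAt
    have h2 : HasDerivAt (fun s : ℝ => y + s • v) v s := by
      simpa using ((hasDerivAt_id s).smul_const v).const_add y
    exact h1.comp_hasDerivAt s h2
  have h := (hasDerivAt_integral_of_dominated_loc_of_deriv_le (μ := (volume : Measure (Torus N)))
    (F := fun (s : ℝ) x => u (x + toTorus (s • v)))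
    (F' := fun (s : ℝ) x => inner ℝ (grad u (x + toTorus (s • v))) v) (x₀ := 0)
    (bound := fun _ => C * ‖v‖) univ_mem (Eventually.of_forall fun s => (hcs s).aestronglyMeasurable)
    (hint (hcs 0))
    (by
      have : Continuous fun x => inner ℝ (grad u (x + toTorus ((0 : ℝ) • v))) v :=
        (hu.continuous_grad.comp (by fun_prop)).inner continuous_const
      exact this.aestronglyMeasurable)
    (Eventually.of_forall fun x s _ => (norm_inner_le_norm _ _).trans
      (mul_le_mul_of_nonneg_right (hg _) (norm_nonneg _)))
    (integrable_const _) (Eventually.of_forall fun x s _ => hd x s)).2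
  have hconst : (fun s : ℝ => ∫ x, u (x + toTorus (s • v))) = fun _ => ∫ x, u x :=
    funext fun s => integral_add_right_eq_self u _
  rw [hconst] at h
  simpa using (h.unique (hasDerivAt_const _ _))

/-- Integration by parts on the torus. -/
theorem integral_inner_grad_add_mul_lap {u ψ : Torus N → ℝ} (hu : TorusContDiff 1 u)
    (hψ : TorusContDiff 2 ψ) :
    ∫ x, (inner ℝ (grad u x) (grad ψ x) + u x * lap ψ x) = 0 := by
  have hψ1 : ContDiff ℝ 1 (fderiv ℝ fun z : Vec N => ψ (toTorus z)) :=
    ContDiff.fderiv_right hψ (by norm_num)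
  set b := EuclideanSpace.basisFun (Fin N) ℝ with hb
  set G : Fin N → Torus N → ℝ := fun i x => u x * inner ℝ (grad ψ x) (b i) with hG
  have hGl : ∀ i, (fun y => G i (toTorus y)) = fun y =>
      u (toTorus y) * fderiv ℝ (fun z => ψ (toTorus z)) y (b i) := fun i => by
    ext y; simp only [hG, inner_grad_toTorus]
  have hGs : ∀ i, TorusContDiff 1 (G i) := fun i => by
    unfold TorusContDiff
    rw [hGl i]
    exact ContDiff.mul hu (hψ1.clm_apply contDiff_const)
  have hsum : ∀ x, inner ℝ (grad u x) (grad ψ x) + u x * lap ψ x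
      = ∑ i, inner ℝ (grad (G i) x) (b i) := by
    intro x
    obtain ⟨y, rfl⟩ := toTorus_surjective x
    have h1 : ∀ i, inner ℝ (grad (G i) (toTorus y)) (b i)
        = inner ℝ (grad u (toTorus y)) (b i) * inner ℝ (b i) (grad ψ (toTorus y))
          + u (toTorus y) * fderiv ℝ (fderiv ℝ fun z => ψ (toTorus z)) y (b i) (b i) := by
      intro i
      have hd1 : DifferentiableAt ℝ (fun z => u (toTorus z)) y :=
        ContDiff.differentiable hu one_ne_zero y
      have hd2 : DifferentiableAt ℝ (fderiv ℝ fun z => ψ (toTorus z)) y :=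
        hψ1.differentiable one_ne_zero y
      rw [inner_grad_toTorus, hGl i, fderiv_fun_mul hd1 (hd2.clm_apply (differentiableAt_const _)),
        fderiv_clm_apply hd2 (differentiableAt_const _), real_inner_comm (grad ψ (toTorus y)),
        inner_grad_toTorus, inner_grad_toTorus]
      simp
      ring
    simp only [h1]
    rw [Finset.sum_add_distrib, b.sum_inner_mul_inner, ← Finset.mul_sum, lap_toTorus]
  simp only [hsum]
  rw [integral_finsetSum]
  · exact Finset.sum_eq_zero fun i _ => integral_inner_grad_eq_zero (hGs i) (b i)
  · intro i _
    exact ((hGs i).continuous_grad.inner continuous_const).integrable_of_hasCompactSupport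
      (HasCompactSupport.of_compactSpace _)

theorem continuous_of_continuous_lift {Y : Type*} [TopologicalSpace Y] {g : Torus N × ℝ → Y}
    (h : Continuous fun z : Vec N × ℝ => g (toTorus z.1, z.2)) : Continuous g :=
  (isOpenQuotientMap_toTorus.prodMap IsOpenQuotientMap.id).isQuotientMap.continuous_iff.2 h

theorem integrable_cyl_of_continuous (T : ℝ) {g : Torus N × ℝ → ℝ} (hg : Continuous g) :
    Integrable g (cyl N T) := by
  rw [cyl_eq_restrict]
  exact (hg.continuousOn.integrableOn_compact (isCompact_univ.prod isCompact_Icc)).mono_set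
    (prod_mono le_rfl Ioo_subset_Icc_self)

theorem fderiv_partial {Φ : Vec N × ℝ → ℝ} (hΦ : Differentiable ℝ Φ) (y : Vec N) (t : ℝ) (e : Vec N) :
    fderiv ℝ (fun z => Φ (z, t)) y e = fderiv ℝ Φ (y, t) (e, 0) := by
  have h1 : HasFDerivAt (fun z : Vec N => (z, t)) (ContinuousLinearMap.inl ℝ (Vec N) ℝ) y :=
    hasFDerivAt_prodMk_left y t
  have h2 := ((hΦ (y, t)).hasFDerivAt.comp y h1).fderiv
  have h3 : fderiv ℝ (fun z => Φ (z, t)) y = _ := h2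
  rw [h3]
  simp

/-- The stationary pair `(m₀, ∇m₀)` satisfies the constraint. -/
theorem stationary_mem_K {T : ℝ} (hT : 0 < T) {α γ' : ℝ} (hγ' : 1 < γ') {m₀ : Torus N → ℝ}
    (hm₀ : TorusContDiff 2 m₀) (hpos : ∀ x, 0 < m₀ x) :
    ((fun z => m₀ z.1, fun z => grad m₀ z.1) :
      (Torus N × ℝ → ℝ) × (Torus N × ℝ → Vec N)) ∈ K T α γ' m₀ := by
  have hm1 : TorusContDiff 1 m₀ := ContDiff.of_le hm₀ (by norm_num)
  have hc := hm₀.continuous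
  have hgc := hm1.continuous_grad
  obtain ⟨C, -, hC⟩ := exists_norm_le_of_continuous hc
  obtain ⟨C', -, hC'⟩ := exists_norm_le_of_continuous hgc
  refine ⟨?_, ?_, ?_, ?_, ?_⟩
  · exact MemLp.of_bound (hc.comp continuous_fst).aestronglyMeasurable C
      (Eventually.of_forall fun z => hC z.1)
  · exact Integrable.of_bound (hgc.comp continuous_fst).aestronglyMeasurable C'
      (Eventually.of_forall fun z => hC' z.1)
  · have hk : Continuous fun x => ‖grad m₀ x‖ ^ γ' * m₀ x ^ (1 - γ') :=
      (hgc.norm.rpow_const fun x => Or.inr (by linarith)).mul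
        (hc.rpow_const fun x => Or.inl (hpos x).ne')
    obtain ⟨B, -, hB⟩ := exists_norm_le_of_continuous hk
    calc ∫⁻ z : Torus N × ℝ, kinetic γ' (m₀ z.1) (grad m₀ z.1) ∂(cyl N T)
        ≤ ∫⁻ _, ENNReal.ofReal B ∂(cyl N T) := by
          refine lintegral_mono fun z => ?_
          simp only [kinetic, hpos, if_true]
          exact ENNReal.ofReal_le_ofReal (le_of_abs_le (hB z.1))
      _ < ⊤ := by
          rw [lintegral_const]
          exact ENNReal.mul_lt_top ENNReal.ofReal_lt_top (measure_lt_top _ _)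
  · exact Eventually.of_forall fun z => (hpos z.1).le
  · rintro φ ⟨hφ, τ, hτT, hτ⟩
    simp only
    set Φ : Vec N × ℝ → ℝ := fun y => φ (toTorus y.1, y.2) with hΦ
    have hΦd : Differentiable ℝ Φ := hφ.differentiable (by simp)
    have hΦf : ∀ e : Vec N, ContDiff ℝ ∞ fun p => fderiv ℝ Φ p (e, 0) := fun e =>
      (hφ.fderiv_right (by simp)).clm_apply contDiff_const
    have hsl : ∀ t, TorusContDiff 2 fun x => φ (x, t) := fun t =>
      (hφ.comp (contDiff_id.prodMk contDiff_const)).of_le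
        (WithTop.coe_le_coe.2 (le_top : (2 : ℕ∞) ≤ ⊤))
    have hsl1 : ∀ t, TorusContDiff 1 fun x => φ (x, t) := fun t =>
      ContDiff.of_le (hsl t) (by norm_num)
    have htime : ∀ x : Torus N, ContDiff ℝ 1 fun s => φ (x, s) := by
      intro x
      obtain ⟨y, rfl⟩ := toTorus_surjective x
      exact (hφ.comp (contDiff_const.prodMk contDiff_id)).of_le
        (WithTop.coe_le_coe.2 (le_top : (1 : ℕ∞) ≤ ⊤))
    have hct : Continuous fun z : Torus N × ℝ => deriv (fun s => φ (z.1, s)) z.2 := by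
      apply continuous_of_continuous_lift
      have h1 : (fun z : Vec N × ℝ => deriv (fun s => φ (toTorus z.1, s)) z.2)
          = fun z => fderiv ℝ Φ z (0, 1) := by
        ext z
        have h2 := ((hΦd (z.1, z.2)).hasFDerivAt.comp_hasDerivAt z.2
          ((hasDerivAt_const z.2 z.1).prodMk (hasDerivAt_id z.2))).deriv
        exact h2
      simp only [h1]
      exact (hφ.continuous_fderiv (by simp)).clm_apply continuous_const
    have hcl : Continuous fun z : Torus N × ℝ => lap (fun x => φ (x, z.2)) z.1 := by
      apply continuous_of_continuous_lift
      have h1 : ∀ z : Vec N × ℝ, lap (fun x => φ (x, z.2)) (toTorus z.1)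
          = ∑ i, fderiv ℝ (fun p => fderiv ℝ Φ p (EuclideanSpace.basisFun (Fin N) ℝ i, 0)) z
            (EuclideanSpace.basisFun (Fin N) ℝ i, 0) := by
        intro z
        rw [lap_toTorus]
        refine Finset.sum_congr rfl fun i _ => ?_
        set e := EuclideanSpace.basisFun (Fin N) ℝ i
        rw [← fderiv_partial ((hΦf e).differentiable (by simp))]
        have h2 : (fun y : Vec N => fderiv ℝ Φ (y, z.2) (e, 0))
            = fun y => fderiv ℝ (fun y => φ (toTorus y, z.2)) y e := by
          ext y; rw [← fderiv_partial hΦd]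
        rw [h2, fderiv_clm_apply (((ContDiff.fderiv_right (hsl z.2) (m := 1)
          (by norm_num)).differentiable one_ne_zero) _) (differentiableAt_const _)]
        simp
      simp only [h1]
      refine continuous_finsetSum _ fun i _ => ?_
      exact ((hΦf _).continuous_fderiv (by simp)).clm_apply continuous_const
    have hcg : Continuous fun z : Torus N × ℝ =>
        inner ℝ (grad m₀ z.1) (grad (fun x => φ (x, z.2)) z.1) := by
      have h0 : ∀ z : Torus N × ℝ, inner ℝ (grad m₀ z.1) (grad (fun x => φ (x, z.2)) z.1)
          = ∑ i, inner ℝ (grad m₀ z.1) (EuclideanSpace.basisFun (Fin N) ℝ i)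
            * inner ℝ (grad (fun x => φ (x, z.2)) z.1) (EuclideanSpace.basisFun (Fin N) ℝ i) := by
        intro z
        rw [← (EuclideanSpace.basisFun (Fin N) ℝ).sum_inner_mul_inner]
        simp only [real_inner_comm]
      simp only [h0]
      refine continuous_finsetSum _ fun i _ => Continuous.mul
        ((hgc.comp continuous_fst).inner continuous_const) (continuous_of_continuous_lift ?_)
      have h1 : ∀ z : Vec N × ℝ, inner ℝ (grad (fun x => φ (x, z.2)) (toTorus z.1))
          (EuclideanSpace.basisFun (Fin N) ℝ i)
            = fderiv ℝ Φ z (EuclideanSpace.basisFun (Fin N) ℝ i, 0) := fun z => by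
        rw [inner_grad_toTorus, ← fderiv_partial hΦd]
      simp only [h1]
      exact (hΦf _).continuous
    have hi1 : Integrable (fun z : Torus N × ℝ => m₀ z.1 * deriv (fun s => φ (z.1, s)) z.2)
        (cyl N T) := integrable_cyl_of_continuous T ((hc.comp continuous_fst).mul hct)
    have hi2 : Integrable (fun z : Torus N × ℝ =>
        inner ℝ (grad m₀ z.1) (grad (fun x => φ (x, z.2)) z.1)
          + m₀ z.1 * lap (fun x => φ (x, z.2)) z.1) (cyl N T) :=
      integrable_cyl_of_continuous T (hcg.add ((hc.comp continuous_fst).mul hcl))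
    have hsplit : ∀ z : Torus N × ℝ, m₀ z.1 * deriv (fun s => φ (z.1, s)) z.2
          + inner ℝ (grad m₀ z.1) (grad (fun x => φ (x, z.2)) z.1)
          + m₀ z.1 * lap (fun x => φ (x, z.2)) z.1
        = m₀ z.1 * deriv (fun s => φ (z.1, s)) z.2
          + (inner ℝ (grad m₀ z.1) (grad (fun x => φ (x, z.2)) z.1)
            + m₀ z.1 * lap (fun x => φ (x, z.2)) z.1) := fun z => add_assoc _ _ _
    simp only [hsplit]
    have hA : ∫ z : Torus N × ℝ, m₀ z.1 * deriv (fun s => φ (z.1, s)) z.2 ∂(cyl N T)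
        = ∫ x, m₀ x * -φ (x, 0) := by
      rw [cyl, integral_prod _ hi1]
      congr 1
      ext x
      have h1 : ∫ t in Ioo 0 T, deriv (fun s => φ (x, s)) t = -φ (x, 0) := by
        rw [← integral_Ioc_eq_integral_Ioo, ← intervalIntegral.integral_of_le hT.le,
          intervalIntegral.integral_deriv_eq_sub
            (fun t _ => (htime x).differentiable one_ne_zero t)
            (((htime x).continuous_deriv le_rfl).intervalIntegrable _ _), hτ x T hτT.le, zero_sub]
      simp only [integral_const_mul, h1]
    have hB : ∫ z : Torus N × ℝ, (inner ℝ (grad m₀ z.1) (grad (fun x => φ (x, z.2)) z.1)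
        + m₀ z.1 * lap (fun x => φ (x, z.2)) z.1) ∂(cyl N T) = 0 := by
      rw [cyl, integral_prod_symm _ hi2]
      simp [integral_inner_grad_add_mul_lap hm1 (hsl _)]
    rw [integral_add hi1 hi2, hA, hB]
    simp [integral_neg]

end MFG

theorem lemma3p2 (N : ℕ) (hN : 0 < N) (T : ℝ) (hT : 0 < T)
    (γ γ' α : ℝ) (hγ : γ.HolderConjugate γ') (hα : 0 < α) (hsub : α < γ' / N)
    (H : MFG.Vec N → ℝ) (hHconv : ConvexOn ℝ univ H) (hHreg : ContDiff ℝ 3 H)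
    (CH : ℝ) (hCH : 0 < CH)
    (hHgrowth : ∀ p, CH⁻¹ * ‖p‖ ^ γ ≤ H p ∧ H p ≤ CH * (‖p‖ ^ γ + 1))
    (f : MFG.Torus N → ℝ → ℝ) (hfnonneg : ∀ x, ∀ s, 0 ≤ s → 0 ≤ f x s)
    (hfcont : ContinuousOn (fun z : MFG.Torus N × ℝ => f z.1 z.2) (univ ×ˢ Ici 0))
    (hfdiff : ∀ x, DifferentiableOn ℝ (f x) (Ici 0))
    (cf : ℝ) (hf : ∀ x, ∀ s, 0 ≤ s → |derivWithin (f x) (Ici 0) s| ≤ cf * (s + 1) ^ (α - 1))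
    (m₀ uT : MFG.Torus N → ℝ) (hm₀reg : MFG.TorusContDiff 2 m₀) (hm₀pos : ∀ x, 0 < m₀ x)
    (hm₀mass : ∫ x, m₀ x = 1) (huT : MFG.TorusContDiff 2 uT) :
    (∀ mw ∈ MFG.K T α γ' m₀, MFG.EnergyWellDefined T H f mw.1 mw.2) ∧
    (∃ c : ℝ, IsGLB ((fun mw => MFG.energy T H f uT mw.1 mw.2) '' MFG.K T α γ' m₀) c) ∧
    (∀ e : ℝ, ∃ c₁ : ℝ, ∀ (m : ℕ → MFG.Torus N × ℝ → ℝ) (w : ℕ → MFG.Torus N × ℝ → MFG.Vec N),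
      (∀ n, (m n, w n) ∈ MFG.K T α γ' m₀) →
      (∀ n, MFG.energy T H f uT (m n) (w n) ≤ e) →
      ∀ n, (∫⁻ z, ENNReal.ofReal (m n z) ^ (α + 1) ∂(MFG.cyl N T))
        + (∫⁻ z, MFG.kinetic γ' (m n z) (w n z) ∂(MFG.cyl N T)) ≤ ENNReal.ofReal c₁) := by
  obtain ⟨a, C, ha, hmain⟩ := MFG.exists_energy_coercive hN hT hγ hα hsub hCH hHgrowth hfnonneg
    hfcont hfdiff hf hm₀reg.continuous hm₀mass huT.continuous
  refine ⟨fun mw h => (hmain mw.1 mw.2 h).1, ?_, fun e => ⟨2 * ((e + C) / a) + |C|, ?_⟩⟩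
  · refine ⟨_, Real.isGLB_sInf ⟨_, mem_image_of_mem _
      (MFG.stationary_mem_K hT hγ.symm.lt hm₀reg hm₀pos)⟩ ⟨-C, ?_⟩⟩
    rintro _ ⟨mw, h, rfl⟩
    have h1 := (hmain mw.1 mw.2 h).2.1
    have h2 := mul_nonneg ha.le
      (ENNReal.toReal_nonneg (a := ∫⁻ z, MFG.kinetic γ' (mw.1 z) (mw.2 z) ∂(MFG.cyl N T)))
    simp only
    linarith
  · intro m w hK he n
    obtain ⟨-, h1, h2⟩ := hmain (m n) (w n) (hK n)
    have hkin : (∫⁻ z, MFG.kinetic γ' (m n z) (w n z) ∂(MFG.cyl N T)) < ⊤ := (hK n).2.2.1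
    set E := ∫⁻ z, MFG.kinetic γ' (m n z) (w n z) ∂(MFG.cyl N T)
    have h3 : E.toReal ≤ (e + C) / a := by
      rw [le_div_iff₀ ha]
      linarith [he n]
    have h4 : E ≤ ENNReal.ofReal ((e + C) / a) :=
      (ENNReal.le_ofReal_iff_toReal_le hkin.ne (ENNReal.toReal_nonneg.trans h3)).2 h3
    have h0 : 0 ≤ (e + C) / a := ENNReal.toReal_nonneg.trans h3
    calc _ ≤ E + ENNReal.ofReal C + E := by gcongr
      _ ≤ ENNReal.ofReal ((e + C) / a) + ENNReal.ofReal |C| + ENNReal.ofReal ((e + C) / a) := by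
          gcongr
          exact le_abs_self C
      _ = ENNReal.ofReal (2 * ((e + C) / a) + |C|) := by
          rw [← ENNReal.ofReal_add h0 (abs_nonneg C), ← ENNReal.ofReal_add (by positivity) h0]
          congr 1
          ring
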